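/- Let $P=\{x\in\mathbb R^2 : l_i(x)=\langle x,n_i\rangle-c_i\ge 0,\ i=1,\dots,d\}$ be a Delzant polygon: $P$ is compact with non-empty interior, $n_i\in\mathbb Z^2$, $c_i\in\mathbb R$, each $P_i=P\cap\{l_i=0\}$ is an edge of $P$, and at every vertex of $P$ exactly two edges meet and their normals form a basis of $\mathbb Z^2$. Let $X$ be the corresponding closed toric surface, i.e. the quotient of $P\times\mathbb R^2/2\pi\mathbb Z^2$ in which over each face of $P$ the subtorus generated by the normals of the edges containing that face is collapsed. Let $d\sigma$ be the measure on $\partial P$ equal to $\frac1{|n_i|}$ times arc length on $P_i$. A symplectic potential on $P$ is a function of the form $u=f+\sum_{i=1}^d\frac12\, l_i\ln l_i$ with $f$ smooth on $P$ up to the boundary, which is strictly convex in the sense that the Hessian of $u$ is positive definite in the interior of $P$ and, for each edge of $P$, the second derivative of the restriction of $u$ to the edge is positive in the interior of the edge. It determines the Kähler metric on $X$ that equals $\sum u_{ij}\,dx_i\,dx_j+\sum u^{ij}\,d\theta_i\,d\theta_j$ over the interior of $P$, where $(u_{ij})=D^2u$ and $(u^{ij})=(u_{ij})^{-1}$. The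 potential $u$ is normalized at an interior point $x_0$ of $P$ if $u(x_0)=0$ and $Du(x_0)=0$. **Theorem.** For every Delzant polygon $P$ and all real $C_1,C_2$ there is a constant $C=C(C_1,C_2,P)$ such that the following holds. If $u$ is a symplectic potential on $P$, normalized at some interior point of $P$, such that the Riemannian curvature tensor of the metric of $u$ on $X$ satisfies $|Rm|\le C_1$ and $$\int_{\partial P}u\,d\sigma<C_2,$$ then the diameter of $X$ with the metric of $u$ is at most $C$ and $\max_P u\le C$. -/

import Mathlib

open MeasureTheory Set
open scoped ENNReal ContDiff Matrix

noncomputable section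

/-! ### Riemannian curvature of a metric tensor in coordinates -/

namespace CoordMetric

variable {ι : Type} [Fintype ι] [DecidableEq ι]

/-- The partial derivative `∂ f / ∂ x_i` at `x`. -/
def pd (i : ι) (f : EuclideanSpace ℝ ι → ℝ) (x : EuclideanSpace ℝ ι) : ℝ :=
  fderiv ℝ f x (EuclideanSpace.single i 1)

/-- The Hessian matrix `(∂_i ∂_j u)` at `x`. -/
def hess (u : EuclideanSpace ℝ ι → ℝ) (x : EuclideanSpace ℝ ι) : Matrix ι ι ℝ :=
  Matrix.of fun i j => pd i (pd j u) x

/-- Christoffel symbols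
`Γ^a_{bc} = ½ g^{ae} (∂_b g_{ec} + ∂_c g_{eb} - ∂_e g_{bc})` of a metric tensor `g`. -/
def christoffel (g : EuclideanSpace ℝ ι → Matrix ι ι ℝ) (a b c : ι)
    (x : EuclideanSpace ℝ ι) : ℝ :=
  (1 / 2) * ∑ e, (g x)⁻¹ a e *
    (pd b (fun y => g y e c) x + pd c (fun y => g y e b) x - pd e (fun y => g y b c) x)

/-- The Riemann curvature tensor
`R^a_{bcd} = ∂_c Γ^a_{db} - ∂_d Γ^a_{cb} + Γ^a_{ce} Γ^e_{db} - Γ^a_{de} Γ^e_{cb}`. -/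
def riemann (g : EuclideanSpace ℝ ι → Matrix ι ι ℝ) (a b c d : ι)
    (x : EuclideanSpace ℝ ι) : ℝ :=
  pd c (christoffel g a d b) x - pd d (christoffel g a c b) x +
    ∑ e, (christoffel g a c e x * christoffel g e d b x -
      christoffel g a d e x * christoffel g e c b x)

/-- The pointwise norm `|Rm|` of the curvature tensor,
`|Rm|² = g_{aa'} g^{bb'} g^{cc'} g^{dd'} R^a_{bcd} R^{a'}_{b'c'd'}`. -/
def riemannNorm (g : EuclideanSpace ℝ ι → Matrix ι ι ℝ) (x : EuclideanSpace ℝ ι) : ℝ :=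
  Real.sqrt (∑ a, ∑ b, ∑ c, ∑ d, ∑ a', ∑ b', ∑ c', ∑ d',
    g x a a' * (g x)⁻¹ b b' * (g x)⁻¹ c c' * (g x)⁻¹ d d' *
      riemann g a b c d x * riemann g a' b' c' d' x)

end CoordMetric

/-! ### Delzant polygons -/

/-- A Delzant polygon `P = {x ∈ ℝ² | ⟨x, n_i⟩ - c_i ≥ 0, i = 1, …, d}`. -/
structure DelzantPolygon where
  /-- number of facets -/
  d : ℕ
  /-- inward integral normals -/
  normal : Fin d → Fin 2 → ℤ
  /-- the constants `c_i` -/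
  offset : Fin d → ℝ
  compact : IsCompact
    {x : EuclideanSpace ℝ (Fin 2) | ∀ i, 0 ≤ (∑ k, (normal i k : ℝ) * x k) - offset i}
  /-- `P` has interior points -/
  exists_interior : ∃ x : EuclideanSpace ℝ (Fin 2),
    ∀ i, 0 < (∑ k, (normal i k : ℝ) * x k) - offset i
  /-- every inequality cuts out a genuine (one-dimensional) facet -/
  exists_facet : ∀ i, ∃ x : EuclideanSpace ℝ (Fin 2),
    (∑ k, (normal i k : ℝ) * x k) - offset i = 0 ∧
      ∀ j, j ≠ i → 0 < (∑ k, (normal j k : ℝ) * x k) - offset j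
  /-- Delzant condition: at a vertex, i.e. at a point of `P` on two different facets `i`, `j`,
  the normals `n_i`, `n_j` form a basis of `ℤ²` and there is no third facet. -/
  delzant : ∀ x : EuclideanSpace ℝ (Fin 2),
    (∀ k, 0 ≤ (∑ m, (normal k m : ℝ) * x m) - offset k) → ∀ i j, i ≠ j →
    (∑ m, (normal i m : ℝ) * x m) - offset i = 0 →
    (∑ m, (normal j m : ℝ) * x m) - offset j = 0 →
    IsUnit (Matrix.of ![normal i, normal j]).det ∧
      ∀ k, (∑ m, (normal k m : ℝ) * x m) - offset k = 0 → k = i ∨ k = j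

namespace DelzantPolygon

open CoordMetric

variable (P : DelzantPolygon)

/-- The normal `n_i` as a vector of the Euclidean plane. -/
def normalVec (i : Fin P.d) : EuclideanSpace ℝ (Fin 2) :=
  WithLp.toLp 2 fun k => (P.normal i k : ℝ)

/-- The affine function `l_i(x) = ⟨x, n_i⟩ - c_i`. -/
def l (i : Fin P.d) (x : EuclideanSpace ℝ (Fin 2)) : ℝ :=
  (∑ k, (P.normal i k : ℝ) * x k) - P.offset i

/-- The closed polygon as a subset of the plane. -/
def carrier : Set (EuclideanSpace ℝ (Fin 2)) := {x | ∀ i, 0 ≤ P.l i x}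

/-- The `i`-th facet (edge) of the polygon. -/
def facet (i : Fin P.d) : Set (EuclideanSpace ℝ (Fin 2)) := {x ∈ P.carrier | P.l i x = 0}

/-- The measure `dσ` on `∂P`: on the `i`-th facet it is `1 / |n_i|` times Lebesgue measure
(arc length). -/
def boundaryMeasure : Measure (EuclideanSpace ℝ (Fin 2)) :=
  ∑ i, ENNReal.ofReal (1 / ‖P.normalVec i‖) • (Measure.hausdorffMeasure 1).restrict (P.facet i)

/-! ### Symplectic potentials -/

/-- `u` is a symplectic potential on `P`: `u = f + ∑ ½ l_i ln l_i` on `P` with `f` smooth up to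
the boundary, and `u` is strictly convex in the sense that its second derivative is positive
definite on the interior of every face of `P`: in all directions `w` at an interior point, in the
direction of the facet at a point inside a facet (and no condition at a vertex). These are the
potentials whose metrics below are Riemannian metrics on the closed toric surface. -/
def IsSymplecticPotential (u : EuclideanSpace ℝ (Fin 2) → ℝ) : Prop :=
  (∃ f : EuclideanSpace ℝ (Fin 2) → ℝ, ContDiffOn ℝ ∞ f P.carrier ∧
    ∀ x ∈ P.carrier, u x = f x + ∑ i, (1 / 2) * (P.l i x * Real.log (P.l i x))) ∧
  ∀ x ∈ P.carrier, ∀ w : EuclideanSpace ℝ (Fin 2), w ≠ 0 →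
    (∀ i, P.l i x = 0 → ∑ k, (P.normal i k : ℝ) * w k = 0) →
    0 < iteratedDeriv 2 (fun t : ℝ => u (x + t • w)) 0

/-- `u` is normalized at the interior point `x₀`. -/
def IsNormalizedAt (u : EuclideanSpace ℝ (Fin 2) → ℝ) (x₀ : EuclideanSpace ℝ (Fin 2)) : Prop :=
  x₀ ∈ interior P.carrier ∧ u x₀ = 0 ∧ fderiv ℝ u x₀ = 0

/-! ### The toric Kähler metric on the open orbit and its curvature

Points of `ℝ² × ℝ²` are written `(x, θ)`, with index set `Fin 2 ⊕ Fin 2`. The angles `θ` are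
taken modulo `2π ℤ²`. -/

/-- The toric Kähler metric `u_{ij} dx_i dx_j + u^{ij} dθ_i dθ_j` in action-angle coordinates,
where `(u^{ij})` is the inverse of the Hessian `(u_{ij})`. -/
def metric (u : EuclideanSpace ℝ (Fin 2) → ℝ) (q : EuclideanSpace ℝ (Fin 2 ⊕ Fin 2)) :
    Matrix (Fin 2 ⊕ Fin 2) (Fin 2 ⊕ Fin 2) ℝ :=
  Matrix.fromBlocks (hess u (WithLp.toLp 2 fun i => q (Sum.inl i))) 0 0
    (hess u (WithLp.toLp 2 fun i => q (Sum.inl i)))⁻¹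

/-- The Riemannian curvature of the toric metric of `u` satisfies `|Rm| ≤ K` at all points of the
open dense orbit `P° × T²`, hence, the metric being smooth, on the whole toric surface. -/
def CurvatureBoundedBy (u : EuclideanSpace ℝ (Fin 2) → ℝ) (K : ℝ) : Prop :=
  ∀ q : EuclideanSpace ℝ (Fin 2 ⊕ Fin 2),
    (WithLp.toLp 2 fun i => q (Sum.inl i)) ∈ interior P.carrier →
    riemannNorm (metric u) q ≤ K

/-! ### The toric surface -/

/-- For `x ∈ P`, the subgroup `2π ℤ² + span_ℝ {n_i | l_i(x) = 0}` of the angle space: the preimage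
in `ℝ²` of the stabilizer in `T² = ℝ² / 2π ℤ²` of the points over `x`. -/
def stab (x : EuclideanSpace ℝ (Fin 2)) : AddSubgroup (EuclideanSpace ℝ (Fin 2)) :=
  AddSubgroup.closure (range fun k : Fin 2 => EuclideanSpace.single k (2 * Real.pi)) ⊔
    (Submodule.span ℝ (P.normalVec '' {i | P.l i x = 0})).toAddSubgroup

/-- Two pairs `(x, θ)` are identified when they have the same `x` and their angles differ by an
element of the stabilizer. -/
def surfaceSetoid : Setoid (P.carrier × EuclideanSpace ℝ (Fin 2)) where
  r p q := p.1 = q.1 ∧ p.2 - q.2 ∈ P.stab p.1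
  iseqv :=
    { refl := fun p => ⟨rfl, by simp [(P.stab p.1).zero_mem]⟩
      symm := by
        rintro p q ⟨h, h2⟩
        refine ⟨h.symm, ?_⟩
        rw [← h, ← neg_sub]
        exact (P.stab p.1).neg_mem h2
      trans := by
        rintro p q r ⟨h, h2⟩ ⟨k, k2⟩
        refine ⟨h.trans k, ?_⟩
        rw [← h] at k2
        have := (P.stab p.1).add_mem h2 k2
        simpa using this }

/-- The toric surface `X` with moment polygon `P`: the quotient of `P × T²` in which, over a face
of `P`, the subtorus generated by the normals of the facets through that face is collapsed. -/
def Surface : Type := Quotient P.surfaceSetoid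

/-- The point of the toric surface with moment image `x` and angle `θ`. -/
def mkPoint (x : P.carrier) (θ : EuclideanSpace ℝ (Fin 2)) : P.Surface :=
  Quotient.mk P.surfaceSetoid (x, θ)

/-- An ordered pair of different facets meeting in a vertex of `P`. -/
def IsCorner (a : Fin 2 → Fin P.d) : Prop :=
  a 0 ≠ a 1 ∧ ∃ v ∈ P.carrier, P.l (a 0) v = 0 ∧ P.l (a 1) v = 0

/-- The matrix with the two normals of a corner as rows. -/
def cornerMatrix (a : Fin 2 → Fin P.d) : Matrix (Fin 2) (Fin 2) ℝ :=
  Matrix.of fun k m => (P.normal (a k) m : ℝ)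

/-- The moment map in the complex coordinates `z ∈ ℂ²` at a corner `a`: the point `x` with
`l_{a k}(x) = |z_k|² / 2` for `k = 0, 1`. -/
def chartMoment (a : Fin 2 → Fin P.d) (z : Fin 2 → ℂ) : EuclideanSpace ℝ (Fin 2) :=
  WithLp.toLp 2 ((P.cornerMatrix a)⁻¹ *ᵥ fun k => ‖z k‖ ^ 2 / 2 + P.offset (a k))

/-- The angle in the complex coordinates at a corner: `θ = ∑ arg(z_k) n_{a k}`. -/
def chartAngle (a : Fin 2 → Fin P.d) (z : Fin 2 → ℂ) : EuclideanSpace ℝ (Fin 2) :=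
  ∑ k, Complex.arg (z k) • P.normalVec (a k)

/-- The domain in `ℂ²` of the coordinates at a corner: the points over `P` minus the facets
which do not pass through that corner. -/
def chartDomain (a : Fin 2 → Fin P.d) : Set (Fin 2 → ℂ) :=
  {z | P.chartMoment a z ∈ P.carrier ∧ ∀ k, k ∉ range a → 0 < P.l k (P.chartMoment a z)}

/-- The complex coordinates at a corner, as a parametrization of a part of the toric surface. -/
def chartPoint (a : Fin 2 → Fin P.d) (z : Fin 2 → ℂ) (hz : z ∈ P.chartDomain a) : P.Surface :=
  P.mkPoint ⟨P.chartMoment a z, hz.1⟩ (P.chartAngle a z)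

/-- The differential of `z ↦ (x, θ)` at a point `z` with non-zero coordinates, applied to `w`:
`d l_{a k} = d (|z_k|² / 2) = Re (conj z_k w_k)` and `d arg z_k = Im (w_k / z_k)`. -/
def chartDiff (a : Fin 2 → Fin P.d) (z w : Fin 2 → ℂ) : Fin 2 ⊕ Fin 2 → ℝ :=
  Sum.elim ((P.cornerMatrix a)⁻¹ *ᵥ fun k => ((starRingEnd ℂ) (z k) * w k).re)
    ((P.cornerMatrix a)ᵀ *ᵥ fun k => (w k / z k).im)

/-- The squared length of the tangent vector `w` at `z` for the pull-back of the metric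
`u_{ij} dx_i dx_j + u^{ij} dθ_i dθ_j` to the part of the chart where both coordinates are
non-zero. -/
def pullbackMetric (u : EuclideanSpace ℝ (Fin 2) → ℝ) (a : Fin 2 → Fin P.d)
    (w z : Fin 2 → ℂ) : ℝ :=
  P.chartDiff a z w ⬝ᵥ
    (metric u (WithLp.toLp 2 (Sum.elim (P.chartMoment a z) (P.chartAngle a z))) *ᵥ
      P.chartDiff a z w)

/-- The Riemannian metric of the toric surface in the complex coordinates at a corner: the
extension by continuity of `pullbackMetric` from the dense set where both coordinates are non-zero
(for a symplectic potential the extension exists and is smooth and positive definite). -/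
def chartMetric (u : EuclideanSpace ℝ (Fin 2) → ℝ) (a : Fin 2 → Fin P.d)
    (z w : Fin 2 → ℂ) : ℝ :=
  extendFrom {z' : Fin 2 → ℂ | ∀ k, z' k ≠ 0} (P.pullbackMetric u a w) z

/-- The length of a curve `γ : [0, 1] → ℂ²` in the coordinates at a corner. -/
def chartLength (u : EuclideanSpace ℝ (Fin 2) → ℝ) (a : Fin 2 → Fin P.d)
    (γ : ℝ → Fin 2 → ℂ) : ℝ≥0∞ :=
  ∫⁻ t in Icc (0 : ℝ) 1,
    ENNReal.ofReal (Real.sqrt (P.chartMetric u a (γ t) (derivWithin γ (Icc 0 1) t)))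

/-- `HasCurve u p q L`: there is a piecewise `C¹` curve on the toric surface from `p` to `q`, made
of finitely many `C¹` pieces each of which lies in the coordinates at a corner, whose length for
the metric of `u` is `L`. -/
inductive HasCurve (u : EuclideanSpace ℝ (Fin 2) → ℝ) : P.Surface → P.Surface → ℝ≥0∞ → Prop
  | refl (p : P.Surface) : HasCurve u p p 0
  | cons (a : Fin 2 → Fin P.d) (ha : P.IsCorner a) (γ : ℝ → Fin 2 → ℂ)
      (hγ : ContDiffOn ℝ 1 γ (Icc 0 1)) (hD : ∀ t ∈ Icc (0 : ℝ) 1, γ t ∈ P.chartDomain a)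
      {q : P.Surface} {L : ℝ≥0∞}
      (rest : HasCurve u (P.chartPoint a (γ 1) (hD 1 (right_mem_Icc.2 zero_le_one))) q L) :
      HasCurve u (P.chartPoint a (γ 0) (hD 0 (left_mem_Icc.2 zero_le_one))) q
        (P.chartLength u a γ + L)

/-- The Riemannian distance on the toric surface. -/
def riemannianDist (u : EuclideanSpace ℝ (Fin 2) → ℝ) (p q : P.Surface) : ℝ≥0∞ :=
  sInf {L | P.HasCurve u p q L}

/-- The diameter of the toric surface with the metric of `u`. -/
def diameter (u : EuclideanSpace ℝ (Fin 2) → ℝ) : ℝ≥0∞ :=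
  ⨆ (p : P.Surface) (q : P.Surface), P.riemannianDist u p q

end DelzantPolygon

end

/-! The heart of the matter is a bound `m ≤ |∇m|²`, uniform in `u`, for the affine functions `m =
l_i` and, at a vertex, `m = l_i + l_j`, at interior points where `m` is below a scale depending only
on `P` and the curvature bound. Along a gradient line `X' = (u^{ij} n_j)` of `m` put `f = m' =
u^{ij} n_i n_j`. One contraction of the curvature tensor computes `f''`, and with Cauchy–Schwarz
`|Rm| ≤ K` becomes `(log f)'' ≥ -2 K f` (`sq_deriv_gradSq_le`). As `m' = f`, the function `f'/f + 2
K m` is nondecreasing. The logarithmic terms of `u` give `f ≥ 2 m / (1 + C m)` for small `m`, with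
`C` depending on `u`. Followed to `s = -∞`, this forces `f' ≥ f = m'` for small `m`, and integration
from `-∞` gives `f ≥ m`, where `C` has disappeared (`le_deriv_of_log_convex`,
`le_gradSq_of_curvature`). Gradient lines exist for all times because `Du` maps the interior of `P`
bijectively onto the plane and moves along them with constant velocity (`exists_flow`).

The normalization makes `u` nonnegative. A convex nonnegative function with bounded boundary
integral is bounded at each point inside an edge, hence at interior points; so `u` and `Du` are
bounded on compact subsets of the interior (`exists_bound_fderiv_compact`). Following the gradient
line of `l_i + l_j` from a fixed interior point into a vertex, the inequality `m ≤ f` bounds `u` at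
the vertex (`le_vertex`), and a convex function on `P` is largest at a vertex.

For the diameter, curves with constant angles suffice, their speed being measured by `u_{ij}`. A
segment in a fixed compact set has length controlled by `Du` at its ends (`JoinedWithin.segment`). A
gradient line with `m ≤ f` has length `∫ √f ds ≤ ∫ f/√m ds ≤ 2 √m` (`JoinedWithin.flow`). Such lines
lead from near a vertex into it, and from near an edge to a definite level of `l_i`, so every point
reaches a fixed interior point. Different angles are connected through a vertex, over which there is
only one point. -/

namespace DelzantPolygon

/-! ### Geometry of the polygon: faces, vertices and convexity. -/

variable (P : DelzantPolygon)

/-- The linear part of `l_i`. -/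
noncomputable def dl (i : Fin P.d) : EuclideanSpace ℝ (Fin 2) →L[ℝ] ℝ := innerSL ℝ (P.normalVec i)

theorem dl_apply (i : Fin P.d) (w : EuclideanSpace ℝ (Fin 2)) :
    P.dl i w = ∑ k, (P.normal i k : ℝ) * w k := by
  simp [dl, normalVec, PiLp.inner_apply, mul_comm]

theorem l_eq (i : Fin P.d) (x : EuclideanSpace ℝ (Fin 2)) : P.l i x = P.dl i x - P.offset i := by
  rw [l, dl_apply]

theorem l_add_smul (i : Fin P.d) (x w : EuclideanSpace ℝ (Fin 2)) (t : ℝ) :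
    P.l i (x + t • w) = P.l i x + t * P.dl i w := by
  simp only [l_eq, map_add, map_smul, smul_eq_mul]; ring

theorem dl_sub (i : Fin P.d) (x y : EuclideanSpace ℝ (Fin 2)) :
    P.dl i (x - y) = P.l i x - P.l i y := by
  simp only [l_eq, map_sub]; ring

theorem l_comb (i : Fin P.d) (x y : EuclideanSpace ℝ (Fin 2)) {a b : ℝ} (h : a + b = 1) :
    P.l i (a • x + b • y) = a * P.l i x + b * P.l i y := by
  simp only [l_eq, map_add, map_smul, smul_eq_mul]
  linear_combination (P.offset i) * h

@[fun_prop]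
theorem continuous_l (i : Fin P.d) : Continuous (P.l i) := by
  have : P.l i = fun x => P.dl i x - P.offset i := funext (P.l_eq i)
  rw [this]; fun_prop

theorem isCompact_carrier : IsCompact P.carrier := P.compact

theorem convex_carrier : Convex ℝ P.carrier := by
  intro x hx y hy a b ha hb hab i
  rw [l_comb P i x y hab]
  have := hx i
  have := hy i
  positivity

theorem exists_pos : ∃ c, ∀ i, 0 < P.l i c := P.exists_interior

theorem dl_ne_zero (i : Fin P.d) : P.dl i ≠ 0 := by
  intro h
  obtain ⟨x, hx⟩ := P.exists_pos
  obtain ⟨y, hy, -⟩ := P.exists_facet i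
  have h1 := P.dl_sub i x y
  have h2 := hx i
  change P.l i y = 0 at hy
  rw [h, hy] at h1
  simp at h1
  linarith

theorem exists_dl_eq_one (i : Fin P.d) : ∃ w, P.dl i w = 1 := by
  obtain ⟨w, hw⟩ : ∃ w, P.dl i w ≠ 0 := by
    by_contra! h
    exact P.dl_ne_zero i (ContinuousLinearMap.ext h)
  exact ⟨(P.dl i w)⁻¹ • w, by simp [hw]⟩

theorem isOpen_pos : IsOpen {x | ∀ i, 0 < P.l i x} := by
  simp only [ofPred_forall]
  exact isOpen_iInter_of_finite fun i => isOpen_lt continuous_const (P.continuous_l i)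

theorem mem_interior {x : EuclideanSpace ℝ (Fin 2)} :
    x ∈ interior P.carrier ↔ ∀ i, 0 < P.l i x := by
  constructor
  · intro hx i
    obtain ⟨w, hw⟩ := P.exists_dl_eq_one i
    have h1 : Filter.Tendsto (fun t : ℝ => x + t • w) (nhdsWithin 0 (Iio 0)) (nhds x) := by
      have : Continuous (fun t : ℝ => x + t • w) := by fun_prop
      simpa [ContinuousWithinAt] using this.continuousWithinAt (s := Iio 0) (x := 0)
    have h2 := h1.eventually (mem_interior_iff_mem_nhds.1 hx)
    obtain ⟨t, ht, ht0⟩ := (h2.and self_mem_nhdsWithin).exists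
    have := ht i
    rw [l_add_smul, hw] at this
    have : t < 0 := ht0
    linarith
  · intro h
    exact interior_maximal (fun y hy i => (hy i).le) P.isOpen_pos h

/-- The exit time is the supremum of the times spent in the compact set `P`. The condition `P.dl i w
< 0` guarantees that the facet hit is not parallel to `w`, so that moving inside one facet ends on
another. -/
theorem exists_exit {x w : EuclideanSpace ℝ (Fin 2)} (hx : x ∈ P.carrier) (hw : w ≠ 0) :
    ∃ T : ℝ, 0 ≤ T ∧ x + T • w ∈ P.carrier ∧
      ∃ i, P.l i (x + T • w) = 0 ∧ P.dl i w < 0 := by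
  set S : Set ℝ := {t | 0 ≤ t ∧ x + t • w ∈ P.carrier} with hS
  have hcont : Continuous (fun t : ℝ => x + t • w) := by fun_prop
  have hcl : IsClosed S := by
    have : S = Ici 0 ∩ (fun t : ℝ => x + t • w) ⁻¹' P.carrier := rfl
    rw [this]
    exact isClosed_Ici.inter (P.isCompact_carrier.isClosed.preimage hcont)
  have hne : S.Nonempty := ⟨0, le_rfl, by simpa using hx⟩
  obtain ⟨R, hR⟩ := P.isCompact_carrier.isBounded.exists_norm_le
  have hbd : BddAbove S := by
    refine ⟨2 * R / ‖w‖, fun t ht => ?_⟩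
    have h1 := hR _ ht.2
    have h2 := hR _ hx
    have hw' : 0 < ‖w‖ := norm_pos_iff.2 hw
    rw [le_div_iff₀ hw']
    have h3 : ‖t • w‖ ≤ ‖x + t • w‖ + ‖x‖ := by
      simpa using norm_sub_le (x + t • w) x
    rw [norm_smul, Real.norm_of_nonneg ht.1] at h3
    linarith
  have hT := hcl.csSup_mem hne hbd
  set T := sSup S
  refine ⟨T, hT.1, hT.2, ?_⟩
  by_contra! h
  -- Otherwise the ray continues past `T`: positive `l_i` stay positive for a while, and vanishing
  -- ones do not decrease.
  have hev : ∀ᶠ t in nhdsWithin T (Ioi T), ∀ i, 0 ≤ P.l i (x + t • w) := by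
    rw [Filter.eventually_all]
    intro i
    rcases (hT.2 i).lt_or_eq with hpos | hz
    · have : ∀ᶠ t in nhds T, 0 < P.l i (x + t • w) :=
        ((P.continuous_l i).comp hcont).continuousAt.eventually (lt_mem_nhds hpos)
      exact Filter.Eventually.filter_mono nhdsWithin_le_nhds (this.mono fun t ht => ht.le)
    · filter_upwards [self_mem_nhdsWithin] with t ht
      have h1 := h i hz.symm
      have h2 : T < t := ht
      rw [l_add_smul] at hz ⊢
      nlinarith
  obtain ⟨t, ht, ht0⟩ := (hev.and self_mem_nhdsWithin).exists
  have ht0' : T < t := ht0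
  exact absurd (le_csSup hbd (show t ∈ S from ⟨hT.1.trans ht0'.le, ht⟩)) (not_le.2 ht0')

/-- The determinant of the normals of two facets. -/
noncomputable def ndet (i j : Fin P.d) : ℝ :=
  (P.normal i 0 : ℝ) * P.normal j 1 - (P.normal i 1 : ℝ) * P.normal j 0

theorem isUnit_det {v : EuclideanSpace ℝ (Fin 2)} (hv : v ∈ P.carrier) {i j : Fin P.d}
    (hij : i ≠ j) (hi : P.l i v = 0) (hj : P.l j v = 0) :
    IsUnit (Matrix.of ![P.normal i, P.normal j]).det := (P.delzant v hv i j hij hi hj).1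

theorem ndet_ne_zero {v : EuclideanSpace ℝ (Fin 2)} (hv : v ∈ P.carrier) {i j : Fin P.d}
    (hij : i ≠ j) (hi : P.l i v = 0) (hj : P.l j v = 0) : P.ndet i j ≠ 0 := by
  have h := (P.isUnit_det hv hij hi hj).ne_zero
  rw [Matrix.det_fin_two] at h
  simp only [Matrix.of_apply, Matrix.cons_val_zero, Matrix.cons_val_one] at h
  rw [ndet]
  exact_mod_cast h

theorem eq_or_eq_of_l_eq_zero {v : EuclideanSpace ℝ (Fin 2)} (hv : v ∈ P.carrier) {i j k : Fin P.d}
    (hij : i ≠ j) (hi : P.l i v = 0) (hj : P.l j v = 0) (hk : P.l k v = 0) : k = i ∨ k = j :=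
  (P.delzant v hv i j hij hi hj).2 k hk

/-- The vector on which the linear parts of `l_i`, `l_j` take the values `α`, `β`. -/
noncomputable def dualVec (i j : Fin P.d) (α β : ℝ) : EuclideanSpace ℝ (Fin 2) :=
  !₂[(α * P.normal j 1 - β * P.normal i 1) / P.ndet i j,
    (β * P.normal i 0 - α * P.normal j 0) / P.ndet i j]

theorem dl_dualVec_left {i j : Fin P.d} (h : P.ndet i j ≠ 0) (α β : ℝ) :
    P.dl i (P.dualVec i j α β) = α := by
  rw [dl_apply, Fin.sum_univ_two]
  simp only [dualVec, PiLp.toLp_apply, Matrix.cons_val_zero, Matrix.cons_val_one]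
  field_simp
  rw [ndet]; ring

theorem dl_dualVec_right {i j : Fin P.d} (h : P.ndet i j ≠ 0) (α β : ℝ) :
    P.dl j (P.dualVec i j α β) = β := by
  rw [dl_apply, Fin.sum_univ_two]
  simp only [dualVec, PiLp.toLp_apply, Matrix.cons_val_zero, Matrix.cons_val_one]
  field_simp
  rw [ndet]; ring

theorem eq_dualVec {i j : Fin P.d} (h : P.ndet i j ≠ 0) (w : EuclideanSpace ℝ (Fin 2)) :
    w = P.dualVec i j (P.dl i w) (P.dl j w) := by
  have h' := h
  rw [ndet] at h'
  ext k
  fin_cases k <;>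
  · simp only [dualVec, dl_apply, Fin.sum_univ_two, ndet]
    simp only [Fin.zero_eta, Fin.mk_one, Matrix.cons_val_zero, Matrix.cons_val_one]
    rw [eq_div_iff h']
    ring

theorem eq_zero_of_dl_eq_zero {i j : Fin P.d} (h : P.ndet i j ≠ 0) {w : EuclideanSpace ℝ (Fin 2)}
    (hi : P.dl i w = 0) (hj : P.dl j w = 0) : w = 0 := by
  rw [P.eq_dualVec h w, hi, hj]
  ext k
  fin_cases k <;> simp [dualVec]

theorem eq_of_l_eq {i j : Fin P.d} (h : P.ndet i j ≠ 0) {x y : EuclideanSpace ℝ (Fin 2)}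
    (hi : P.l i x = P.l i y) (hj : P.l j x = P.l j y) : x = y :=
  sub_eq_zero.1 (P.eq_zero_of_dl_eq_zero h (by rw [dl_sub, hi, sub_self])
    (by rw [dl_sub, hj, sub_self]))

/-- A uniform scale: two facets that are both closer than `ε` to a point of `P` meet in a vertex,
and no three facets are that close to a point of `P`. -/
theorem exists_scale : ∃ ε : ℝ, 0 < ε ∧
    (∀ i j, i ≠ j → ∀ x ∈ P.carrier, P.l i x ≤ ε → P.l j x ≤ ε →
      ∃ v ∈ P.carrier, P.l i v = 0 ∧ P.l j v = 0) ∧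
    (∀ i j k, i ≠ j → k ≠ i → k ≠ j → ∀ x ∈ P.carrier, P.l i x ≤ ε → P.l j x ≤ ε →
      ε < P.l k x) := by
  -- By compactness, applied to `l_i + l_j` for facets that do not meet and to `l_i + l_j + l_k` for
  -- three distinct facets, which never vanish together by the Delzant condition. A sum above `3 ε`
  -- with two terms at most `ε` leaves more than `ε` for the third.
  have key : ∀ g : EuclideanSpace ℝ (Fin 2) → ℝ, Continuous g → (∀ x ∈ P.carrier, 0 < g x) →
      ∀ᶠ ε in nhdsWithin (0 : ℝ) (Ioi 0), ∀ x ∈ P.carrier, 3 * ε < g x := by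
    intro g hg hpos
    rcases P.carrier.eq_empty_or_nonempty with he | hne
    · simp [he]
    · obtain ⟨x0, hx0, hmin⟩ := P.isCompact_carrier.exists_isMinOn hne hg.continuousOn
      have h0 := hpos x0 hx0
      filter_upwards [Ioo_mem_nhdsGT (show (0:ℝ) < g x0 / 4 by positivity)] with ε hε x hx
      have h1 : g x0 ≤ g x := hmin hx
      have h2 := hε.1
      have h3 := hε.2
      linarith
  have h1 : ∀ᶠ ε in nhdsWithin (0 : ℝ) (Ioi 0), ∀ i j, i ≠ j → ∀ x ∈ P.carrier,
      P.l i x ≤ ε → P.l j x ≤ ε → ∃ v ∈ P.carrier, P.l i v = 0 ∧ P.l j v = 0 := by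
    rw [Filter.eventually_all]; intro i
    rw [Filter.eventually_all]; intro j
    by_cases hex : ∃ v ∈ P.carrier, P.l i v = 0 ∧ P.l j v = 0
    · exact Filter.Eventually.of_forall fun ε _ x _ _ _ => hex
    · push Not at hex
      have := key (fun x => P.l i x + P.l j x) (by fun_prop) (by
        intro x hx
        have a := hx i
        have b := hx j
        rcases a.lt_or_eq with a | a
        · linarith
        · have := hex x hx a.symm
          have := b.lt_of_ne' this
          linarith)
      filter_upwards [this, self_mem_nhdsWithin] with ε hε h0 _ x hx hi hj
      have := hε x hx
      have : 0 < ε := h0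
      linarith
  have h2 : ∀ᶠ ε in nhdsWithin (0 : ℝ) (Ioi 0), ∀ i j k, i ≠ j → k ≠ i → k ≠ j →
      ∀ x ∈ P.carrier, P.l i x ≤ ε → P.l j x ≤ ε → ε < P.l k x := by
    rw [Filter.eventually_all]; intro i
    rw [Filter.eventually_all]; intro j
    rw [Filter.eventually_all]; intro k
    by_cases hd : i ≠ j ∧ k ≠ i ∧ k ≠ j
    · obtain ⟨hij, hki, hkj⟩ := hd
      have := key (fun x => P.l i x + P.l j x + P.l k x) (by fun_prop) (by
        intro x hx
        have a := hx i
        have b := hx j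
        have c := hx k
        by_contra hle
        have a' : P.l i x = 0 := by linarith
        have b' : P.l j x = 0 := by linarith
        have c' : P.l k x = 0 := by linarith
        rcases P.eq_or_eq_of_l_eq_zero hx hij a' b' c' with h | h
        · exact hki h
        · exact hkj h)
      filter_upwards [this] with ε hε _ _ _ x hx hi hj
      have := hε x hx
      linarith
    · exact Filter.Eventually.of_forall fun ε a b c => absurd ⟨a, b, c⟩ hd
  obtain ⟨ε, ⟨h1, h2⟩, h0⟩ := ((h1.and h2).and self_mem_nhdsWithin).exists
  exact ⟨ε, h0, h1, h2⟩

/-- Through an interior point there is a line avoiding the vertices. -/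
theorem exists_generic_direction {q : EuclideanSpace ℝ (Fin 2)} (hq : ∀ i, 0 < P.l i q) :
    ∃ w : EuclideanSpace ℝ (Fin 2), w ≠ 0 ∧ ∀ t : ℝ, q + t • w ∈ P.carrier → ∀ i j,
      P.l i (q + t • w) = 0 → P.l j (q + t • w) = 0 → i = j := by
  let W : ℕ → EuclideanSpace ℝ (Fin 2) := fun k => !₂[1, (k : ℝ)]
  let B : Fin P.d × Fin P.d → Set ℕ := fun p => {k | p.1 ≠ p.2 ∧ ∃ t : ℝ, q + t • W k ∈ P.carrier ∧
    P.l p.1 (q + t • W k) = 0 ∧ P.l p.2 (q + t • W k) = 0}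
  -- Two facets meet in at most one vertex, which is not `q`, so each pair of facets rules out at
  -- most one of the infinitely many slopes.
  have hB : ∀ p, (B p).Subsingleton := by
    rintro ⟨i, j⟩ k ⟨hij, t, ht, hi, hj⟩ k' ⟨-, t', ht', hi', hj'⟩
    have h1 : q + t • W k = q + t' • W k' :=
      P.eq_of_l_eq (P.ndet_ne_zero ht hij hi hj) (by rw [hi, hi']) (by rw [hj, hj'])
    have h2 := add_left_cancel h1
    have h3 := congrArg (fun z : EuclideanSpace ℝ (Fin 2) => z 0) h2
    have h4 := congrArg (fun z : EuclideanSpace ℝ (Fin 2) => z 1) h2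
    simp [W] at h3 h4
    have ht0 : t ≠ 0 := by
      rintro rfl
      have := hq i
      simp at hi
      simp only at *
      linarith
    rw [← h3] at h4
    exact_mod_cast mul_left_cancel₀ ht0 h4
  obtain ⟨k, hk⟩ : ∃ k, k ∉ ⋃ p, B p :=
    (Set.finite_iUnion fun p => (hB p).finite).exists_notMem
  simp only [mem_iUnion, not_exists] at hk
  refine ⟨W k, fun h => ?_, fun t ht i j hi hj => ?_⟩
  · have := congrArg (fun z : EuclideanSpace ℝ (Fin 2) => z 0) h
    simp [W] at this
  · by_contra hij
    exact hk (i, j) ⟨hij, t, ht, hi, hj⟩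

theorem exists_vec_ne_zero_dl_eq_zero (i : Fin P.d) : ∃ w : EuclideanSpace ℝ (Fin 2),
    w ≠ 0 ∧ P.dl i w = 0 := by
  by_cases h : (P.normal i 0 : ℝ) = 0 ∧ (P.normal i 1 : ℝ) = 0
  · refine ⟨!₂[1, 0], fun h => ?_, ?_⟩
    · have := congrArg (fun z : EuclideanSpace ℝ (Fin 2) => z 0) h
      simp at this
    · simp [dl_apply, Fin.sum_univ_two, h]
  · refine ⟨!₂[-(P.normal i 1 : ℝ), (P.normal i 0 : ℝ)], fun h' => h ?_, ?_⟩
    · have h0 := congrArg (fun z : EuclideanSpace ℝ (Fin 2) => z 0) h'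
      have h1 := congrArg (fun z : EuclideanSpace ℝ (Fin 2) => z 1) h'
      simp at h0 h1
      simp [h0, h1]
    · simp [dl_apply, Fin.sum_univ_two]; ring

/-- Moving inside a facet one reaches a vertex. -/
theorem exists_exit_facet {x w : EuclideanSpace ℝ (Fin 2)} (hx : x ∈ P.carrier) (hw : w ≠ 0)
    {i : Fin P.d} (hi : P.l i x = 0) (hwi : P.dl i w = 0) :
    ∃ T : ℝ, 0 ≤ T ∧ x + T • w ∈ P.carrier ∧ P.l i (x + T • w) = 0 ∧
      ∃ j, i ≠ j ∧ P.l j (x + T • w) = 0 := by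
  obtain ⟨T, hT, hTP, j, hj, hjw⟩ := P.exists_exit hx hw
  refine ⟨T, hT, hTP, by rw [l_add_smul, hi, hwi]; simp, j, ?_, hj⟩
  rintro rfl
  exact hjw.ne hwi

theorem exists_vertex_of_facet {x : EuclideanSpace ℝ (Fin 2)} (hx : x ∈ P.carrier)
    {i : Fin P.d} (hi : P.l i x = 0) :
    ∃ j, i ≠ j ∧ ∃ v ∈ P.carrier, P.l i v = 0 ∧ P.l j v = 0 := by
  obtain ⟨w, hw, hwi⟩ := P.exists_vec_ne_zero_dl_eq_zero i
  obtain ⟨T, -, hTP, hTi, j, hij, hj⟩ := P.exists_exit_facet hx hw hi hwi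
  exact ⟨j, hij, _, hTP, hTi, hj⟩

theorem exists_vertex : ∃ i j, i ≠ j ∧ ∃ v ∈ P.carrier, P.l i v = 0 ∧ P.l j v = 0 := by
  obtain ⟨x, hx⟩ := P.exists_pos
  have hw : (EuclideanSpace.single 0 1 : EuclideanSpace ℝ (Fin 2)) ≠ 0 := by simp
  obtain ⟨T, -, hTP, i, hi, -⟩ := P.exists_exit (x := x) (fun i => (hx i).le) hw
  exact ⟨i, P.exists_vertex_of_facet hTP hi⟩

theorem le_of_convexOn_of_endpoints {g : EuclideanSpace ℝ (Fin 2) → ℝ}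
    (hg : ConvexOn ℝ P.carrier g) {x w : EuclideanSpace ℝ (Fin 2)} {S T B : ℝ}
    (hS : 0 ≤ S) (hT : 0 ≤ T) (hS' : x - S • w ∈ P.carrier) (hT' : x + T • w ∈ P.carrier)
    (h1 : g (x - S • w) ≤ B) (h2 : g (x + T • w) ≤ B) : g x ≤ B := by
  have hseg : x ∈ segment ℝ (x - S • w) (x + T • w) := by
    rcases (add_nonneg hS hT).eq_or_lt with h | h
    · have : S = 0 := by linarith
      have hT0 : T = 0 := by linarith
      subst this hT0
      simp
    · refine ⟨T / (S + T), S / (S + T), by positivity, by positivity, by field_simp; ring, ?_⟩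
      have : T / (S + T) + S / (S + T) = 1 := by field_simp; ring
      calc _ = (T / (S + T) + S / (S + T)) • x +
            ((S / (S + T)) * T - (T / (S + T)) * S) • w := by module
        _ = x := by
          rw [this, div_mul_eq_mul_div, div_mul_eq_mul_div, mul_comm S T, sub_self]; simp
  exact (hg.le_on_segment hS' hT' hseg).trans (max_le h1 h2)

/-- A convex function on the polygon is at most the maximum of its values at vertices. -/
theorem le_of_convexOn_of_vertices {g : EuclideanSpace ℝ (Fin 2) → ℝ}
    (hg : ConvexOn ℝ P.carrier g) {B : ℝ}
    (hB : ∀ i j, i ≠ j → ∀ v ∈ P.carrier, P.l i v = 0 → P.l j v = 0 → g v ≤ B)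
    {x : EuclideanSpace ℝ (Fin 2)} (hx : x ∈ P.carrier) : g x ≤ B := by
  -- A point of a facet lies between two vertices, and any point of `P` lies between two points of
  -- facets.
  have hfacet : ∀ x ∈ P.carrier, ∀ i, P.l i x = 0 → g x ≤ B := by
    intro x hx i hi
    obtain ⟨w, hw, hwi⟩ := P.exists_vec_ne_zero_dl_eq_zero i
    obtain ⟨T, hT, hTP, hTi, j, hij, hj⟩ := P.exists_exit_facet hx hw hi hwi
    obtain ⟨S, hS, hSP, hSi, k, hik, hk⟩ := P.exists_exit_facet hx (neg_ne_zero.2 hw) hi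
      (by simp [hwi])
    have e : x + S • -w = x - S • w := by rw [smul_neg, sub_eq_add_neg]
    rw [e] at hSP hSi hk
    exact P.le_of_convexOn_of_endpoints hg hS hT hSP hTP (hB i k hik _ hSP hSi hk)
      (hB i j hij _ hTP hTi hj)
  have hw : (EuclideanSpace.single 0 1 : EuclideanSpace ℝ (Fin 2)) ≠ 0 := by simp
  obtain ⟨T, hT, hTP, i, hi, -⟩ := P.exists_exit hx hw
  obtain ⟨S, hS, hSP, j, hj, -⟩ := P.exists_exit hx (neg_ne_zero.2 hw)
  have e : x + S • -(EuclideanSpace.single 0 1 : EuclideanSpace ℝ (Fin 2))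
    = x - S • EuclideanSpace.single 0 1 := by rw [smul_neg, sub_eq_add_neg]
  rw [e] at hSP hj
  exact P.le_of_convexOn_of_endpoints hg hS hT hSP hTP (hfacet _ hSP j hj) (hfacet _ hTP i hi)

end DelzantPolygon

/-! ### Symplectic potentials: regularity, convexity, and the gradient map. -/

namespace DelzantPolygon

open CoordMetric Filter Topology

variable {P : DelzantPolygon} {u : EuclideanSpace ℝ (Fin 2) → ℝ}

/-- The second derivative of a function, as a bilinear form. -/
noncomputable def D2 (u : EuclideanSpace ℝ (Fin 2) → ℝ) (x : EuclideanSpace ℝ (Fin 2)) :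
    EuclideanSpace ℝ (Fin 2) →L[ℝ] EuclideanSpace ℝ (Fin 2) →L[ℝ] ℝ :=
  fderiv ℝ (fderiv ℝ u) x

theorem hasFDerivAt_l (i : Fin P.d) (x : EuclideanSpace ℝ (Fin 2)) :
    HasFDerivAt (P.l i) (P.dl i) x := by
  have : P.l i = fun x => P.dl i x - P.offset i := funext (P.l_eq i)
  rw [this]
  exact (P.dl i).hasFDerivAt.sub_const _

theorem contDiff_l (i : Fin P.d) : ContDiff ℝ ∞ (P.l i) := by
  have : P.l i = fun x => P.dl i x - P.offset i := funext (P.l_eq i)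
  rw [this]
  fun_prop

theorem carrier_mem_nhds {x : EuclideanSpace ℝ (Fin 2)} (hx : ∀ i, 0 < P.l i x) :
    P.carrier ∈ 𝓝 x := mem_interior_iff_mem_nhds.1 (P.mem_interior.2 hx)

theorem eventually_pos {x : EuclideanSpace ℝ (Fin 2)} (hx : ∀ i, 0 < P.l i x) :
    ∀ᶠ y in 𝓝 x, ∀ i, 0 < P.l i y := P.isOpen_pos.mem_nhds hx

theorem pos_segment {c x : EuclideanSpace ℝ (Fin 2)} (hc : ∀ i, 0 < P.l i c) (hx : x ∈ P.carrier)
    {t : ℝ} (ht0 : 0 < t) (ht1 : t ≤ 1) (i : Fin P.d) : 0 < P.l i (x + t • (c - x)) := by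
  rw [l_add_smul, dl_sub]
  have h1 := hc i
  have h2 := hx i
  have : 0 < t * P.l i c := mul_pos ht0 h1
  have : 0 ≤ (1 - t) * P.l i x := mul_nonneg (by linarith) h2
  linarith

namespace IsSymplecticPotential

theorem contDiffAt (hu : P.IsSymplecticPotential u) {x : EuclideanSpace ℝ (Fin 2)}
    (hx : ∀ i, 0 < P.l i x) : ContDiffAt ℝ ∞ u x := by
  obtain ⟨⟨f, hf, hfu⟩, -⟩ := hu
  have h1 : ContDiffAt ℝ ∞ f x := hf.contDiffAt (carrier_mem_nhds hx)
  have h2 : u =ᶠ[𝓝 x] fun x => f x + ∑ i, (1 / 2) * (P.l i x * Real.log (P.l i x)) := by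
    filter_upwards [carrier_mem_nhds hx] with y hy using hfu y hy
  refine ContDiffAt.congr_of_eventuallyEq (h1.add (ContDiffAt.sum fun i _ => ?_)) h2
  exact contDiffAt_const.mul ((contDiff_l i).contDiffAt.mul
    ((contDiff_l i).contDiffAt.log (hx i).ne'))

theorem continuousOn (hu : P.IsSymplecticPotential u) : ContinuousOn u P.carrier := by
  obtain ⟨⟨f, hf, hfu⟩, -⟩ := hu
  refine ContinuousOn.congr (hf.continuousOn.add (Continuous.continuousOn ?_)) hfu
  refine continuous_finsetSum _ fun i _ => continuous_const.mul ?_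
  exact Real.continuous_mul_log.comp (P.continuous_l i)

theorem differentiableAt (hu : P.IsSymplecticPotential u) {x : EuclideanSpace ℝ (Fin 2)}
    (hx : ∀ i, 0 < P.l i x) : DifferentiableAt ℝ u x :=
  (hu.contDiffAt hx).differentiableAt (by simp)

theorem contDiffAt_fderiv (hu : P.IsSymplecticPotential u) {x : EuclideanSpace ℝ (Fin 2)}
    (hx : ∀ i, 0 < P.l i x) : ContDiffAt ℝ ∞ (fderiv ℝ u) x :=
  (hu.contDiffAt hx).fderiv_right (by simp)

theorem hasFDerivAt_fderiv (hu : P.IsSymplecticPotential u) {x : EuclideanSpace ℝ (Fin 2)}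
    (hx : ∀ i, 0 < P.l i x) : HasFDerivAt (fderiv ℝ u) (D2 u x) x :=
  ((hu.contDiffAt_fderiv hx).differentiableAt (by simp)).hasFDerivAt

theorem hasDerivAt_line (hu : P.IsSymplecticPotential u) {x w : EuclideanSpace ℝ (Fin 2)} {t : ℝ}
    (hx : ∀ i, 0 < P.l i (x + t • w)) :
    HasDerivAt (fun t : ℝ => u (x + t • w)) (fderiv ℝ u (x + t • w) w) t := by
  have h1 : HasDerivAt (fun t : ℝ => x + t • w) w t := by
    simpa using ((hasDerivAt_id t).smul_const w).const_add x
  exact (hu.differentiableAt hx).hasFDerivAt.comp_hasDerivAt t h1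

theorem hasDerivAt_fderiv_line (hu : P.IsSymplecticPotential u) {x w : EuclideanSpace ℝ (Fin 2)}
    {t : ℝ} (hx : ∀ i, 0 < P.l i (x + t • w)) :
    HasDerivAt (fun t : ℝ => fderiv ℝ u (x + t • w) w) (D2 u (x + t • w) w w) t := by
  have h1 : HasDerivAt (fun t : ℝ => x + t • w) w t := by
    simpa using ((hasDerivAt_id t).smul_const w).const_add x
  have h2 := (hu.hasFDerivAt_fderiv hx).comp_hasDerivAt t h1
  exact (ContinuousLinearMap.apply ℝ ℝ w).hasFDerivAt.comp_hasDerivAt t h2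

theorem eventually_pos_line {x w : EuclideanSpace ℝ (Fin 2)} {t : ℝ}
    (hx : ∀ i, 0 < P.l i (x + t • w)) : ∀ᶠ s in 𝓝 t, ∀ i, 0 < P.l i (x + s • w) := by
  have : Continuous (fun t : ℝ => x + t • w) := by fun_prop
  exact this.continuousAt.eventually (eventually_pos hx)

/-- No facet passes through an interior point, so the side condition on `w` in the definition of a
potential is vacuous there. -/
theorem D2_pos (hu : P.IsSymplecticPotential u) {x : EuclideanSpace ℝ (Fin 2)}
    (hx : ∀ i, 0 < P.l i x) {w : EuclideanSpace ℝ (Fin 2)} (hw : w ≠ 0) : 0 < D2 u x w w := by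
  have h := hu.2 x (fun i => (hx i).le) w hw (fun i hi => absurd hi (hx i).ne')
  have hx0 : ∀ i, 0 < P.l i (x + (0:ℝ) • w) := by simpa using hx
  rw [iteratedDeriv_succ, iteratedDeriv_one] at h
  have h2 : deriv (fun t : ℝ => u (x + t • w)) =ᶠ[𝓝 0] fun t => fderiv ℝ u (x + t • w) w := by
    filter_upwards [eventually_pos_line hx0] with s hs using (hu.hasDerivAt_line hs).deriv
  rw [h2.deriv_eq, (hu.hasDerivAt_fderiv_line hx0).deriv] at h
  simpa using h

/-- In the interior this is the sign of the second derivative along segments. For boundary points,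
all three points are moved slightly towards a common interior point `c`, which respects convex
combinations, and continuity of `u` on `P` gives the limit. -/
theorem convexOn (hu : P.IsSymplecticPotential u) : ConvexOn ℝ P.carrier u := by
  have hint : ∀ x y, (∀ i, 0 < P.l i x) → (∀ i, 0 < P.l i y) → ∀ a b : ℝ, 0 ≤ a → 0 ≤ b →
      a + b = 1 → u (a • x + b • y) ≤ a * u x + b * u y := by
    intro x y hx hy a b ha hb hab
    have hpos : ∀ t ∈ Icc (0:ℝ) 1, ∀ i, 0 < P.l i (x + t • (y - x)) := by
      intro t ht i
      rcases ht.1.eq_or_lt with h | h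
      · rw [← h]; simpa using hx i
      · exact pos_segment hy (fun i => (hx i).le) h ht.2 i
    have hc : ConvexOn ℝ (Icc (0:ℝ) 1) (fun t : ℝ => u (x + t • (y - x))) := by
      refine convexOn_of_hasDerivWithinAt2_nonneg (convex_Icc _ _)
        (f' := fun t => fderiv ℝ u (x + t • (y - x)) (y - x))
        (f'' := fun t => D2 u (x + t • (y - x)) (y - x) (y - x)) ?_ ?_ ?_ ?_
      · exact fun t ht => (hu.hasDerivAt_line (hpos t ht)).continuousAt.continuousWithinAt
      · intro t ht
        exact (hu.hasDerivAt_line (hpos t (interior_subset ht))).hasDerivWithinAt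
      · intro t ht
        exact (hu.hasDerivAt_fderiv_line (hpos t (interior_subset ht))).hasDerivWithinAt
      · intro t ht
        by_cases h0 : y - x = 0
        · simp [h0]
        · exact (hu.D2_pos (hpos t (interior_subset ht)) h0).le
    have := hc.2 (left_mem_Icc.2 zero_le_one) (right_mem_Icc.2 zero_le_one) ha hb hab
    simp only [smul_eq_mul, mul_zero, mul_one, zero_add, zero_smul, add_zero, one_smul] at this
    have e : x + b • (y - x) = a • x + b • y := by
      have : a = 1 - b := by linarith
      rw [this]; module
    rwa [e, add_sub_cancel] at this
  refine ⟨P.convex_carrier, fun x hx y hy a b ha hb hab => ?_⟩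
  obtain ⟨c, hc⟩ := P.exists_pos
  have hz : a • x + b • y ∈ P.carrier := P.convex_carrier hx hy ha hb hab
  have hlim : ∀ z ∈ P.carrier, Tendsto (fun t : ℝ => u (z + t • (c - z))) (𝓝[>] 0) (𝓝 (u z)) := by
    intro z hz
    have h1 : Tendsto (fun t : ℝ => z + t • (c - z)) (𝓝[>] 0) (𝓝[P.carrier] z) := by
      refine tendsto_nhdsWithin_iff.2 ⟨?_, ?_⟩
      · have : Continuous (fun t : ℝ => z + t • (c - z)) := by fun_prop
        have h := this.tendsto 0
        simp only [zero_smul, add_zero] at h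
        exact h.mono_left nhdsWithin_le_nhds
      · filter_upwards [Ioc_mem_nhdsGT (zero_lt_one (α := ℝ))] with t ht i
        exact (pos_segment hc hz ht.1 ht.2 i).le
    exact (hu.continuousOn z hz).tendsto.comp h1
  refine le_of_tendsto_of_tendsto (hlim _ hz)
    (((hlim x hx).const_mul a).add ((hlim y hy).const_mul b)) ?_
  filter_upwards [Ioc_mem_nhdsGT (zero_lt_one (α := ℝ))] with t ht
  refine le_trans (le_of_eq ?_) (hint _ _ (pos_segment hc hx ht.1 ht.2)
    (pos_segment hc hy ht.1 ht.2) a b ha hb hab)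
  congr 1
  have : a = 1 - b := by linarith
  rw [this]; module

/-- Second derivatives of a symplectic potential, up to a bounded term. -/
theorem exists_D2_le (hu : P.IsSymplecticPotential u) : ∃ B : ℝ, 0 ≤ B ∧
    ∀ x, (∀ i, 0 < P.l i x) → ∀ w, D2 u x w w ≤ B * ‖w‖ ^ 2 +
      ∑ i, (1 / 2) * ((P.dl i w) ^ 2 / P.l i x) := by
  obtain ⟨⟨f, hf, hfu⟩, -⟩ := hu
  have hne : (interior P.carrier).Nonempty := by
    obtain ⟨c, hc⟩ := P.exists_pos
    exact ⟨c, P.mem_interior.2 hc⟩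
  have hud : UniqueDiffOn ℝ P.carrier := uniqueDiffOn_convex P.convex_carrier hne
  have h1 : ContDiffOn ℝ ∞ (fderivWithin ℝ f P.carrier) P.carrier :=
    hf.fderivWithin hud (by simp)
  -- As `f` is smooth up to the boundary, its second derivative within `P` is bounded on `P`; only
  -- the logarithmic terms blow up.
  have h2 : ContinuousOn (fderivWithin ℝ (fderivWithin ℝ f P.carrier) P.carrier) P.carrier :=
    h1.continuousOn_fderivWithin hud (by simp)
  obtain ⟨B, hB⟩ := P.isCompact_carrier.exists_bound_of_continuousOn
    (E := EuclideanSpace ℝ (Fin 2) →L[ℝ] EuclideanSpace ℝ (Fin 2) →L[ℝ] ℝ) h2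
  refine ⟨max B 0, le_max_right _ _, fun x hx w => ?_⟩
  have hfd : ∀ y, (∀ i, 0 < P.l i y) → DifferentiableAt ℝ f y := fun y hy =>
    (hf.contDiffAt (carrier_mem_nhds hy)).differentiableAt (by simp)
  have e1 : fderivWithin ℝ f P.carrier =ᶠ[𝓝 x] fderiv ℝ f := by
    filter_upwards [eventually_pos hx] with y hy
    exact fderivWithin_of_mem_nhds (carrier_mem_nhds hy)
  have e2 : fderivWithin ℝ (fderivWithin ℝ f P.carrier) P.carrier x = D2 f x := by
    rw [fderivWithin_of_mem_nhds (carrier_mem_nhds hx), e1.fderiv_eq, D2]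
  have hBx : ‖D2 f x‖ ≤ B := e2 ▸ hB x (fun i => (hx i).le)
  have hDu : ∀ y, (∀ i, 0 < P.l i y) → fderiv ℝ u y =
      fderiv ℝ f y + ∑ i, ((1 / 2) * (Real.log (P.l i y) + 1)) • P.dl i := by
    intro y hy
    have e : u =ᶠ[𝓝 y] fun x => f x + ∑ i, (1 / 2) * (P.l i x * Real.log (P.l i x)) := by
      filter_upwards [carrier_mem_nhds hy] with z hz using hfu z hz
    rw [e.fderiv_eq]
    refine HasFDerivAt.fderiv ((hfd y hy).hasFDerivAt.add (HasFDerivAt.fun_sum fun i _ => ?_))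
    rw [← smul_smul]
    exact ((Real.hasDerivAt_mul_log (hy i).ne').comp_hasFDerivAt y (hasFDerivAt_l i y)).const_mul _
  have e3 : fderiv ℝ u =ᶠ[𝓝 x] fun y =>
      fderiv ℝ f y + ∑ i, ((1 / 2) * (Real.log (P.l i y) + 1)) • P.dl i := by
    filter_upwards [eventually_pos hx] with y hy using hDu y hy
  have hff : HasFDerivAt (fderiv ℝ f) (D2 f x) x :=
    (((hf.contDiffAt (carrier_mem_nhds hx)).fderiv_right (m := ∞) (by simp)).differentiableAt
      (by simp)).hasFDerivAt
  have hD2 : D2 u x = D2 f x + ∑ i, (((1 / 2) * (P.l i x)⁻¹) • P.dl i).smulRight (P.dl i) := by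
    rw [D2, e3.fderiv_eq]
    refine HasFDerivAt.fderiv (hff.add (HasFDerivAt.fun_sum fun i _ => ?_))
    refine HasFDerivAt.smul_const ?_ (P.dl i)
    rw [← smul_smul]
    exact (((hasFDerivAt_l i x).log (hx i).ne').add_const 1).const_mul (1 / 2)
  rw [hD2]
  simp only [add_apply, sum_apply,
    ContinuousLinearMap.smulRight_apply, smul_apply, smul_eq_mul]
  refine add_le_add ?_ (le_of_eq (Finset.sum_congr rfl fun i _ => by ring))
  calc D2 f x w w ≤ ‖D2 f x w w‖ := le_abs_self _
    _ ≤ ‖D2 f x‖ * ‖w‖ * ‖w‖ := (D2 f x).le_opNorm₂ w w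
    _ ≤ max B 0 * ‖w‖ * ‖w‖ := by gcongr; exact hBx.trans (le_max_left _ _)
    _ = _ := by ring

theorem fderiv_sub_pos (hu : P.IsSymplecticPotential u) {x y : EuclideanSpace ℝ (Fin 2)}
    (hx : ∀ i, 0 < P.l i x) (hy : ∀ i, 0 < P.l i y) (hxy : x ≠ y) :
    fderiv ℝ u x (y - x) < fderiv ℝ u y (y - x) := by
  have hpos : ∀ t ∈ Icc (0:ℝ) 1, ∀ i, 0 < P.l i (x + t • (y - x)) := by
    intro t ht i
    rcases ht.1.eq_or_lt with h | h
    · rw [← h]; simpa using hx i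
    · exact pos_segment hy (fun i => (hx i).le) h ht.2 i
  have hm : StrictMonoOn (fun t : ℝ => fderiv ℝ u (x + t • (y - x)) (y - x)) (Icc 0 1) := by
    refine strictMonoOn_of_hasDerivWithinAt_pos (convex_Icc _ _)
      (f' := fun t => D2 u (x + t • (y - x)) (y - x) (y - x)) ?_ ?_ ?_
    · exact fun t ht => (hu.hasDerivAt_fderiv_line (hpos t ht)).continuousAt.continuousWithinAt
    · intro t ht
      exact (hu.hasDerivAt_fderiv_line (hpos t (interior_subset ht))).hasDerivWithinAt
    · intro t ht
      exact hu.D2_pos (hpos t (interior_subset ht)) (sub_ne_zero.2 hxy.symm)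
  simpa using hm (left_mem_Icc.2 zero_le_one) (right_mem_Icc.2 zero_le_one) zero_lt_one

theorem fderiv_injOn (hu : P.IsSymplecticPotential u) {x y : EuclideanSpace ℝ (Fin 2)}
    (hx : ∀ i, 0 < P.l i x) (hy : ∀ i, 0 < P.l i y) (h : fderiv ℝ u x = fderiv ℝ u y) :
    x = y := by
  by_contra hxy
  have := hu.fderiv_sub_pos hx hy hxy
  rw [h] at this
  exact lt_irrefl _ this

/-- The slope of a symplectic potential at a boundary point in an inward direction is `-∞`. -/
theorem exists_lt_of_boundary (hu : P.IsSymplecticPotential u) {p c : EuclideanSpace ℝ (Fin 2)}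
    (hp : p ∈ P.carrier) {i : Fin P.d} (hi : P.l i p = 0) (hc : ∀ i, 0 < P.l i c) (M : ℝ) :
    ∃ t ∈ Ioc (0 : ℝ) 1, u (p + t • (c - p)) < u p - M * t := by
  obtain ⟨⟨f, hf, hfu⟩, -⟩ := hu
  have hl : ∀ k (t : ℝ), P.l k (p + t • (c - p)) = P.l k p + t * (P.l k c - P.l k p) := by
    intro k t; rw [l_add_smul, dl_sub]
  have hmem : ∀ t ∈ Ioc (0:ℝ) 1, p + t • (c - p) ∈ P.carrier := fun t ht k =>
    (pos_segment hc hp ht.1 ht.2 k).le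
  -- The increment of each summand of `u` is at most linear in `t`: for `f` and for the facets away
  -- from `p` by differentiability, for the facets through `p` because `τ log τ ≤ 0` for small `τ`.
  -- The summand of the facet `i` is a multiple of `t log (t l_i(c))` and eventually beats all
  -- linear terms.
  have h1 : ∃ C : ℝ, ∀ᶠ t in 𝓝[>] (0 : ℝ), f (p + t • (c - p)) - f p ≤ C * t := by
    have hd := (hf.differentiableOn (by simp) p hp).hasFDerivWithinAt.isBigO_sub
    obtain ⟨C, hC⟩ := hd.bound
    have h1 : Tendsto (fun t : ℝ => p + t • (c - p)) (𝓝[>] 0) (𝓝[P.carrier] p) := by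
      refine tendsto_nhdsWithin_iff.2 ⟨?_, ?_⟩
      · have : Continuous (fun t : ℝ => p + t • (c - p)) := by fun_prop
        have h := this.tendsto 0
        simp only [zero_smul, add_zero] at h
        exact h.mono_left nhdsWithin_le_nhds
      · filter_upwards [Ioc_mem_nhdsGT (zero_lt_one (α := ℝ))] with t ht using hmem t ht
    refine ⟨C * ‖c - p‖, ?_⟩
    filter_upwards [h1.eventually hC, self_mem_nhdsWithin] with t ht ht0
    have ht0' : (0:ℝ) < t := ht0
    rw [add_sub_cancel_left, norm_smul, Real.norm_of_nonneg ht0'.le] at ht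
    calc _ ≤ ‖f (p + t • (c - p)) - f p‖ := le_abs_self _
      _ ≤ _ := ht
      _ = _ := by ring
  have h2 : ∀ k, ∃ C : ℝ, ∀ᶠ t in 𝓝[>] (0 : ℝ),
      (1 / 2) * (P.l k (p + t • (c - p)) * Real.log (P.l k (p + t • (c - p))))
        - (1 / 2) * (P.l k p * Real.log (P.l k p)) ≤ C * t := by
    intro k
    rcases (hp k).eq_or_lt with h0 | hpos
    · refine ⟨0, ?_⟩
      have hck := hc k
      have : Ioo (0:ℝ) (1 / P.l k c) ∈ 𝓝[>] (0:ℝ) := Ioo_mem_nhdsGT (by positivity)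
      filter_upwards [this] with t ht
      rw [hl, ← h0]
      have hlt : t * P.l k c < 1 := by
        have := ht.2
        rwa [lt_div_iff₀ hck] at this
      have hlog : Real.log (t * P.l k c) ≤ 0 :=
        Real.log_nonpos (mul_pos ht.1 hck).le hlt.le
      have := mul_nonneg (mul_pos ht.1 hck).le (neg_nonneg.2 hlog)
      simp only [zero_add, sub_zero, zero_mul, mul_zero]
      linarith
    · have hd : HasDerivAt (fun t : ℝ => (1 / 2) * (P.l k (p + t • (c - p)) *
          Real.log (P.l k (p + t • (c - p)))))
          ((1 / 2) * ((Real.log (P.l k p) + 1) * (P.l k c - P.l k p))) 0 := by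
        have e : HasDerivAt (fun t : ℝ => P.l k (p + t • (c - p))) (P.l k c - P.l k p) 0 := by
          simp only [hl]
          simpa using ((hasDerivAt_id (0:ℝ)).mul_const (P.l k c - P.l k p)).const_add (P.l k p)
        have e2 := Real.hasDerivAt_mul_log hpos.ne'
        have e3 : P.l k p = P.l k (p + (0:ℝ) • (c - p)) := by simp
        rw [e3] at e2
        have e4 := (e2.comp (0:ℝ) e).const_mul (1 / 2 : ℝ)
        rw [← e3] at e4
        exact e4
      obtain ⟨C, hC⟩ := hd.hasFDerivAt.isBigO_sub.bound
      refine ⟨C, ?_⟩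
      filter_upwards [nhdsWithin_le_nhds hC, self_mem_nhdsWithin] with t ht ht0
      have ht0' : (0:ℝ) < t := ht0
      simp only [zero_smul, add_zero, sub_zero, Real.norm_of_nonneg ht0'.le] at ht
      exact (le_abs_self _).trans ht
  choose C hC using h2
  obtain ⟨C0, hC0⟩ := h1
  have h3 : ∀ᶠ t in 𝓝[>] (0 : ℝ), (1 / 2) * P.l i c * Real.log (t * P.l i c)
      < -M - C0 - ∑ k ∈ Finset.univ.erase i, C k := by
    have hci := hc i
    have e1 : Tendsto (fun t : ℝ => t * P.l i c) (𝓝[>] 0) (𝓝[>] 0) := by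
      refine tendsto_nhdsWithin_iff.2 ⟨?_, ?_⟩
      · have : Continuous (fun t : ℝ => t * P.l i c) := by fun_prop
        have h := this.tendsto 0
        simp only [zero_mul] at h
        exact h.mono_left nhdsWithin_le_nhds
      · filter_upwards [self_mem_nhdsWithin] with t ht using mul_pos ht hci
    have e2 := (Real.tendsto_log_nhdsGT_zero.comp e1).const_mul_atBot
      (show 0 < (1 / 2) * P.l i c by positivity)
    exact e2.eventually_lt_atBot _
  have h4 : ∀ᶠ t in 𝓝[>] (0:ℝ), ∀ k, (1 / 2) * (P.l k (p + t • (c - p)) *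
      Real.log (P.l k (p + t • (c - p)))) - (1 / 2) * (P.l k p * Real.log (P.l k p)) ≤ C k * t :=
    eventually_all.2 hC
  obtain ⟨t, ⟨⟨h3, h4⟩, h5⟩, ht⟩ := (((h3.and h4).and hC0).and
    (Ioc_mem_nhdsGT (zero_lt_one (α := ℝ)))).exists
  refine ⟨t, ht, ?_⟩
  rw [hfu _ (hmem t ht), hfu p hp]
  have hsum : ∑ k, (1 / 2) * (P.l k (p + t • (c - p)) * Real.log (P.l k (p + t • (c - p))))
      - ∑ k, (1 / 2) * (P.l k p * Real.log (P.l k p)) ≤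
      (1 / 2) * P.l i c * Real.log (t * P.l i c) * t +
        (∑ k ∈ Finset.univ.erase i, C k) * t := by
    rw [← Finset.sum_sub_distrib, ← Finset.add_sum_erase _ _ (Finset.mem_univ i)]
    refine add_le_add (le_of_eq ?_) ?_
    · rw [hl, hi]; simp only [zero_add, sub_zero, zero_mul, mul_zero]; ring
    · rw [Finset.sum_mul]
      exact Finset.sum_le_sum fun k _ => h4 k
  have := mul_lt_mul_of_pos_right h3 ht.1
  linarith

/-- The gradient of a symplectic potential maps the interior of the polygon onto the plane. -/
theorem exists_fderiv_eq (hu : P.IsSymplecticPotential u)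
    (y : EuclideanSpace ℝ (Fin 2) →L[ℝ] ℝ) : ∃ x, (∀ i, 0 < P.l i x) ∧ fderiv ℝ u x = y := by
  obtain ⟨c, hc⟩ := P.exists_pos
  have hcont : ContinuousOn (fun x => u x - y x) P.carrier :=
    hu.continuousOn.sub y.continuous.continuousOn
  -- A minimum point of `u - y` over `P` is not on the boundary, where the inward slope is `-∞`; in
  -- the interior it is critical.
  obtain ⟨p, hp, hmin⟩ := P.isCompact_carrier.exists_isMinOn ⟨c, fun i => (hc i).le⟩ hcont
  have hpi : ∀ i, 0 < P.l i p := by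
    intro i
    refine (hp i).lt_of_ne' fun h0 => ?_
    obtain ⟨t, ht, hlt⟩ := hu.exists_lt_of_boundary hp h0 hc (-(y (c - p)))
    have h1 : u p - y p ≤ u (p + t • (c - p)) - y (p + t • (c - p)) :=
      hmin (show p + t • (c - p) ∈ P.carrier from fun k => (pos_segment hc hp ht.1 ht.2 k).le)
    rw [map_add, map_smul, smul_eq_mul] at h1
    linarith
  refine ⟨p, hpi, ?_⟩
  have hloc : IsLocalMin (fun x => u x - y x) p := hmin.isLocalMin (carrier_mem_nhds hpi)
  have h1 := hloc.hasFDerivAt_eq_zero ((hu.differentiableAt hpi).hasFDerivAt.sub y.hasFDerivAt)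
  exact sub_eq_zero.1 h1

end IsSymplecticPotential

end DelzantPolygon

/-! ### Cauchy–Schwarz for contractions of tensors. -/

namespace Matrix

open scoped Kronecker

variable {κ κ' : Type*} [Fintype κ] [Fintype κ']

/-- The quadratic polynomial `t ↦ (x + t r) ⬝ M (x + t r)` is nonnegative, so its discriminant is at
most zero. -/
theorem PosSemidef.sq_dotProduct_mulVec_le {M : Matrix κ κ ℝ} (hM : M.PosSemidef) (x r : κ → ℝ) :
    (x ⬝ᵥ (M *ᵥ r)) ^ 2 ≤ (x ⬝ᵥ (M *ᵥ x)) * (r ⬝ᵥ (M *ᵥ r)) := by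
  have hsymm : r ⬝ᵥ (M *ᵥ x) = x ⬝ᵥ (M *ᵥ r) := by
    have h : Mᵀ = M := by simpa using hM.1.eq
    rw [dotProduct_mulVec, ← mulVec_transpose, h, dotProduct_comm]
  have h : ∀ t : ℝ, 0 ≤ (r ⬝ᵥ (M *ᵥ r)) * (t * t) + 2 * (x ⬝ᵥ (M *ᵥ r)) * t + x ⬝ᵥ (M *ᵥ x) := by
    intro t
    have h1 := hM.dotProduct_mulVec_nonneg (x + t • r)
    simp only [star_trivial, mulVec_add, mulVec_smul, dotProduct_add, add_dotProduct,
      dotProduct_smul, smul_dotProduct, smul_eq_mul, hsymm] at h1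
    linarith
  have h2 := discrim_le_zero h
  rw [discrim] at h2
  linarith

/-- The product of two vectors, as a vector over the product of the index types. -/
def prodVec (x : κ → ℝ) (y : κ' → ℝ) : κ × κ' → ℝ := fun p => x p.1 * y p.2

theorem kronecker_mulVec_prodVec (A : Matrix κ κ ℝ) (B : Matrix κ' κ' ℝ) (x : κ → ℝ) (y : κ' → ℝ) :
    (A ⊗ₖ B) *ᵥ prodVec x y = prodVec (A *ᵥ x) (B *ᵥ y) := by
  ext ⟨i, j⟩
  simp only [prodVec, mulVec, dotProduct, kroneckerMap_apply, Fintype.sum_prod_type, Finset.sum_mul_sum]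
  exact Finset.sum_congr rfl fun a _ => Finset.sum_congr rfl fun b _ => by ring

theorem prodVec_dotProduct_prodVec (x x' : κ → ℝ) (y y' : κ' → ℝ) :
    prodVec x y ⬝ᵥ prodVec x' y' = (x ⬝ᵥ x') * (y ⬝ᵥ y') := by
  simp only [prodVec, dotProduct, Fintype.sum_prod_type, Finset.sum_mul_sum]
  exact Finset.sum_congr rfl fun a _ => Finset.sum_congr rfl fun b _ => by ring

/-- The Cauchy–Schwarz inequality for the contraction of a tensor of type `(1, 3)` with a product
vector. -/
theorem sq_contract_le {g h : Matrix κ κ ℝ} (hg : g.PosSemidef) (hh : h.PosSemidef)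
    (R : κ → κ → κ → κ → ℝ) (x₁ x₂ x₃ x₄ : κ → ℝ) :
    (∑ a, ∑ b, ∑ c, ∑ d, (g *ᵥ x₁) a * (h *ᵥ x₂) b * (h *ᵥ x₃) c * (h *ᵥ x₄) d * R a b c d) ^ 2 ≤
      ((x₁ ⬝ᵥ (g *ᵥ x₁)) * ((x₂ ⬝ᵥ (h *ᵥ x₂)) * ((x₃ ⬝ᵥ (h *ᵥ x₃)) * (x₄ ⬝ᵥ (h *ᵥ x₄))))) *
      ∑ a, ∑ b, ∑ c, ∑ d, ∑ a', ∑ b', ∑ c', ∑ d',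
        g a a' * h b b' * h c c' * h d d' * R a b c d * R a' b' c' d' := by
  classical
  -- The tensor is viewed as a vector over the product index set, where `g ⊗ h ⊗ h ⊗ h` is positive
  -- semidefinite; this is the form that defines `riemannNorm`.
  have hM : (g ⊗ₖ (h ⊗ₖ (h ⊗ₖ h))).PosSemidef := hg.kronecker (hh.kronecker (hh.kronecker hh))
  have key := hM.sq_dotProduct_mulVec_le
    (prodVec x₁ (prodVec x₂ (prodVec x₃ x₄)))
    (fun p => R p.1 p.2.1 p.2.2.1 p.2.2.2)
  have hT : (g ⊗ₖ (h ⊗ₖ (h ⊗ₖ h)))ᵀ = g ⊗ₖ (h ⊗ₖ (h ⊗ₖ h)) := by simpa using hM.1.eq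
  rw [dotProduct_mulVec, ← mulVec_transpose, hT] at key
  simp only [kronecker_mulVec_prodVec, prodVec_dotProduct_prodVec] at key
  convert! key using 2
  · simp only [dotProduct, prodVec, Fintype.sum_prod_type]
    refine Finset.sum_congr rfl fun a _ => Finset.sum_congr rfl fun b _ =>
      Finset.sum_congr rfl fun c _ => Finset.sum_congr rfl fun d _ => by ring
  · simp only [dotProduct, mulVec, Fintype.sum_prod_type, kroneckerMap_apply, Finset.mul_sum]
    refine Finset.sum_congr rfl fun a _ => Finset.sum_congr rfl fun b _ =>
      Finset.sum_congr rfl fun c _ => Finset.sum_congr rfl fun d _ =>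
      Finset.sum_congr rfl fun a _ => Finset.sum_congr rfl fun b _ =>
      Finset.sum_congr rfl fun c _ => Finset.sum_congr rfl fun d _ => by ring

end Matrix

/-! ### Partial derivatives of functions of the action variables. -/

namespace CoordMetric

open Filter Topology

variable {ι ι' : Type} [Fintype ι] [Fintype ι']

/-- The projection of the action-angle space to the action variables. -/
noncomputable def actionPart : EuclideanSpace ℝ (ι ⊕ ι') →L[ℝ] EuclideanSpace ℝ ι :=
  LinearMap.toContinuousLinearMap
    { toFun := fun q => WithLp.toLp 2 fun i => q (Sum.inl i)
      map_add' := fun _ _ => rfl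
      map_smul' := fun _ _ => rfl }

theorem actionPart_apply (q : EuclideanSpace ℝ (ι ⊕ ι')) :
    actionPart q = WithLp.toLp 2 fun i => q (Sum.inl i) := rfl

variable [DecidableEq ι] [DecidableEq ι']

theorem actionPart_single_inl (i : ι) : (actionPart (EuclideanSpace.single (Sum.inl i) 1 :
    EuclideanSpace ℝ (ι ⊕ ι'))) = EuclideanSpace.single i 1 := by
  ext j
  simp [actionPart_apply]

theorem actionPart_single_inr (i : ι') : (actionPart (EuclideanSpace.single (Sum.inr i) 1 :
    EuclideanSpace ℝ (ι ⊕ ι'))) = 0 := by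
  ext j
  simp [actionPart_apply]

theorem pd_comp_inl {h : EuclideanSpace ℝ ι → ℝ} {q : EuclideanSpace ℝ (ι ⊕ ι')}
    (hh : DifferentiableAt ℝ h (actionPart q)) (i : ι) :
    pd (Sum.inl i) (fun y => h (actionPart y)) q = pd i h (actionPart q) := by
  have h1 := hh.hasFDerivAt.comp q (actionPart (ι := ι) (ι' := ι')).hasFDerivAt
  rw [pd, pd]
  erw [h1.fderiv]
  simp [actionPart_single_inl]

theorem pd_comp_inr {h : EuclideanSpace ℝ ι → ℝ} {q : EuclideanSpace ℝ (ι ⊕ ι')}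
    (hh : DifferentiableAt ℝ h (actionPart q)) (i : ι') :
    pd (Sum.inr i) (fun y => h (actionPart y)) q = 0 := by
  have h1 := hh.hasFDerivAt.comp q (actionPart (ι := ι) (ι' := ι')).hasFDerivAt
  rw [pd]
  erw [h1.fderiv]
  simp [actionPart_single_inr]

theorem pd_const (i : ι) (c : ℝ) (q : EuclideanSpace ℝ ι) : pd i (fun _ => c) q = 0 := by
  simp [pd]

theorem pd_congr {f g : EuclideanSpace ℝ ι → ℝ} {q : EuclideanSpace ℝ ι} (h : f =ᶠ[𝓝 q] g)
    (i : ι) : pd i f q = pd i g q := by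
  rw [pd, pd, h.fderiv_eq]

theorem pd_mul {f g : EuclideanSpace ℝ ι → ℝ} {q : EuclideanSpace ℝ ι}
    (hf : DifferentiableAt ℝ f q) (hg : DifferentiableAt ℝ g q) (i : ι) :
    pd i (fun y => f y * g y) q = pd i f q * g q + f q * pd i g q := by
  simp only [pd]
  rw [fderiv_fun_mul hf hg]
  simp
  ring

theorem pd_sum {κ : Type*} {s : Finset κ} {f : κ → EuclideanSpace ℝ ι → ℝ}
    {q : EuclideanSpace ℝ ι} (hf : ∀ k ∈ s, DifferentiableAt ℝ (f k) q) (i : ι) :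
    pd i (fun y => ∑ k ∈ s, f k y) q = ∑ k ∈ s, pd i (f k) q := by
  simp only [pd]
  rw [fderiv_fun_sum hf]
  simp

theorem pd_const_mul {f : EuclideanSpace ℝ ι → ℝ} {q : EuclideanSpace ℝ ι}
    (hf : DifferentiableAt ℝ f q) (c : ℝ) (i : ι) :
    pd i (fun y => c * f y) q = c * pd i f q := by
  simp only [pd]
  rw [fderiv_const_mul hf]
  simp

end CoordMetric

/-! ### The algebra of the curvature along a gradient line. -/

namespace CoordMetric

/-- The algebraic identity behind the formula for the curvature of a toric Kähler metric along a
gradient line: `G` and `U` are inverse to each other, `A`, `B` are the first and second derivatives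
of `G`, and `V` is the symmetric derivative of `U`. -/
theorem curvature_identity {G U : Fin 2 → Fin 2 → ℝ} {A V : Fin 2 → Fin 2 → Fin 2 → ℝ}
    {B : Fin 2 → Fin 2 → Fin 2 → Fin 2 → ℝ} {n w : Fin 2 → ℝ}
    (hw : ∀ i, w i = ∑ j, G i j * n j) (hG : ∀ i j, G i j = G j i)
    (hV : ∀ i j k, V i j k = V j i k)
    (hV' : ∀ i j k, V i j k = V i k j)
    (hA : ∀ q i j, A q i j = -∑ p, ∑ r, G i p * V q p r * G r j)
    (hUG : ∀ i j, ∑ p, U i p * G p j = if i = j then 1 else 0) :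
    (∑ c, ∑ d, (∑ i, ∑ j, B d c i j * n i * n j) * w d * w c) +
      ∑ c, (∑ i, ∑ j, A c i j * n i * n j) * (∑ d, (∑ j, A d c j * n j) * w d) =
    -2 * (∑ a, ∑ b, ∑ c, ∑ d, n a * n b * w c * n d *
      (-(1 / 2) * (∑ e, (A c a e * A e d b + G a e * B c e d b))
        - (1 / 4) * (∑ e, (∑ p, G a p * V c p e) * (∑ p, G e p * A p d b))
        + (1 / 4) * ∑ e, (∑ p, G a p * A p d e) * (∑ p, U e p * A c p b))) +
    ∑ e, ∑ p, (∑ d, (∑ j, A d e j * n j) * w d) * U e p * (∑ d, (∑ j, A d p j * n j) * w d) := by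
  have hAs : ∀ q i j, A q i j = A q j i := by
    intro q i j
    rw [hA, hA, Finset.sum_comm]
    congr 1
    refine Finset.sum_congr rfl fun r _ => Finset.sum_congr rfl fun p _ => ?_
    rw [hG i p, hG r j, hV' q p r]
    ring
  set a : Fin 2 → ℝ := fun e => ∑ d, (∑ j, A d e j * n j) * w d with ha
  set df : Fin 2 → ℝ := fun c => ∑ i, ∑ j, A c i j * n i * n j with hdf
  set v : Fin 2 → ℝ := fun e => ∑ c, ∑ p, w c * w p * V c p e with hv
  have h1 : ∀ q, df q = -v q := by
    intro q
    have e : ∀ c p, V c p q = V q c p := fun c p => by rw [hV' c p q, hV c q p]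
    simp only [hdf, hv, hA, hw, e, Fin.sum_univ_two, hG 1 0]
    ring
  have h2 : ∀ q, a q = -∑ e, G q e * v e := by
    intro q
    simp only [ha, hv, hA, hw, Fin.sum_univ_two, hG 1 0]
    rw [hV' 0 1 0, hV' 1 1 0]
    ring
  -- Here `a` plays the role of the acceleration of the gradient line and `df` of the differential
  -- of `f = G n n`, and they are dual to each other for `U`. Hence all terms quadratic in `A` and
  -- `V` are multiples of the one number `∑ a df`, with coefficients `-1/2`, `1/4`, `1/4` in the
  -- curvature, where they cancel.
  have h3 : ∀ e, ∑ p, U e p * a p = df e := by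
    intro e
    have : ∑ p, U e p * a p = -∑ q, (∑ p, U e p * G p q) * v q := by
      simp only [h2, Fin.sum_univ_two]; ring
    rw [this, h1]
    simp [hUG]
  have h4 : ∑ e, ∑ p, a e * U e p * a p = ∑ e, a e * df e := by
    refine Finset.sum_congr rfl fun e _ => ?_
    rw [← h3, Finset.mul_sum]
    exact Finset.sum_congr rfl fun p _ => by ring
  have h6 : ∑ e, v e * ∑ p, G e p * df p = -∑ e, a e * df e := by
    simp only [h2, Fin.sum_univ_two, hG 1 0]; ring
  have h5 : (∑ a, ∑ b, ∑ c, ∑ d, n a * n b * w c * n d *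
      (-(1 / 2) * (∑ e, (A c a e * A e d b + G a e * B c e d b))
        - (1 / 4) * (∑ e, (∑ p, G a p * V c p e) * (∑ p, G e p * A p d b))
        + (1 / 4) * ∑ e, (∑ p, G a p * A p d e) * (∑ p, U e p * A c p b))) =
      -(1 / 2) * (∑ e, a e * df e) -
        (1 / 2) * (∑ c, ∑ d, (∑ i, ∑ j, B d c i j * n i * n j) * w d * w c)
      - (1 / 4) * ∑ e, v e * ∑ p, G e p * df p
      + (1 / 4) * ∑ e, ∑ p, a e * U e p * a p := by
    have e1 : ∑ a, ∑ b, ∑ c, ∑ d, n a * n b * w c * n d * ∑ e, A c a e * A e d b =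
        ∑ e, a e * df e := by
      simp only [ha, hdf, Fin.sum_univ_two, hAs _ 1 0]; ring
    have e2 : ∑ a, ∑ b, ∑ c, ∑ d, n a * n b * w c * n d * ∑ e, G a e * B c e d b =
        ∑ c, ∑ d, (∑ i, ∑ j, B d c i j * n i * n j) * w d * w c := by
      have : ∑ c, ∑ d, (∑ i, ∑ j, B d c i j * n i * n j) * w d * w c =
        ∑ c, ∑ d, (∑ i, ∑ j, B d c i j * n i * n j) * w d * (∑ j, G j c * n j) := by
        refine Finset.sum_congr rfl fun c _ => Finset.sum_congr rfl fun d _ => ?_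
        congr 1
        rw [hw]
        exact Finset.sum_congr rfl fun j _ => by rw [hG]
      rw [this]
      simp only [Fin.sum_univ_two]; ring
    have e3 : ∑ a, ∑ b, ∑ c, ∑ d, n a * n b * w c * n d *
        (∑ e, (∑ p, G a p * V c p e) * (∑ p, G e p * A p d b)) =
        ∑ e, v e * ∑ p, G e p * df p := by
      have : ∀ e, v e = ∑ c, ∑ p, w c * (∑ j, G j p * n j) * V c p e := by
        intro e
        refine Finset.sum_congr rfl fun c _ => Finset.sum_congr rfl fun p _ => ?_
        rw [hw p]
        congr 2
        exact Finset.sum_congr rfl fun j _ => by rw [hG]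
      simp only [this, hdf, Fin.sum_univ_two]; ring
    have e4 : ∑ a, ∑ b, ∑ c, ∑ d, n a * n b * w c * n d *
        (∑ e, (∑ p, G a p * A p d e) * (∑ p, U e p * A c p b)) =
        ∑ e, ∑ p, a e * U e p * a p := by
      have : ∀ e, a e = ∑ d, (∑ j, A d j e * n j) * (∑ j, G j d * n j) := by
        intro e
        refine Finset.sum_congr rfl fun d _ => ?_
        rw [hw d]
        congr 1
        · exact Finset.sum_congr rfl fun j _ => by rw [hAs]
        · exact Finset.sum_congr rfl fun j _ => by rw [hG]
      have : ∑ e, ∑ p, a e * U e p * a p = ∑ e, ∑ p,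
        (∑ d, (∑ j, A d j e * n j) * (∑ j, G j d * n j)) * U e p * a p := by
        refine Finset.sum_congr rfl fun e _ => Finset.sum_congr rfl fun p _ => ?_
        rw [← this]
      rw [this]
      simp only [ha, Fin.sum_univ_two]; ring
    rw [← e1, ← e2, ← e3, ← e4]
    simp only [Finset.sum_add_distrib, mul_add, mul_sub, Finset.sum_sub_distrib]
    have pull : ∀ (r : ℝ) (F : Fin 2 → Fin 2 → Fin 2 → Fin 2 → ℝ),
        ∑ a, ∑ b, ∑ c, ∑ d, n a * n b * w c * n d * (r * F a b c d) =
        r * ∑ a, ∑ b, ∑ c, ∑ d, n a * n b * w c * n d * F a b c d := by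
      intro r F
      simp only [Finset.mul_sum]
      refine Finset.sum_congr rfl fun _ _ => Finset.sum_congr rfl fun _ _ =>
        Finset.sum_congr rfl fun _ _ => Finset.sum_congr rfl fun _ _ => by ring
    rw [pull, pull, pull, pull]
    ring
  rw [h5, h4, h6]
  have : ∑ c, df c * a c = ∑ e, a e * df e := Finset.sum_congr rfl fun _ _ => mul_comm _ _
  linear_combination this

end CoordMetric

/-! ### Symmetry of second derivatives, and the inverse Hessian. -/

namespace CoordMetric

open Filter Topology

theorem contDiffAt_pd {ι : Type} [Fintype ι] [DecidableEq ι] {h : EuclideanSpace ℝ ι → ℝ}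
    {x : EuclideanSpace ℝ ι} (hh : ContDiffAt ℝ ∞ h x) (i : ι) : ContDiffAt ℝ ∞ (pd i h) x :=
  (hh.fderiv_right (m := ∞) (by simp)).clm_apply contDiffAt_const

theorem pd_pd_eq {ι : Type} [Fintype ι] [DecidableEq ι] {h : EuclideanSpace ℝ ι → ℝ}
    {x : EuclideanSpace ℝ ι} (hh : ContDiffAt ℝ ∞ h x) (i j : ι) :
    pd i (pd j h) x =
      fderiv ℝ (fderiv ℝ h) x (EuclideanSpace.single i 1) (EuclideanSpace.single j 1) := by
  have h1 : HasFDerivAt (fderiv ℝ h) (fderiv ℝ (fderiv ℝ h) x) x :=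
    ((hh.fderiv_right (m := ∞) (by simp)).differentiableAt (by simp)).hasFDerivAt
  have h2 : HasFDerivAt (pd j h) _ x := (ContinuousLinearMap.apply ℝ ℝ
    (EuclideanSpace.single j (1 : ℝ) : EuclideanSpace ℝ ι)).hasFDerivAt.comp x h1
  rw [pd, h2.fderiv]
  rfl

theorem pd_pd_comm {ι : Type} [Fintype ι] [DecidableEq ι] {h : EuclideanSpace ℝ ι → ℝ}
    {x : EuclideanSpace ℝ ι} (hh : ContDiffAt ℝ ∞ h x) (i j : ι) :
    pd i (pd j h) x = pd j (pd i h) x := by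
  rw [pd_pd_eq hh, pd_pd_eq hh]
  exact hh.isSymmSndFDerivAt (by
    rw [minSmoothness_of_isRCLikeNormedField]
    exact WithTop.coe_le_coe.2 (le_top : (2 : ℕ∞) ≤ ⊤)) _ _

end CoordMetric

namespace DelzantPolygon

open CoordMetric Filter Topology

variable {P : DelzantPolygon} {u : EuclideanSpace ℝ (Fin 2) → ℝ}

/-- The inverse of the Hessian of `u`. -/
noncomputable def invHess (u : EuclideanSpace ℝ (Fin 2) → ℝ) (x : EuclideanSpace ℝ (Fin 2)) :
    Matrix (Fin 2) (Fin 2) ℝ := (hess u x)⁻¹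

/-- The gradient `(u^{ij} n_j)` of the linear function with coefficients `n`. -/
noncomputable def gradVec (u : EuclideanSpace ℝ (Fin 2) → ℝ) (n : Fin 2 → ℝ)
    (x : EuclideanSpace ℝ (Fin 2)) : Fin 2 → ℝ := invHess u x *ᵥ n

/-- The squared length `u^{ij} n_i n_j` of the gradient of the linear function with
coefficients `n`. -/
noncomputable def gradSq (u : EuclideanSpace ℝ (Fin 2) → ℝ) (n : Fin 2 → ℝ)
    (x : EuclideanSpace ℝ (Fin 2)) : ℝ := n ⬝ᵥ gradVec u n x

theorem sum_smul_single (w : Fin 2 → ℝ) : (WithLp.toLp 2 w : EuclideanSpace ℝ (Fin 2)) =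
    ∑ i, w i • EuclideanSpace.single i (1 : ℝ) := by
  ext k
  fin_cases k <;> simp [Fin.sum_univ_two]

theorem fderiv_toLp (h : EuclideanSpace ℝ (Fin 2) → ℝ) (x : EuclideanSpace ℝ (Fin 2))
    (w : Fin 2 → ℝ) : fderiv ℝ h x (WithLp.toLp 2 w) = ∑ c, pd c h x * w c := by
  rw [sum_smul_single, map_sum]
  simp only [map_smul, smul_eq_mul, pd]
  exact Finset.sum_congr rfl fun c _ => mul_comm _ _

namespace IsSymplecticPotential

variable (hu : P.IsSymplecticPotential u) {x : EuclideanSpace ℝ (Fin 2)} (hx : ∀ i, 0 < P.l i x)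

include hu hx

theorem hess_apply (i j : Fin 2) : hess u x i j =
    D2 u x (EuclideanSpace.single i 1) (EuclideanSpace.single j 1) :=
  pd_pd_eq (hu.contDiffAt hx) i j

theorem contDiffAt_hess (i j : Fin 2) : ContDiffAt ℝ ∞ (fun y => hess u y i j) x :=
  contDiffAt_pd (contDiffAt_pd (hu.contDiffAt hx) j) i

theorem hess_symm (i j : Fin 2) : hess u x i j = hess u x j i :=
  pd_pd_comm (hu.contDiffAt hx) i j

theorem pd_hess_symm (i j k : Fin 2) :
    pd i (fun y => hess u y j k) x = pd j (fun y => hess u y i k) x :=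
  pd_pd_comm (contDiffAt_pd (hu.contDiffAt hx) k) i j

theorem pd_hess_symm' (i j k : Fin 2) :
    pd i (fun y => hess u y j k) x = pd i (fun y => hess u y k j) x := by
  refine pd_congr ?_ i
  filter_upwards [eventually_pos hx] with y hy using hu.hess_symm hy j k

theorem dotProduct_hess (v w : Fin 2 → ℝ) :
    v ⬝ᵥ (hess u x *ᵥ w) = D2 u x (WithLp.toLp 2 v) (WithLp.toLp 2 w) := by
  rw [sum_smul_single v, sum_smul_single w]
  simp only [map_sum, map_smul, sum_apply, smul_apply, smul_eq_mul, dotProduct, Matrix.mulVec,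
    hu.hess_apply hx, Finset.mul_sum]
  rw [Finset.sum_comm]
  exact Finset.sum_congr rfl fun i _ => Finset.sum_congr rfl fun j _ => by ring

theorem posDef_hess : (hess u x).PosDef := by
  refine Matrix.PosDef.of_dotProduct_mulVec_pos ?_ fun w hw => ?_
  · ext i j
    simp [hu.hess_symm hx j i]
  · simp only [star_trivial]
    rw [hu.dotProduct_hess hx]
    refine hu.D2_pos hx fun h => hw ?_
    simpa using h

theorem det_hess_ne_zero : (hess u x).det ≠ 0 := (hu.posDef_hess hx).det_pos.ne'

theorem hess_mul_invHess : hess u x * invHess u x = 1 :=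
  Matrix.mul_nonsing_inv _ (hu.det_hess_ne_zero hx).isUnit

theorem invHess_mul_hess : invHess u x * hess u x = 1 :=
  Matrix.nonsing_inv_mul _ (hu.det_hess_ne_zero hx).isUnit

theorem posDef_invHess : (invHess u x).PosDef := (hu.posDef_hess hx).inv

theorem invHess_symm (i j : Fin 2) : invHess u x i j = invHess u x j i := by
  have := (hu.posDef_invHess hx).1.apply i j
  simpa using this.symm

theorem contDiffAt_invHess (i j : Fin 2) : ContDiffAt ℝ ∞ (fun y => invHess u y i j) x := by
  have h := hu.contDiffAt_hess hx
  have hdet : ContDiffAt ℝ ∞ (fun y => (hess u y).det) x := by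
    simp only [Matrix.det_fin_two]
    exact ((h 0 0).mul (h 1 1)).sub ((h 0 1).mul (h 1 0))
  simp only [invHess, Matrix.inv_def, Ring.inverse_eq_inv', Matrix.smul_apply, smul_eq_mul,
    Matrix.adjugate_fin_two]
  refine (hdet.inv (hu.det_hess_ne_zero hx)).mul ?_
  fin_cases i <;> fin_cases j <;> simp
  exacts [h 1 1, (h 0 1).neg, (h 1 0).neg, h 0 0]

theorem contDiffAt_gradVec (n : Fin 2 → ℝ) (i : Fin 2) :
    ContDiffAt ℝ ∞ (fun y => gradVec u n y i) x := by
  simp only [gradVec, Matrix.mulVec, dotProduct]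
  exact ContDiffAt.sum fun j _ => (hu.contDiffAt_invHess hx i j).mul contDiffAt_const

theorem contDiffAt_gradSq (n : Fin 2 → ℝ) : ContDiffAt ℝ ∞ (gradSq u n) x := by
  change ContDiffAt ℝ ∞ (fun y => ∑ i, n i * gradVec u n y i) x
  exact ContDiffAt.sum fun j _ => contDiffAt_const.mul (hu.contDiffAt_gradVec hx n j)

theorem gradSq_pos {n : Fin 2 → ℝ} (hn : n ≠ 0) : 0 < gradSq u n x := by
  have h := (hu.posDef_invHess hx).dotProduct_mulVec_pos hn
  rwa [star_trivial] at h

theorem hess_mulVec_gradVec (n : Fin 2 → ℝ) : hess u x *ᵥ gradVec u n x = n := by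
  rw [gradVec, Matrix.mulVec_mulVec, hu.hess_mul_invHess hx, Matrix.one_mulVec]

/-- Differentiate the identity `hess * invHess = 1` and multiply by the inverse from the left. -/
theorem pd_invHess (q i j : Fin 2) : pd q (fun y => invHess u y i j) x =
    -∑ p, ∑ r, invHess u x i p * pd q (fun y => hess u y p r) x * invHess u x r j := by
  have hd : ∀ i j, DifferentiableAt ℝ (fun y => invHess u y i j) x := fun i j =>
    (hu.contDiffAt_invHess hx i j).differentiableAt (by simp)
  have hd' : ∀ i j, DifferentiableAt ℝ (fun y => hess u y i j) x := fun i j =>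
    (hu.contDiffAt_hess hx i j).differentiableAt (by simp)
  have h1 : ∀ p, ∑ r, (pd q (fun y => hess u y p r) x * invHess u x r j +
      hess u x p r * pd q (fun y => invHess u y r j) x) = 0 := by
    intro p
    have e : (fun y => ∑ r, hess u y p r * invHess u y r j) =ᶠ[𝓝 x]
        fun _ => (1 : Matrix (Fin 2) (Fin 2) ℝ) p j := by
      filter_upwards [eventually_pos hx] with y hy
      rw [← hu.hess_mul_invHess hy, Matrix.mul_apply]
    have := pd_congr e q
    rw [pd_const, pd_sum fun r _ => (hd' p r).fun_mul (hd r j)] at this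
    rw [← this]
    exact Finset.sum_congr rfl fun r _ => (pd_mul (hd' p r) (hd r j) q).symm
  have h2 : ∀ r, ∑ p, invHess u x i p * hess u x p r = if i = r then 1 else 0 := by
    intro r
    rw [← Matrix.mul_apply, hu.invHess_mul_hess hx, Matrix.one_apply]
  have h3 : ∑ p, invHess u x i p * ∑ r, (pd q (fun y => hess u y p r) x * invHess u x r j +
      hess u x p r * pd q (fun y => invHess u y r j) x) = 0 := by
    simp [h1]
  have h4 : ∑ p, invHess u x i p * ∑ r, (pd q (fun y => hess u y p r) x * invHess u x r j +
      hess u x p r * pd q (fun y => invHess u y r j) x) =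
      ∑ p, ∑ r, invHess u x i p * pd q (fun y => hess u y p r) x * invHess u x r j +
      ∑ r, (∑ p, invHess u x i p * hess u x p r) * pd q (fun y => invHess u y r j) x := by
    simp only [Fin.sum_univ_two]; ring
  rw [h4] at h3
  simp only [h2, ite_mul, one_mul, zero_mul, Finset.sum_ite_eq, Finset.mem_univ, if_true] at h3
  linarith

end IsSymplecticPotential

end DelzantPolygon

/-! ### The curvature of the toric metric and a differential inequality for gradients. -/

namespace DelzantPolygon

open CoordMetric Filter Topology

variable {P : DelzantPolygon} {u : EuclideanSpace ℝ (Fin 2) → ℝ}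

theorem metric_eq (u : EuclideanSpace ℝ (Fin 2) → ℝ) (q : EuclideanSpace ℝ (Fin 2 ⊕ Fin 2)) :
    metric u q = Matrix.fromBlocks (hess u (actionPart q)) 0 0 (invHess u (actionPart q)) := rfl

theorem metric_inl_inl (i j : Fin 2) : (fun q => metric u q (Sum.inl i) (Sum.inl j)) =
    fun q => (fun x => hess u x i j) (actionPart q) := rfl

theorem metric_inr_inr (i j : Fin 2) : (fun q => metric u q (Sum.inr i) (Sum.inr j)) =
    fun q => (fun x => invHess u x i j) (actionPart q) := rfl

theorem metric_inl_inr (i j : Fin 2) : (fun q => metric u q (Sum.inl i) (Sum.inr j)) =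
    fun _ => 0 := rfl

theorem metric_inr_inl (i j : Fin 2) : (fun q => metric u q (Sum.inr i) (Sum.inl j)) =
    fun _ => 0 := rfl

theorem posSemidef_fromBlocks {A D : Matrix (Fin 2) (Fin 2) ℝ} (hA : A.PosDef) (hD : D.PosDef) :
    (Matrix.fromBlocks A 0 0 D).PosSemidef := by
  have : Invertible A := hA.isUnit.invertible
  have h := (Matrix.PosDef.fromBlocks₁₁ (A := A) 0 D hA).2 (by simpa using hD.posSemidef)
  simpa using h

theorem eventually_pos_actionPart {q : EuclideanSpace ℝ (Fin 2 ⊕ Fin 2)}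
    (hq : ∀ i, 0 < P.l i (actionPart q)) :
    ∀ᶠ q' in 𝓝 q, ∀ i, 0 < P.l i (actionPart q') :=
  (actionPart (ι := Fin 2) (ι' := Fin 2)).continuous.continuousAt.eventually (eventually_pos hq)

namespace IsSymplecticPotential

variable (hu : P.IsSymplecticPotential u) {q : EuclideanSpace ℝ (Fin 2 ⊕ Fin 2)}
  (hq : ∀ i, 0 < P.l i (actionPart q))

include hu hq

theorem metric_inv : (metric u q)⁻¹ =
    Matrix.fromBlocks (invHess u (actionPart q)) 0 0 (hess u (actionPart q)) := by
  refine Matrix.inv_eq_right_inv ?_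
  rw [metric_eq, Matrix.fromBlocks_multiply]
  simp [hu.hess_mul_invHess hq, hu.invHess_mul_hess hq]

theorem differentiableAt_hess (i j : Fin 2) :
    DifferentiableAt ℝ (fun x => hess u x i j) (actionPart q) :=
  (hu.contDiffAt_hess hq i j).differentiableAt (by simp)

theorem differentiableAt_invHess (i j : Fin 2) :
    DifferentiableAt ℝ (fun x => invHess u x i j) (actionPart q) :=
  (hu.contDiffAt_invHess hq i j).differentiableAt (by simp)

theorem christoffel_inl_inr_inr (a d b : Fin 2) :
    christoffel (metric u) (Sum.inl a) (Sum.inr d) (Sum.inr b) q =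
      -(1 / 2) * ∑ e, invHess u (actionPart q) a e *
        pd e (fun x => invHess u x d b) (actionPart q) := by
  rw [christoffel, hu.metric_inv hq]
  simp only [Fintype.sum_sum_type, metric_inr_inr, metric_inl_inr,
    pd_const, pd_comp_inl (hu.differentiableAt_invHess hq _ _),
    Matrix.fromBlocks_apply₁₁, Matrix.fromBlocks_apply₁₂, Matrix.zero_apply, zero_mul,
    Finset.sum_const_zero, add_zero, zero_sub, mul_neg, Finset.sum_neg_distrib]
  ring

theorem christoffel_inl_inl_inl (a c e : Fin 2) :
    christoffel (metric u) (Sum.inl a) (Sum.inl c) (Sum.inl e) q =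
      (1 / 2) * ∑ p, invHess u (actionPart q) a p *
        pd c (fun x => hess u x p e) (actionPart q) := by
  rw [christoffel, hu.metric_inv hq]
  simp only [Fintype.sum_sum_type, metric_inl_inl, metric_inr_inl,
    pd_const, pd_comp_inl (hu.differentiableAt_hess hq _ _),
    Matrix.fromBlocks_apply₁₁, Matrix.fromBlocks_apply₁₂, Matrix.zero_apply, zero_mul,
    Finset.sum_const_zero, add_zero]
  congr 1
  refine Finset.sum_congr rfl fun p _ => ?_
  rw [hu.pd_hess_symm hq p c e, hu.pd_hess_symm' hq e p c, hu.pd_hess_symm hq e c p,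
    hu.pd_hess_symm' hq c p e]
  ring

theorem christoffel_inr_inl_inr (e c b : Fin 2) :
    christoffel (metric u) (Sum.inr e) (Sum.inl c) (Sum.inr b) q =
      (1 / 2) * ∑ p, hess u (actionPart q) e p *
        pd c (fun x => invHess u x p b) (actionPart q) := by
  rw [christoffel, hu.metric_inv hq]
  simp only [Fintype.sum_sum_type, metric_inl_inl, metric_inr_inr, metric_inl_inr, metric_inr_inl,
    pd_const, pd_comp_inl (hu.differentiableAt_invHess hq _ _),
    Matrix.fromBlocks_apply₂₂, Matrix.fromBlocks_apply₂₁, Matrix.zero_apply, zero_mul,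
    Finset.sum_const_zero, add_zero, zero_add, sub_zero]

theorem christoffel_inl_inl_inr (a c e : Fin 2) :
    christoffel (metric u) (Sum.inl a) (Sum.inl c) (Sum.inr e) q = 0 := by
  rw [christoffel, hu.metric_inv hq]
  simp [Fintype.sum_sum_type, metric_inl_inl, metric_inl_inr, metric_inr_inl,
    pd_const, pd_comp_inr (hu.differentiableAt_hess hq _ _)]

theorem christoffel_inl_inr_inl (a d e : Fin 2) :
    christoffel (metric u) (Sum.inl a) (Sum.inr d) (Sum.inl e) q = 0 := by
  rw [christoffel, hu.metric_inv hq]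
  simp [Fintype.sum_sum_type, metric_inl_inl, metric_inl_inr, metric_inr_inl,
    pd_const, pd_comp_inr (hu.differentiableAt_hess hq _ _)]

/-- Among the mixed action-angle components this type is enough: contracted with `n` and the
gradient it produces the second derivative of `gradSq`. The `θ`-derivative drops out because the
Christoffel symbol it acts on vanishes. -/
theorem riemann_inl_inr_inl_inr (a b c d : Fin 2) :
    riemann (metric u) (Sum.inl a) (Sum.inr b) (Sum.inl c) (Sum.inr d) q =
      -(1 / 2) * (∑ e, (pd c (fun x => invHess u x a e) (actionPart q) *
          pd e (fun x => invHess u x d b) (actionPart q) +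
        invHess u (actionPart q) a e *
          pd c (pd e fun x => invHess u x d b) (actionPart q)))
      - (1 / 4) * (∑ e, (∑ p, invHess u (actionPart q) a p *
          pd c (fun x => hess u x p e) (actionPart q)) *
        (∑ p, invHess u (actionPart q) e p * pd p (fun x => invHess u x d b) (actionPart q)))
      + (1 / 4) * ∑ e, (∑ p, invHess u (actionPart q) a p *
          pd p (fun x => invHess u x d e) (actionPart q)) *
        (∑ p, hess u (actionPart q) e p * pd c (fun x => invHess u x p b) (actionPart q)) := by
  have h1 : pd (Sum.inl c) (christoffel (metric u) (Sum.inl a) (Sum.inr d) (Sum.inr b)) q =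
      -(1 / 2) * (∑ e, (pd c (fun x => invHess u x a e) (actionPart q) *
          pd e (fun x => invHess u x d b) (actionPart q) +
        invHess u (actionPart q) a e *
          pd c (pd e fun x => invHess u x d b) (actionPart q))) := by
    have e1 : christoffel (metric u) (Sum.inl a) (Sum.inr d) (Sum.inr b) =ᶠ[𝓝 q]
        fun q => (fun x => -(1 / 2) * ∑ e, invHess u x a e *
          pd e (fun x => invHess u x d b) x) (actionPart q) := by
      filter_upwards [eventually_pos_actionPart hq] with q' hq'
        using hu.christoffel_inl_inr_inr hq' a d b
    have d1 : ∀ e, DifferentiableAt ℝ (pd e fun x => invHess u x d b) (actionPart q) := fun e =>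
      (contDiffAt_pd (hu.contDiffAt_invHess hq d b) e).differentiableAt (by simp)
    have d2 : ∀ e ∈ Finset.univ, DifferentiableAt ℝ (fun x => invHess u x a e *
          pd e (fun x => invHess u x d b) x) (actionPart q) := fun e _ =>
      (hu.differentiableAt_invHess hq a e).fun_mul (d1 e)
    have d3 : DifferentiableAt ℝ (fun x => ∑ e, invHess u x a e *
          pd e (fun x => invHess u x d b) x) (actionPart q) := DifferentiableAt.fun_sum d2
    rw [pd_congr e1, pd_comp_inl (d3.const_mul _), pd_const_mul d3, pd_sum d2]
    congr 1
    exact Finset.sum_congr rfl fun e _ => pd_mul (hu.differentiableAt_invHess hq a e) (d1 e) c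
  have h2 : pd (Sum.inr d) (christoffel (metric u) (Sum.inl a) (Sum.inl c) (Sum.inr b)) q = 0 := by
    have e1 : christoffel (metric u) (Sum.inl a) (Sum.inl c) (Sum.inr b) =ᶠ[𝓝 q]
        fun _ => (0 : ℝ) := by
      filter_upwards [eventually_pos_actionPart hq] with q' hq'
        using hu.christoffel_inl_inl_inr hq' a c b
    rw [pd_congr e1, pd_const]
  rw [riemann, h1, h2]
  simp only [Fintype.sum_sum_type, hu.christoffel_inl_inl_inr hq, hu.christoffel_inl_inr_inl hq,
    hu.christoffel_inl_inr_inr hq, hu.christoffel_inl_inl_inl hq, hu.christoffel_inr_inl_inr hq,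
    Fin.sum_univ_two]
  ring

omit hq in
theorem pd_gradVec {x : EuclideanSpace ℝ (Fin 2)} (hx : ∀ i, 0 < P.l i x) (n : Fin 2 → ℝ)
    (c d : Fin 2) : pd d (fun y => gradVec u n y c) x =
      ∑ j, pd d (fun y => invHess u y c j) x * n j := by
  have hd : ∀ j, DifferentiableAt ℝ (fun y => invHess u y c j) x := fun j =>
    (hu.contDiffAt_invHess hx c j).differentiableAt (by simp)
  simp only [gradVec, Matrix.mulVec, dotProduct]
  rw [pd_sum fun j _ => (hd j).mul_const _]
  refine Finset.sum_congr rfl fun j _ => ?_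
  rw [pd_mul (hd j) (differentiableAt_const _), pd_const, mul_zero, add_zero]

omit hq in
theorem pd_gradSq {x : EuclideanSpace ℝ (Fin 2)} (hx : ∀ i, 0 < P.l i x) (n : Fin 2 → ℝ)
    (c : Fin 2) : pd c (gradSq u n) x =
      ∑ i, ∑ j, pd c (fun y => invHess u y i j) x * n i * n j := by
  have hd : ∀ i, DifferentiableAt ℝ (fun y => gradVec u n y i) x := fun i =>
    (hu.contDiffAt_gradVec hx n i).differentiableAt (by simp)
  change pd c (fun y => ∑ i, n i * gradVec u n y i) x = _
  rw [pd_sum fun j _ => (hd j).const_mul _]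
  refine Finset.sum_congr rfl fun i _ => ?_
  rw [pd_const_mul (hd i), hu.pd_gradVec hx, Finset.mul_sum]
  exact Finset.sum_congr rfl fun j _ => by ring

omit hq in
theorem pd_pd_gradSq {x : EuclideanSpace ℝ (Fin 2)} (hx : ∀ i, 0 < P.l i x) (n : Fin 2 → ℝ)
    (c d : Fin 2) : pd d (pd c (gradSq u n)) x =
      ∑ i, ∑ j, pd d (pd c fun y => invHess u y i j) x * n i * n j := by
  have hd : ∀ i j, DifferentiableAt ℝ (pd c fun y => invHess u y i j) x := fun i j =>
    (contDiffAt_pd (hu.contDiffAt_invHess hx i j) c).differentiableAt (by simp)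
  have e : pd c (gradSq u n) =ᶠ[𝓝 x]
      fun x => ∑ i, ∑ j, pd c (fun y => invHess u y i j) x * n i * n j := by
    filter_upwards [eventually_pos hx] with y hy using hu.pd_gradSq hy n c
  rw [pd_congr e, pd_sum fun i _ => DifferentiableAt.fun_sum fun j _ =>
    ((hd i j).mul_const _).mul_const _]
  refine Finset.sum_congr rfl fun i _ => ?_
  rw [pd_sum fun j _ => ((hd i j).mul_const _).mul_const _]
  refine Finset.sum_congr rfl fun j _ => ?_
  rw [pd_mul ((hd i j).mul_const _) (differentiableAt_const _), pd_const, mul_zero, add_zero,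
    pd_mul (hd i j) (differentiableAt_const _), pd_const, mul_zero, add_zero]

/-- The contraction of the curvature tensor computing `|Rm|` along a gradient vector. -/
theorem abs_contract_riemann_le (n : Fin 2 → ℝ) :
    |∑ a, ∑ b, ∑ c, ∑ d, n a * n b * gradVec u n (actionPart q) c * n d *
      riemann (metric u) (Sum.inl a) (Sum.inr b) (Sum.inl c) (Sum.inr d) q| ≤
      gradSq u n (actionPart q) ^ 2 * riemannNorm (metric u) q := by
  set x := actionPart q with hx
  set w := gradVec u n x with hw
  have hg : (metric u q).PosSemidef :=
    posSemidef_fromBlocks (hu.posDef_hess hq) (hu.posDef_invHess hq)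
  have hh : ((metric u q)⁻¹).PosSemidef := by
    rw [hu.metric_inv hq]
    exact posSemidef_fromBlocks (hu.posDef_invHess hq) (hu.posDef_hess hq)
  -- Each of the four test vectors has squared length `w ⬝ n = gradSq`, since the Hessian takes `w`
  -- to `n`. The fourth power under the root becomes the square in the statement.
  have key := Matrix.sq_contract_le hg hh (fun a b c d => riemann (metric u) a b c d q)
    (Sum.elim w 0) (Sum.elim 0 w) (Sum.elim n 0) (Sum.elim 0 w)
  have hN : riemannNorm (metric u) q = Real.sqrt (∑ a, ∑ b, ∑ c, ∑ d, ∑ a', ∑ b', ∑ c', ∑ d',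
    metric u q a a' * (metric u q)⁻¹ b b' * (metric u q)⁻¹ c c' * (metric u q)⁻¹ d d' *
      riemann (metric u) a b c d q * riemann (metric u) a' b' c' d' q) := rfl
  generalize (∑ a, ∑ b, ∑ c, ∑ d, ∑ a', ∑ b', ∑ c', ∑ d',
    metric u q a a' * (metric u q)⁻¹ b b' * (metric u q)⁻¹ c c' * (metric u q)⁻¹ d d' *
      riemann (metric u) a b c d q * riemann (metric u) a' b' c' d' q) = N at key hN
  have hUw : hess u x *ᵥ w = n := hu.hess_mulVec_gradVec hq n
  have hGn : invHess u x *ᵥ n = w := rfl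
  have e1 : metric u q *ᵥ Sum.elim w 0 = Sum.elim n (0 : Fin 2 → ℝ) := by
    rw [metric_eq, Matrix.fromBlocks_mulVec]
    simp [← hx, hUw]
  have e2 : (metric u q)⁻¹ *ᵥ Sum.elim 0 w = Sum.elim (0 : Fin 2 → ℝ) n := by
    rw [hu.metric_inv hq, Matrix.fromBlocks_mulVec]
    simp [← hx, hUw]
  have e3 : (metric u q)⁻¹ *ᵥ Sum.elim n 0 = Sum.elim w (0 : Fin 2 → ℝ) := by
    rw [hu.metric_inv hq, Matrix.fromBlocks_mulVec]
    simp [← hx, hGn]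
  have hf : n ⬝ᵥ w = gradSq u n x := rfl
  have hf' : w ⬝ᵥ n = gradSq u n x := by rw [dotProduct_comm]; rfl
  rw [e1, e2, e3] at key
  simp only [Fintype.sum_sum_type, Sum.elim_inl, Sum.elim_inr, Pi.zero_apply, zero_mul, mul_zero,
    Finset.sum_const_zero, add_zero, zero_add, sumElim_dotProduct_sumElim, dotProduct_zero,
    hf, hf'] at key
  have hnn : 0 ≤ gradSq u n x := by
    have h := (hu.posDef_invHess hq).posSemidef.dotProduct_mulVec_nonneg n
    rwa [star_trivial] at h
  rw [hN, ← Real.sqrt_sq (sq_nonneg (gradSq u n x)), ← Real.sqrt_mul (by positivity)]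
  exact Real.abs_le_sqrt (key.trans (le_of_eq (by ring)))

omit hq in
/-- The curvature bound as a differential inequality for the squared length of the gradient of a
linear function along its gradient lines. -/
theorem sq_deriv_gradSq_le {x : EuclideanSpace ℝ (Fin 2)} (hx : ∀ i, 0 < P.l i x) {K : ℝ}
    (hK : P.CurvatureBoundedBy u K) {n : Fin 2 → ℝ} (hn : n ≠ 0) :
    (∑ c, pd c (gradSq u n) x * gradVec u n x c) ^ 2 - 2 * K * gradSq u n x ^ 3 ≤
      ((∑ c, ∑ d, pd d (pd c (gradSq u n)) x * gradVec u n x d * gradVec u n x c) +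
        ∑ c, pd c (gradSq u n) x * ∑ d, pd d (fun y => gradVec u n y c) x * gradVec u n x d) *
      gradSq u n x := by
  -- The angles are set to zero; the metric does not depend on them.
  set q : EuclideanSpace ℝ (Fin 2 ⊕ Fin 2) := WithLp.toLp 2 (Sum.elim x 0)
  have hqx : actionPart q = x := rfl
  have hR := hu.abs_contract_riemann_le (q := q) hx n
  have hKq := hK q (P.mem_interior.2 hx)
  rw [hqx] at hR
  set w := gradVec u n x with hw
  set a : Fin 2 → ℝ := fun c => ∑ d, pd d (fun y => gradVec u n y c) x * w d with ha
  set S := ∑ a, ∑ b, ∑ c, ∑ d, n a * n b * w c * n d *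
      riemann (metric u) (Sum.inl a) (Sum.inr b) (Sum.inl c) (Sum.inr d) q with hS
  have hid : (∑ c, ∑ d, pd d (pd c (gradSq u n)) x * w d * w c) + ∑ c, pd c (gradSq u n) x * a c =
      -2 * S + a ⬝ᵥ (hess u x *ᵥ a) := by
    have h := curvature_identity (G := invHess u x) (U := hess u x)
      (A := fun k i j => pd k (fun y => invHess u y i j) x)
      (V := fun k i j => pd k (fun y => hess u y i j) x)
      (B := fun k l i j => pd k (pd l fun y => invHess u y i j) x) (n := n) (w := w)
      (fun i => rfl) (hu.invHess_symm hx) (hu.pd_hess_symm hx) (hu.pd_hess_symm' hx)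
      (hu.pd_invHess hx) (fun i j => by
        rw [← Matrix.mul_apply, hu.hess_mul_invHess hx, Matrix.one_apply])
    simp only [hS, hu.riemann_inl_inr_inl_inr (q := q) hx, hqx, ha, hu.pd_gradSq hx,
      hu.pd_pd_gradSq hx, hu.pd_gradVec hx]
    refine h.trans ?_
    congr 1
    simp only [dotProduct, Matrix.mulVec]
    refine Finset.sum_congr rfl fun e _ => ?_
    rw [Finset.mul_sum]
    exact Finset.sum_congr rfl fun p _ => by rw [mul_assoc]
  have hdf : ∑ c, pd c (gradSq u n) x * w c = n ⬝ᵥ a := by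
    simp only [hu.pd_gradSq hx, ha, hu.pd_gradVec hx, Fin.sum_univ_two, dotProduct]
    ring
  -- With `f' = n ⬝ a` and `n` the Hessian applied to `w`, this reads `f'² ≤ (a ⬝ U a) f`, so the
  -- positive term of `f''` absorbs `f'²`.
  have hcs := (hu.posDef_hess hx).posSemidef.sq_dotProduct_mulVec_le a w
  rw [hu.hess_mulVec_gradVec hx n, dotProduct_comm a n, dotProduct_comm _ n] at hcs
  have hf : n ⬝ᵥ w = gradSq u n x := rfl
  rw [hf] at hcs
  have hpos := hu.gradSq_pos hx hn
  have hSle : S ≤ gradSq u n x ^ 2 * K := (le_abs_self _).trans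
    (hR.trans (mul_le_mul_of_nonneg_left hKq (sq_nonneg _)))
  rw [hid, hdf]
  nlinarith [mul_le_mul_of_nonneg_right hSle hpos.le]

end IsSymplecticPotential

end DelzantPolygon

/-! ### The comparison argument on a half-line. -/

theorem monotoneOn_Iic_of_hasDerivAt {g g' : ℝ → ℝ} {b : ℝ}
    (hg : ∀ s ≤ b, HasDerivAt g (g' s) s) (h : ∀ s ≤ b, 0 ≤ g' s) : MonotoneOn g (Iic b) := by
  refine monotoneOn_of_hasDerivWithinAt_nonneg (convex_Iic b) (f' := g')
    (fun s hs => (hg s hs).continuousAt.continuousWithinAt)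
    (fun s hs => (hg s (mem_Iic.1 (interior_subset hs))).hasDerivWithinAt)
    (fun s hs => h s (mem_Iic.1 (interior_subset hs)))

/-- A function that is bounded below towards `-∞` has arbitrarily small slopes there. -/
theorem exists_deriv_lt {m f : ℝ → ℝ} {b c : ℝ} (hm : ∀ s ≤ b, HasDerivAt m (f s) s)
    (hpos : ∀ s ≤ b, 0 < m s) (hc : 0 < c) : ∃ s ≤ b, f s < c := by
  by_contra! h
  have h1 : MonotoneOn (fun s => m s - c * s) (Iic b) :=
    monotoneOn_Iic_of_hasDerivAt (fun s hs => (hm s hs).sub ((hasDerivAt_id s).const_mul c))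
      (fun s hs => by simpa using h s hs)
  have hs : b - m b / c ≤ b := by
    have := hpos b le_rfl
    have : 0 < m b / c := by positivity
    linarith
  have h2 := h1 hs (mem_Iic.2 le_rfl) hs
  have h3 := hpos _ hs
  have h4 : c * (b - m b / c) = c * b - m b := by field_simp
  simp only at h2
  linarith

/-- If the logarithm of `m' = f > 0` satisfies `(log f)'' ≥ -K f` and `f ≥ 2 m / (1 + C m)`, then
`f ≥ m`, uniformly in `C`, as long as `K m ≤ 1 / 2`. -/
theorem le_deriv_of_log_convex {m f f₁ f₂ : ℝ → ℝ} {K C : ℝ}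
    (hm : ∀ s ≤ 0, HasDerivAt m (f s) s) (hf : ∀ s ≤ 0, HasDerivAt f (f₁ s) s)
    (hf₁ : ∀ s ≤ 0, HasDerivAt f₁ (f₂ s) s) (hmpos : ∀ s ≤ 0, 0 < m s)
    (hfpos : ∀ s ≤ 0, 0 < f s) (hineq : ∀ s ≤ 0, f₁ s ^ 2 - K * f s ^ 3 ≤ f₂ s * f s)
    (hK : 0 < K) (hC : 0 ≤ C) (hlow : ∀ s ≤ 0, 2 * m s ≤ f s * (1 + C * m s))
    (h0 : K * m 0 ≤ 1 / 2) : m 0 ≤ f 0 := by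
  have hmono : MonotoneOn m (Iic 0) := monotoneOn_Iic_of_hasDerivAt hm fun s hs => (hfpos s hs).le
  have hmle : ∀ s ≤ 0, m s ≤ m 0 := fun s hs => hmono hs (mem_Iic.2 le_rfl) hs
  -- Since `m` stays positive towards `-∞`, its slope `f` is small somewhere, and `hlow` then makes
  -- `m` small there.
  have hsmall : ∀ b ≤ 0, ∀ ε > 0, ∃ s ≤ b, m s < ε := by
    intro b hb ε hε
    have hm0 := hmpos 0 le_rfl
    obtain ⟨s, hs, hlt⟩ := exists_deriv_lt (c := 2 * ε / (1 + C * m 0))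
      (fun s hs => hm s (hs.trans hb)) (fun s hs => hmpos s (hs.trans hb)) (by positivity)
    refine ⟨s, hs, ?_⟩
    rw [lt_div_iff₀ (by positivity)] at hlt
    have h1 := hlow s (hs.trans hb)
    have h2 : f s * (1 + C * m s) ≤ f s * (1 + C * m 0) := by
      have := hfpos s (hs.trans hb)
      have := hmle s (hs.trans hb)
      gcongr
    linarith
  have hφd : ∀ s ≤ 0, HasDerivAt (fun s => f₁ s / f s + K * m s)
      ((f₂ s * f s - f₁ s * f₁ s) / f s ^ 2 + K * f s) s := fun s hs =>
    ((hf₁ s hs).div (hf s hs) (hfpos s hs).ne').add ((hm s hs).const_mul K)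
  -- Its derivative is `(log f)'' + K f`.
  have hφ : MonotoneOn (fun s => f₁ s / f s + K * m s) (Iic 0) := by
    refine monotoneOn_Iic_of_hasDerivAt hφd fun s hs => ?_
    have h1 := hineq s hs
    have h2 := hfpos s hs
    have : (f₂ s * f s - f₁ s * f₁ s) / f s ^ 2 + K * f s =
        (f₂ s * f s - f₁ s ^ 2 + K * f s ^ 3) / f s ^ 2 := by
      field_simp
    rw [this]
    exact div_nonneg (by linarith) (by positivity)
  -- The expected limit at `-∞` is `2`, and `3/2` leaves room on both sides. If the bound failed,
  -- then `f' ≤ (3/2) m'` towards `-∞`; at a point where `m` is so small that `f ≥ (7/4) m`, going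
  -- backwards would keep `f` above a positive constant, against the positivity of `m`.
  have hφge : ∀ s ≤ 0, 3 / 2 ≤ f₁ s / f s + K * m s := by
    by_contra! h
    obtain ⟨b, hb, hlt⟩ := h
    -- This gives `C * m s₂ ≤ 1/7`, and `2 / (1 + 1/7) = 7/4`.
    obtain ⟨s₂, hs₂, hms₂⟩ := hsmall b hb (1 / (7 * C + 7)) (by positivity)
    have hs₂0 := hs₂.trans hb
    have h1 : ∀ s ≤ s₂, f₁ s ≤ 3 / 2 * f s := by
      intro s hs
      have h2 := hφ (mem_Iic.2 (hs.trans hs₂0)) hb (hs.trans hs₂)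
      have h3 := hmpos s (hs.trans hs₂0)
      have h4 : f₁ s / f s ≤ 3 / 2 := by
        have : 0 < K * m s := by positivity
        simp only at h2
        linarith
      rwa [div_le_iff₀ (hfpos s (hs.trans hs₂0))] at h4
    have h2 : MonotoneOn (fun s => 3 / 2 * m s - f s) (Iic s₂) :=
      monotoneOn_Iic_of_hasDerivAt (fun s hs =>
        ((hm s (hs.trans hs₂0)).const_mul _).sub (hf s (hs.trans hs₂0)))
        (fun s hs => by have := h1 s hs; linarith)
    have hm2 := hmpos s₂ hs₂0
    have h3 : 7 / 4 * m s₂ ≤ f s₂ := by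
      have h4 := hlow s₂ hs₂0
      have h5 : C * m s₂ ≤ 1 / 7 := by
        rw [lt_div_iff₀ (by positivity)] at hms₂
        nlinarith
      have h6 : f s₂ * (1 + C * m s₂) ≤ f s₂ * (8 / 7) := by
        have := hfpos s₂ hs₂0
        gcongr
        linarith
      linarith
    obtain ⟨s, hs, hlt⟩ := exists_deriv_lt (c := m s₂ / 4)
      (fun s hs => hm s (hs.trans hs₂0)) (fun s hs => hmpos s (hs.trans hs₂0)) (by positivity)
    have h4 := h2 (mem_Iic.2 hs) (mem_Iic.2 le_rfl) hs
    have h5 := hmpos s (hs.trans hs₂0)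
    simp only at h4
    linarith
  -- `3/2 - K m ≥ 1`, by monotonicity of `m` and the hypothesis at `0`.
  have hge : ∀ s ≤ 0, f s ≤ f₁ s := by
    intro s hs
    have h1 := hφge s hs
    have h2 : K * m s ≤ K * m 0 := by
      have := hmle s hs
      gcongr
    have h3 : 1 ≤ f₁ s / f s := by linarith
    rwa [le_div_iff₀ (hfpos s hs), one_mul] at h3
  have hfin : MonotoneOn (fun s => f s - m s) (Iic 0) :=
    monotoneOn_Iic_of_hasDerivAt (fun s hs => (hf s hs).sub (hm s hs))
      (fun s hs => by have := hge s hs; linarith)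
  by_contra! hlt
  obtain ⟨s, hs, hms⟩ := hsmall 0 le_rfl (m 0 - f 0) (by linarith)
  have h1 := hfin (mem_Iic.2 hs) (mem_Iic.2 le_rfl) hs
  have h2 := hfpos s hs
  simp only at h1
  linarith

/-! ### Gradient lines of affine functions. -/

namespace DelzantPolygon

open CoordMetric Filter Topology

variable {P : DelzantPolygon} {u : EuclideanSpace ℝ (Fin 2) → ℝ}

namespace IsSymplecticPotential

/-- Strict differentiability of the gradient map is what the inverse function theorem needs in
`exists_flow`. -/
theorem hasStrictFDerivAt_grad (hu : P.IsSymplecticPotential u) {x : EuclideanSpace ℝ (Fin 2)}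
    (hx : ∀ i, 0 < P.l i x) :
    HasStrictFDerivAt (fun x => (WithLp.toLp 2 fun i => pd i u x : EuclideanSpace ℝ (Fin 2)))
      (Matrix.toEuclideanCLM (𝕜 := ℝ) (hess u x)) x := by
  rw [hasStrictFDerivAt_euclidean]
  intro i
  have h1 : HasStrictFDerivAt (pd i u) (fderiv ℝ (pd i u) x) x :=
    (contDiffAt_pd (hu.contDiffAt hx) i).hasStrictFDerivAt (by simp)
  refine h1.congr_fderiv ?_
  ext w
  have h2 := fderiv_toLp (pd i u) x w.ofLp
  rw [WithLp.toLp_ofLp] at h2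
  rw [h2]
  simp only [ContinuousLinearMap.comp_apply, PiLp.proj_apply, Matrix.ofLp_toEuclideanCLM,
    Matrix.mulVec, dotProduct]
  refine Finset.sum_congr rfl fun c _ => ?_
  rw [hu.hess_symm hx i c]
  rfl

theorem hess_toEuclideanCLM_inv (hu : P.IsSymplecticPotential u) {x : EuclideanSpace ℝ (Fin 2)}
    (hx : ∀ i, 0 < P.l i x) : ∃ e : EuclideanSpace ℝ (Fin 2) ≃L[ℝ] EuclideanSpace ℝ (Fin 2),
      (e : EuclideanSpace ℝ (Fin 2) →L[ℝ] EuclideanSpace ℝ (Fin 2)) =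
        Matrix.toEuclideanCLM (𝕜 := ℝ) (hess u x) ∧
      ∀ n : Fin 2 → ℝ, e.symm (WithLp.toLp 2 n) = WithLp.toLp 2 (gradVec u n x) := by
  refine ⟨ContinuousLinearEquiv.equivOfInverse (Matrix.toEuclideanCLM (𝕜 := ℝ) (hess u x))
    (Matrix.toEuclideanCLM (𝕜 := ℝ) (invHess u x)) ?_ ?_, rfl, ?_⟩
  · intro w
    rw [← mul_apply_eq_comp, ← map_mul, hu.invHess_mul_hess hx, map_one,
      one_apply_eq_self]
  · intro w
    rw [← mul_apply_eq_comp, ← map_mul, hu.hess_mul_invHess hx, map_one,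
      one_apply_eq_self]
  · intro n
    rfl

/-- The gradient lines of a linear function exist for all times; along them the differential of
`u` moves with constant velocity. -/
theorem exists_flow (hu : P.IsSymplecticPotential u) {x₀ : EuclideanSpace ℝ (Fin 2)}
    (hx₀ : ∀ i, 0 < P.l i x₀) (n : Fin 2 → ℝ) : ∃ X : ℝ → EuclideanSpace ℝ (Fin 2),
      X 0 = x₀ ∧ (∀ s i, 0 < P.l i (X s)) ∧
      (∀ s, HasDerivAt X (WithLp.toLp 2 (gradVec u n (X s))) s) ∧
      ∀ s i, pd i u (X s) = pd i u x₀ + s * n i := by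
  set ν : EuclideanSpace ℝ (Fin 2) →L[ℝ] ℝ := innerSL ℝ (WithLp.toLp 2 n) with hν
  have hνe : ∀ i, ν (EuclideanSpace.single i 1) = n i := by
    intro i
    simp [hν, EuclideanSpace.inner_single_right]
  -- The curve is defined as the preimage of a straight line under the bijection `Du`, which makes
  -- it global in time without solving an equation. Its differentiability comes from the local
  -- inverse, which agrees with `X` by injectivity of `Du`.
  choose X hXpos hX using fun s : ℝ => hu.exists_fderiv_eq (fderiv ℝ u x₀ + s • ν)
  have hpd : ∀ s i, pd i u (X s) = pd i u x₀ + s * n i := by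
    intro s i
    rw [pd, hX, add_apply, smul_apply, hνe]
    rfl
  refine ⟨X, ?_, hXpos, fun s => ?_, hpd⟩
  · exact hu.fderiv_injOn (hXpos 0) hx₀ (by rw [hX]; simp)
  · set g : EuclideanSpace ℝ (Fin 2) → EuclideanSpace ℝ (Fin 2) :=
      fun x => WithLp.toLp 2 fun i => pd i u x with hg
    set γ : ℝ → EuclideanSpace ℝ (Fin 2) := fun s => g x₀ + s • WithLp.toLp 2 n with hγ
    have hgX : ∀ s, g (X s) = γ s := by
      intro s
      ext i
      simp [hg, hγ, hpd]
    have hginj : ∀ x y, (∀ i, 0 < P.l i x) → (∀ i, 0 < P.l i y) → g x = g y → x = y := by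
      intro x y hx hy hxy
      refine hu.fderiv_injOn hx hy (ContinuousLinearMap.ext fun w => ?_)
      have h1 := fderiv_toLp u x w.ofLp
      have h2 := fderiv_toLp u y w.ofLp
      rw [WithLp.toLp_ofLp] at h1 h2
      rw [h1, h2]
      refine Finset.sum_congr rfl fun c _ => ?_
      have := congrArg (fun z : EuclideanSpace ℝ (Fin 2) => z c) hxy
      simp only [hg] at this
      rw [this]
    obtain ⟨e, he, hes⟩ := hu.hess_toEuclideanCLM_inv (hXpos s)
    have hstrict : HasStrictFDerivAt g (e : EuclideanSpace ℝ (Fin 2) →L[ℝ] EuclideanSpace ℝ (Fin 2))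
      (X s) := he ▸ hu.hasStrictFDerivAt_grad (hXpos s)
    set φ := hstrict.localInverse g e (X s) with hφ
    have hφd : HasFDerivAt φ (e.symm : EuclideanSpace ℝ (Fin 2) →L[ℝ] EuclideanSpace ℝ (Fin 2))
      (γ s) := by
      rw [← hgX s]
      exact hstrict.to_localInverse.hasFDerivAt
    have hγd : HasDerivAt γ (WithLp.toLp 2 n) s := by
      have h := ((hasDerivAt_id s).smul_const
        (WithLp.toLp 2 n : EuclideanSpace ℝ (Fin 2))).const_add (g x₀)
      rwa [one_smul] at h
    have hcomp := hφd.comp_hasDerivAt s hγd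
    have hval : φ (γ s) = X s := by
      rw [← hgX s]
      exact hstrict.localInverse_apply_image
    have hev : X =ᶠ[𝓝 s] φ ∘ γ := by
      have h1 : ∀ᶠ t in 𝓝 s, ∀ i, 0 < P.l i (φ (γ t)) := by
        refine hcomp.continuousAt.eventually (eventually_pos ?_)
        simp only [Function.comp_apply, hval]
        exact hXpos s
      have h2 : ∀ᶠ t in 𝓝 s, g (φ (γ t)) = γ t := by
        refine Tendsto.eventually (p := fun y => g (φ y) = y) hγd.continuousAt ?_
        rw [← hgX s]
        exact hstrict.eventually_right_inverse
      filter_upwards [h1, h2] with t h1 h2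
      exact hginj _ _ (hXpos t) h1 (by rw [hgX, Function.comp_apply, h2])
    refine (hcomp.congr_of_eventuallyEq hev).congr_deriv ?_
    exact hes n

end IsSymplecticPotential

end DelzantPolygon

/-! ### Lower bounds for gradients near the boundary. -/

namespace DelzantPolygon

open CoordMetric Filter Topology

variable {P : DelzantPolygon} {u : EuclideanSpace ℝ (Fin 2) → ℝ}

/-- The coefficients of `l_i`. -/
def nv (P : DelzantPolygon) (i : Fin P.d) : Fin 2 → ℝ := fun k => (P.normal i k : ℝ)

theorem l_eq_dotProduct (i : Fin P.d) (x : EuclideanSpace ℝ (Fin 2)) :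
    P.l i x = P.nv i ⬝ᵥ x.ofLp - P.offset i := rfl

theorem dl_eq_dotProduct (i : Fin P.d) (w : EuclideanSpace ℝ (Fin 2)) :
    P.dl i w = P.nv i ⬝ᵥ w.ofLp := P.dl_apply i w

theorem nv_ne_zero (i : Fin P.d) : P.nv i ≠ 0 := by
  intro h
  refine P.dl_ne_zero i (ContinuousLinearMap.ext fun w => ?_)
  simp [dl_eq_dotProduct, h]

theorem exists_dualVec_le (i j : Fin P.d) : ∃ D : ℝ, 0 ≤ D ∧ ∀ α β : ℝ,
    ‖P.dualVec i j α β‖ ≤ D * (|α| + |β|) := by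
  have e : ∀ α β : ℝ, P.dualVec i j α β =
      α • P.dualVec i j 1 0 + β • P.dualVec i j 0 1 := by
    intro α β
    ext k
    fin_cases k <;> simp [dualVec] <;> ring
  refine ⟨‖P.dualVec i j 1 0‖ + ‖P.dualVec i j 0 1‖, by positivity, fun α β => ?_⟩
  rw [e]
  refine (norm_add_le _ _).trans ?_
  rw [norm_smul, norm_smul, Real.norm_eq_abs, Real.norm_eq_abs]
  have := norm_nonneg (P.dualVec i j 1 0)
  have := norm_nonneg (P.dualVec i j 0 1)
  have := abs_nonneg α
  have := abs_nonneg β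
  nlinarith

namespace IsSymplecticPotential

/-- Cauchy–Schwarz in the Hessian metric between `w` and the gradient. An upper bound on `D2` in one
well-chosen direction `w` thus bounds `gradSq` from below. -/
theorem sq_dotProduct_le (hu : P.IsSymplecticPotential u) {x : EuclideanSpace ℝ (Fin 2)}
    (hx : ∀ i, 0 < P.l i x) (n : Fin 2 → ℝ) (w : EuclideanSpace ℝ (Fin 2)) :
    (n ⬝ᵥ w.ofLp) ^ 2 ≤ gradSq u n x * D2 u x w w := by
  have h := (hu.posDef_hess hx).posSemidef.sq_dotProduct_mulVec_le w.ofLp (gradVec u n x)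
  rw [hu.hess_mulVec_gradVec hx, hu.dotProduct_hess hx, WithLp.toLp_ofLp,
    dotProduct_comm _ n, dotProduct_comm _ n, mul_comm] at h
  exact h

/-- A lower bound for the length of a gradient from a suitable test vector. -/
theorem exists_gradSq_lower (hu : P.IsSymplecticPotential u) {ε D : ℝ} (hε : 0 < ε) :
    ∃ C : ℝ, 0 ≤ C ∧ ∀ (n : Fin 2 → ℝ) (x w : EuclideanSpace ℝ (Fin 2)) (a : Fin P.d → ℝ) (m : ℝ),
      (∀ i, 0 < P.l i x) → 0 < m → n ⬝ᵥ w.ofLp = m → ‖w‖ ≤ D * m → (∑ k, a k = m) →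
      (∀ k, (P.dl k w) ^ 2 = a k * P.l k x ∨ (0 ≤ a k ∧ ε < P.l k x)) →
      2 * m ≤ gradSq u n x * (1 + C * m) := by
  obtain ⟨B, hB, hBu⟩ := hu.exists_D2_le
  set A : ℝ := ∑ k, ‖P.dl k‖ ^ 2 * D ^ 2 / ε with hA
  have hA0 : 0 ≤ A := Finset.sum_nonneg fun k _ => by positivity
  refine ⟨2 * B * D ^ 2 + A, by positivity, ?_⟩
  intro n x w a m hx hm hnw hw ha hk
  have hw2 : ‖w‖ ^ 2 ≤ D ^ 2 * m ^ 2 := by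
    rw [← mul_pow]
    exact pow_le_pow_left₀ (norm_nonneg _) hw 2
  have hterm : ∀ k, (P.dl k w) ^ 2 / P.l k x ≤ a k + ‖P.dl k‖ ^ 2 * D ^ 2 / ε * m ^ 2 := by
    intro k
    rcases hk k with h | ⟨h0, h⟩
    · rw [h, mul_div_assoc, div_self (hx k).ne', mul_one]
      have : 0 ≤ ‖P.dl k‖ ^ 2 * D ^ 2 / ε * m ^ 2 := by positivity
      linarith
    · have h1 : (P.dl k w) ^ 2 ≤ ‖P.dl k‖ ^ 2 * ‖w‖ ^ 2 := by
        rw [← mul_pow, ← sq_abs]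
        exact pow_le_pow_left₀ (abs_nonneg _) ((P.dl k).le_opNorm w) 2
      have h2 : (P.dl k w) ^ 2 ≤ ‖P.dl k‖ ^ 2 * (D ^ 2 * m ^ 2) :=
        h1.trans (by gcongr)
      have h3 : (P.dl k w) ^ 2 / P.l k x ≤ ‖P.dl k‖ ^ 2 * (D ^ 2 * m ^ 2) / ε := by
        gcongr
      have h4 : ‖P.dl k‖ ^ 2 * (D ^ 2 * m ^ 2) / ε = ‖P.dl k‖ ^ 2 * D ^ 2 / ε * m ^ 2 := by ring
      linarith
  have hsum : ∑ k, (1 / 2) * ((P.dl k w) ^ 2 / P.l k x) ≤ (1 / 2) * (m + A * m ^ 2) := by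
    rw [← Finset.mul_sum]
    refine mul_le_mul_of_nonneg_left ?_ (by norm_num)
    calc ∑ k, (P.dl k w) ^ 2 / P.l k x ≤ ∑ k, (a k + ‖P.dl k‖ ^ 2 * D ^ 2 / ε * m ^ 2) :=
          Finset.sum_le_sum fun k _ => hterm k
      _ = m + A * m ^ 2 := by rw [Finset.sum_add_distrib, ha, hA, Finset.sum_mul]
  have hD := hBu x hx w
  have hcs := hu.sq_dotProduct_le hx n w
  rw [hnw] at hcs
  have hf : 0 ≤ gradSq u n x := by
    have h := (hu.posDef_invHess hx).posSemidef.dotProduct_mulVec_nonneg n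
    rwa [star_trivial] at h
  -- The weights `a k` sum to `m`, so the singular terms contribute `m / 2`; everything else is of
  -- order `m²`. This `1/2` is the source of the factor `2` in the conclusion.
  have h1 : D2 u x w w ≤ (1 / 2) * m * (1 + (2 * B * D ^ 2 + A) * m) := by
    have : B * ‖w‖ ^ 2 ≤ B * (D ^ 2 * m ^ 2) := by gcongr
    nlinarith
  have h2 : m * m ≤ m * (gradSq u n x * ((1 / 2) * (1 + (2 * B * D ^ 2 + A) * m))) := by
    have := mul_le_mul_of_nonneg_left h1 hf
    nlinarith
  have h3 := le_of_mul_le_mul_left h2 hm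
  linarith

end IsSymplecticPotential

/-- A scale at which facets close to a point meet in a vertex. -/
def IsScale (P : DelzantPolygon) (ε : ℝ) : Prop := 0 < ε ∧
    (∀ i j, i ≠ j → ∀ x ∈ P.carrier, P.l i x ≤ ε → P.l j x ≤ ε →
      ∃ v ∈ P.carrier, P.l i v = 0 ∧ P.l j v = 0) ∧
    (∀ i j k, i ≠ j → k ≠ i → k ≠ j → ∀ x ∈ P.carrier, P.l i x ≤ ε → P.l j x ≤ ε →
      ε < P.l k x)

namespace IsSymplecticPotential

/-- The test vector is `x - v`: the linear parts of `l_i` and `l_j` take on it the values `l_i x`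
and `l_j x`, so these numbers are the weights, and all other facets are farther than `ε`. -/
theorem exists_gradSq_lower_corner (hu : P.IsSymplecticPotential u) {ε : ℝ} (hε : P.IsScale ε)
    {i j : Fin P.d} (hij : i ≠ j) {v : EuclideanSpace ℝ (Fin 2)} (hv : v ∈ P.carrier)
    (hi : P.l i v = 0) (hj : P.l j v = 0) :
    ∃ C : ℝ, 0 ≤ C ∧ ∀ x, (∀ i, 0 < P.l i x) → P.l i x + P.l j x ≤ ε →
      2 * (P.l i x + P.l j x) ≤ gradSq u (P.nv i + P.nv j) x * (1 + C * (P.l i x + P.l j x)) := by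
  obtain ⟨D, hD, hDw⟩ := exists_dualVec_le i j
  obtain ⟨C, hC, hlow⟩ := hu.exists_gradSq_lower (D := D) hε.1
  refine ⟨C, hC, fun x hx hxε => ?_⟩
  have hdi : P.dl i (x - v) = P.l i x := by rw [dl_sub, hi, sub_zero]
  have hdj : P.dl j (x - v) = P.l j x := by rw [dl_sub, hj, sub_zero]
  have h1 := hx i
  have h2 := hx j
  refine hlow _ x (x - v) (Pi.single i (P.l i x) + Pi.single j (P.l j x)) _ hx (by linarith)
    ?_ ?_ ?_ ?_
  · rw [add_dotProduct, ← dl_eq_dotProduct, ← dl_eq_dotProduct, hdi, hdj]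
  · have h := hDw (P.l i x) (P.l j x)
    rw [abs_of_pos h1, abs_of_pos h2] at h
    rwa [P.eq_dualVec (P.ndet_ne_zero hv hij hi hj) (x - v), hdi, hdj]
  · simp [Finset.sum_add_distrib]
  · intro k
    by_cases hki : k = i
    · subst hki
      left
      rw [hdi]
      simp [Pi.single_eq_of_ne hij]
      ring
    · by_cases hkj : k = j
      · subst hkj
        left
        rw [hdj]
        simp [Pi.single_eq_of_ne hij.symm]
        ring
      · right
        refine ⟨by simp [Pi.single_eq_of_ne hki, Pi.single_eq_of_ne hkj], ?_⟩
        exact hε.2.2 i j k hij hki hkj x (fun k => (hx k).le) (by linarith) (by linarith)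

/-- The test vector must not see the singularity of a second facet close to `x`. At most one such
facet `j` exists, and it meets the facet `i` in a vertex, so the vector can be taken parallel to
`j`; if there is none, any vector transversal to `i` will do. -/
theorem exists_gradSq_lower_facet (hu : P.IsSymplecticPotential u) {ε : ℝ} (hε : P.IsScale ε)
    (i : Fin P.d) :
    ∃ C : ℝ, 0 ≤ C ∧ ∀ x, (∀ i, 0 < P.l i x) → P.l i x ≤ ε →
      2 * P.l i x ≤ gradSq u (P.nv i) x * (1 + C * P.l i x) := by
  choose D hD hDw using fun j => exists_dualVec_le (P := P) i j
  obtain ⟨w₁, hw₁⟩ := P.exists_dl_eq_one i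
  obtain ⟨C, hC, hlow⟩ := hu.exists_gradSq_lower (D := ‖w₁‖ + ∑ j, D j) hε.1
  have hDsum : ∀ j, D j ≤ ∑ j, D j := fun j =>
    Finset.single_le_sum (fun j _ => hD j) (Finset.mem_univ j)
  have hDsum0 : 0 ≤ ∑ j, D j := Finset.sum_nonneg fun j _ => hD j
  refine ⟨C, hC, fun x hx hxε => ?_⟩
  have h1 := hx i
  by_cases hex : ∃ j, i ≠ j ∧ P.l j x ≤ ε
  · obtain ⟨j, hij, hj⟩ := hex
    obtain ⟨v, hv, hvi, hvj⟩ := hε.2.1 i j hij x (fun k => (hx k).le) hxε hj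
    have hdet := P.ndet_ne_zero hv hij hvi hvj
    refine hlow _ x (P.dualVec i j (P.l i x) 0) (Pi.single i (P.l i x)) _ hx h1 ?_ ?_ ?_ ?_
    · rw [← dl_eq_dotProduct, P.dl_dualVec_left hdet]
    · have h := hDw j (P.l i x) 0
      rw [abs_of_pos h1, abs_zero, add_zero] at h
      refine h.trans (mul_le_mul_of_nonneg_right ?_ h1.le)
      have := hDsum j
      have := norm_nonneg w₁
      linarith
    · simp
    · intro k
      by_cases hki : k = i
      · subst hki
        left
        rw [P.dl_dualVec_left hdet]
        simp
        ring
      · by_cases hkj : k = j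
        · subst hkj
          left
          rw [P.dl_dualVec_right hdet]
          simp [Pi.single_eq_of_ne hki]
        · right
          exact ⟨by simp [Pi.single_eq_of_ne hki],
            hε.2.2 i j k hij hki hkj x (fun k => (hx k).le) hxε hj⟩
  · push Not at hex
    refine hlow _ x (P.l i x • w₁) (Pi.single i (P.l i x)) _ hx h1 ?_ ?_ ?_ ?_
    · rw [← dl_eq_dotProduct, map_smul, hw₁, smul_eq_mul, mul_one]
    · rw [norm_smul, Real.norm_of_nonneg h1.le, mul_comm]
      exact mul_le_mul_of_nonneg_right (by linarith) h1.le
    · simp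
    · intro k
      by_cases hki : k = i
      · subst hki
        left
        rw [map_smul, hw₁]
        simp
        ring
      · right
        exact ⟨by simp [Pi.single_eq_of_ne hki], hex k (Ne.symm hki)⟩

/-- The uniform lower bound for the length of the gradient of an affine function at points where
this function is small, under a curvature bound. -/
theorem le_gradSq_of_curvature (hu : P.IsSymplecticPotential u) {K K' ε c C : ℝ}
    (hK : P.CurvatureBoundedBy u K) (hK' : 0 < K') (hKK' : 2 * K ≤ K') {n : Fin 2 → ℝ}
    (hn : n ≠ 0) (hC : 0 ≤ C) (hpos : ∀ x, (∀ i, 0 < P.l i x) → 0 < n ⬝ᵥ x.ofLp - c)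
    (hlow : ∀ x, (∀ i, 0 < P.l i x) → n ⬝ᵥ x.ofLp - c ≤ ε →
      2 * (n ⬝ᵥ x.ofLp - c) ≤ gradSq u n x * (1 + C * (n ⬝ᵥ x.ofLp - c)))
    (hεK : K' * ε ≤ 1 / 2) {x : EuclideanSpace ℝ (Fin 2)} (hx : ∀ i, 0 < P.l i x)
    (hxε : n ⬝ᵥ x.ofLp - c ≤ ε) : n ⬝ᵥ x.ofLp - c ≤ gradSq u n x := by
  obtain ⟨X, hX0, hXpos, hXd, -⟩ := hu.exists_flow hx n
  have hcomp : ∀ s (h : EuclideanSpace ℝ (Fin 2) → ℝ), DifferentiableAt ℝ h (X s) →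
      HasDerivAt (fun s => h (X s)) (∑ c, pd c h (X s) * gradVec u n (X s) c) s := by
    intro s h hh
    have := hh.hasFDerivAt.comp_hasDerivAt s (hXd s)
    rwa [fderiv_toLp] at this
  have hcoord : ∀ s k, HasDerivAt (fun s => X s k) (gradVec u n (X s) k) s := by
    intro s k
    exact (PiLp.proj 2 (fun _ : Fin 2 => ℝ) k : EuclideanSpace ℝ (Fin 2) →L[ℝ] ℝ).hasFDerivAt
      |>.comp_hasDerivAt s (hXd s)
  have hm : ∀ s, HasDerivAt (fun s => n ⬝ᵥ (X s).ofLp - c) (gradSq u n (X s)) s := by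
    intro s
    exact (HasDerivAt.fun_sum fun k _ => (hcoord s k).const_mul (n k)).sub_const c
  have hf : ∀ s, HasDerivAt (fun s => gradSq u n (X s))
      (∑ c, pd c (gradSq u n) (X s) * gradVec u n (X s) c) s := fun s =>
    hcomp s _ ((hu.contDiffAt_gradSq (hXpos s) n).differentiableAt (by simp))
  have hf₁ : ∀ s, HasDerivAt (fun s => ∑ c, pd c (gradSq u n) (X s) * gradVec u n (X s) c)
      ((∑ c, ∑ d, pd d (pd c (gradSq u n)) (X s) * gradVec u n (X s) d * gradVec u n (X s) c) +
        ∑ c, pd c (gradSq u n) (X s) *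
          ∑ d, pd d (fun y => gradVec u n y c) (X s) * gradVec u n (X s) d) s := by
    intro s
    rw [← Finset.sum_add_distrib]
    refine HasDerivAt.fun_sum fun c _ => ?_
    have h1 := hcomp s (pd c (gradSq u n))
      ((contDiffAt_pd (hu.contDiffAt_gradSq (hXpos s) n) c).differentiableAt (by simp))
    have h2 := hcomp s (fun y => gradVec u n y c)
      ((hu.contDiffAt_gradVec (hXpos s) n c).differentiableAt (by simp))
    refine (h1.mul h2).congr_deriv ?_
    rw [Finset.sum_mul]
  -- The function increases along its gradient line, so its smallness at time `0` persists for all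
  -- negative times.
  have hmono : ∀ s ≤ 0, n ⬝ᵥ (X s).ofLp - c ≤ ε := by
    intro s hs
    have h := monotoneOn_Iic_of_hasDerivAt (b := 0) (fun s _ => hm s)
      (fun s _ => (hu.gradSq_pos (hXpos s) hn).le) (mem_Iic.2 hs) (mem_Iic.2 le_rfl) hs
    simp only [hX0] at h
    exact h.trans hxε
  have h := le_deriv_of_log_convex (K := K') (C := C) (fun s _ => hm s) (fun s _ => hf s)
    (fun s _ => hf₁ s) (fun s _ => hpos _ (hXpos s)) (fun s _ => hu.gradSq_pos (hXpos s) hn)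
    (fun s _ => ?_) hK' hC (fun s hs => hlow _ (hXpos s) (hmono s hs)) ?_
  · rwa [hX0] at h
  · have h1 := hu.sq_deriv_gradSq_le (hXpos s) hK hn
    have h2 : 2 * K * gradSq u n (X s) ^ 3 ≤ K' * gradSq u n (X s) ^ 3 := by
      have := (hu.gradSq_pos (hXpos s) hn).le
      gcongr
    linarith
  · rw [hX0]
    exact (mul_le_mul_of_nonneg_left hxε hK'.le).trans hεK

theorem le_gradSq_facet (hu : P.IsSymplecticPotential u) {K K' ε δ : ℝ}
    (hK : P.CurvatureBoundedBy u K) (hK' : 0 < K') (hKK' : 2 * K ≤ K') (hε : P.IsScale ε)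
    (hδε : δ ≤ ε) (hδK : K' * δ ≤ 1 / 2) (i : Fin P.d) {x : EuclideanSpace ℝ (Fin 2)}
    (hx : ∀ i, 0 < P.l i x) (hxδ : P.l i x ≤ δ) : P.l i x ≤ gradSq u (P.nv i) x := by
  obtain ⟨C, hC, hlow⟩ := hu.exists_gradSq_lower_facet hε i
  exact hu.le_gradSq_of_curvature hK hK' hKK' (nv_ne_zero i) hC (c := P.offset i)
    (fun x hx => hx i) (fun x hx h => hlow x hx (h.trans hδε)) hδK hx hxδ

theorem le_gradSq_corner (hu : P.IsSymplecticPotential u) {K K' ε δ : ℝ}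
    (hK : P.CurvatureBoundedBy u K) (hK' : 0 < K') (hKK' : 2 * K ≤ K') (hε : P.IsScale ε)
    (hδε : δ ≤ ε) (hδK : K' * δ ≤ 1 / 2)
    {i j : Fin P.d} (hij : i ≠ j) {v : EuclideanSpace ℝ (Fin 2)} (hv : v ∈ P.carrier)
    (hi : P.l i v = 0) (hj : P.l j v = 0) {x : EuclideanSpace ℝ (Fin 2)}
    (hx : ∀ i, 0 < P.l i x) (hxδ : P.l i x + P.l j x ≤ δ) :
    P.l i x + P.l j x ≤ gradSq u (P.nv i + P.nv j) x := by
  obtain ⟨C, hC, hlow⟩ := hu.exists_gradSq_lower_corner hε hij hv hi hj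
  have e : ∀ x : EuclideanSpace ℝ (Fin 2), (P.nv i + P.nv j) ⬝ᵥ x.ofLp -
      (P.offset i + P.offset j) = P.l i x + P.l j x := by
    intro x
    rw [add_dotProduct, l_eq_dotProduct, l_eq_dotProduct]
    ring
  have hn : P.nv i + P.nv j ≠ 0 := by
    intro h
    have h1 := e x
    have h2 := e v
    rw [h] at h1 h2
    simp only [zero_dotProduct] at h1 h2
    have := hx i
    have := hx j
    linarith
  have := hu.le_gradSq_of_curvature hK hK' hKK' hn hC (c := P.offset i + P.offset j) (ε := δ)
    (fun x hx => by rw [e]; exact add_pos (hx i) (hx j))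
    (fun x hx h => by rw [e] at h ⊢; exact hlow x hx (h.trans hδε)) hδK hx (by rwa [e])
  rwa [e] at this

end IsSymplecticPotential

end DelzantPolygon

namespace DelzantPolygon

open CoordMetric Filter Topology

variable {P : DelzantPolygon} {u : EuclideanSpace ℝ (Fin 2) → ℝ}

/-! ### Bounds from the boundary integral -/

theorem exists_direction (i : Fin P.d) : ∃ τ : EuclideanSpace ℝ (Fin 2), τ ≠ 0 ∧ P.dl i τ = 0 ∧
    ∀ z, P.dl i z = 0 → ∃ t : ℝ, z = t • τ := by
  set a : ℝ := (P.normal i 0 : ℝ)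
  set b : ℝ := (P.normal i 1 : ℝ)
  have hdl : ∀ z, P.dl i z = a * z 0 + b * z 1 := by
    intro z; rw [dl_apply, Fin.sum_univ_two]
  have hab : a ^ 2 + b ^ 2 ≠ 0 := by
    intro h
    have ha : a = 0 := by nlinarith [sq_nonneg a, sq_nonneg b]
    have hb : b = 0 := by nlinarith [sq_nonneg a, sq_nonneg b]
    refine P.dl_ne_zero i (ContinuousLinearMap.ext fun z => ?_)
    rw [hdl, ha, hb]; simp
  refine ⟨!₂[-b, a], fun h => hab ?_, ?_, fun z hz => ⟨(-b * z 0 + a * z 1) / (a ^ 2 + b ^ 2), ?_⟩⟩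
  · have h0 := congrArg (fun z : EuclideanSpace ℝ (Fin 2) => z 0) h
    have h1 := congrArg (fun z : EuclideanSpace ℝ (Fin 2) => z 1) h
    simp only [Matrix.cons_val_zero, Matrix.cons_val_one, PiLp.zero_apply] at h0 h1
    have hb : b = 0 := by linarith
    rw [h1, hb]; ring
  · rw [hdl]; simp; ring
  · rw [hdl] at hz
    ext k
    fin_cases k
    · simp
      field_simp
      linear_combination a * hz
    · simp
      field_simp
      linear_combination b * hz

/-- A facet is bounded and contained in a line, hence in a segment, whose measure is its length. -/
theorem hausdorffMeasure_facet_lt_top (i : Fin P.d) :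
    (μH[1] : Measure (EuclideanSpace ℝ (Fin 2))) (P.facet i) < ⊤ := by
  obtain ⟨τ, hτ, hτi, hτs⟩ := exists_direction i
  obtain ⟨p, hp, hp'⟩ := P.exists_facet i
  have hpP : p ∈ P.carrier := by
    intro j
    by_cases h : j = i
    · subst h; exact hp.ge
    · exact (hp' j h).le
  obtain ⟨R, hR⟩ := P.isCompact_carrier.isBounded.exists_norm_le
  have hτ0 : 0 < ‖τ‖ := norm_pos_iff.2 hτ
  have hR0 : 0 ≤ R := (norm_nonneg _).trans (hR p hpP)
  set T := 2 * R / ‖τ‖ + 1 with hT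
  have hT0 : 0 < T := by positivity
  have hsub : P.facet i ⊆ segment ℝ (p + (-T) • τ) (p + T • τ) := by
    rintro x ⟨hx, hxi⟩
    have hpi : P.l i p = 0 := hp
    obtain ⟨t, ht⟩ := hτs (x - p) (by rw [dl_sub, hxi, hpi, sub_zero])
    have h1 : |t| * ‖τ‖ ≤ 2 * R := by
      rw [← Real.norm_eq_abs, ← norm_smul, ← ht]
      refine (norm_sub_le _ _).trans ?_
      have := hR x hx
      have := hR p hpP
      linarith
    have h2 : |t| ≤ T := by
      rw [← le_div_iff₀ hτ0] at h1
      linarith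
    obtain ⟨h3, h4⟩ := abs_le.1 h2
    refine ⟨(T - t) / (2 * T), (T + t) / (2 * T), div_nonneg (by linarith) (by linarith),
      div_nonneg (by linarith) (by linarith), by field_simp; ring, ?_⟩
    have hx' : x = p + t • τ := by rw [← ht]; abel
    have e : ((T - t) / (2 * T)) • (p + (-T) • τ) + ((T + t) / (2 * T)) • (p + T • τ) =
      ((T - t) / (2 * T) + (T + t) / (2 * T)) • p +
        (T * ((T + t) / (2 * T) - (T - t) / (2 * T))) • τ := by module
    rw [e, hx']
    congr 1
    · rw [show (T - t) / (2 * T) + (T + t) / (2 * T) = 1 by field_simp; ring, one_smul]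
    · congr 1
      field_simp
      ring
  refine (measure_mono hsub).trans_lt ?_
  rw [hausdorffMeasure_segment]
  exact edist_lt_top _ _

instance : IsFiniteMeasure P.boundaryMeasure := by
  refine ⟨?_⟩
  rw [boundaryMeasure, Measure.finsetSum_apply]
  refine ENNReal.sum_lt_top.2 fun i _ => ?_
  rw [Measure.smul_apply, Measure.restrict_apply_univ, smul_eq_mul]
  exact ENNReal.mul_lt_top ENNReal.ofReal_lt_top (hausdorffMeasure_facet_lt_top i)

theorem ae_mem_carrier : ∀ᵐ x ∂P.boundaryMeasure, x ∈ P.carrier := by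
  have hm : MeasurableSet P.carrierᶜ := P.isCompact_carrier.measurableSet.compl
  rw [ae_iff]
  change P.boundaryMeasure P.carrierᶜ = 0
  rw [boundaryMeasure, Measure.finsetSum_apply]
  refine Finset.sum_eq_zero fun i _ => ?_
  rw [Measure.smul_apply, Measure.restrict_apply hm, smul_eq_mul]
  have : P.carrierᶜ ∩ P.facet i = ∅ := by
    ext x
    simp only [mem_inter_iff, mem_compl_iff, mem_empty_iff_false, iff_false, not_and]
    exact fun h1 h2 => h1 h2.1
  rw [this, measure_empty, mul_zero]

theorem le_boundaryMeasure (i : Fin P.d) {S : Set (EuclideanSpace ℝ (Fin 2))}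
    (hS : S ⊆ P.facet i) :
    ENNReal.ofReal (1 / ‖P.normalVec i‖) * μH[1] S ≤ P.boundaryMeasure S := by
  rw [boundaryMeasure, Measure.finsetSum_apply]
  refine le_trans ?_ (Finset.single_le_sum (f := fun i => (ENNReal.ofReal (1 / ‖P.normalVec i‖) •
    (μH[1] : Measure (EuclideanSpace ℝ (Fin 2))).restrict (P.facet i)) S)
    (fun _ _ => zero_le) (Finset.mem_univ i))
  rw [Measure.smul_apply, Measure.restrict_eq_self _ hS, smul_eq_mul]

/-- The nonnegative symplectic potentials with bounded boundary integral. -/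
def admissible (P : DelzantPolygon) (C : ℝ) : Set (EuclideanSpace ℝ (Fin 2) → ℝ) :=
  {u | P.IsSymplecticPotential u ∧ (∀ x ∈ P.carrier, 0 ≤ u x) ∧
    (∫ x, u x ∂P.boundaryMeasure) < C}

theorem IsSymplecticPotential.integrable (hu : P.IsSymplecticPotential u) :
    Integrable u P.boundaryMeasure := by
  have h1 : IntegrableOn u P.carrier P.boundaryMeasure :=
    hu.continuousOn.integrableOn_compact P.isCompact_carrier
  rwa [IntegrableOn, Measure.restrict_eq_self_of_ae_mem ae_mem_carrier] at h1

/-- By convexity `u` is at least `u p` on one of the two halves of a segment of the edge centred at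
`p`. As `u` is nonnegative, `u p` times the measure of this half is at most the whole boundary
integral. -/
theorem exists_bound_facet_point {i : Fin P.d} {p : EuclideanSpace ℝ (Fin 2)}
    (hi : P.l i p = 0) (hp : ∀ j, j ≠ i → 0 < P.l j p) (C : ℝ) :
    ∃ B : ℝ, ∀ u ∈ P.admissible C, u p ≤ B := by
  obtain ⟨τ, hτ, hτi, -⟩ := exists_direction i
  have hev : ∀ᶠ t in 𝓝 (0 : ℝ), ∀ j, j ≠ i → 0 < P.l j (p + t • τ) := by
    rw [eventually_all]; intro j
    by_cases hj : j = i
    · simp [hj]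
    · have hc : Continuous fun t : ℝ => P.l j (p + t • τ) := by fun_prop
      have h0 : 0 < P.l j (p + (0 : ℝ) • τ) := by simpa using hp j hj
      exact (hc.continuousAt.eventually (lt_mem_nhds h0)).mono fun t ht _ => ht
  obtain ⟨r, hr, hball⟩ := Metric.eventually_nhds_iff_ball.1 hev
  have hmem : ∀ t : ℝ, |t| < r → p + t • τ ∈ P.facet i := by
    intro t ht
    have h0 : P.l i (p + t • τ) = 0 := by rw [l_add_smul, hi, hτi]; simp
    refine ⟨fun j => ?_, h0⟩
    by_cases hj : j = i
    · subst hj; exact h0.ge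
    · exact (hball t (by simpa using ht) j hj).le
  have hpP : p ∈ P.carrier := by simpa using (hmem 0 (by simpa using hr)).1
  set s := r / 2 with hs
  have hs0 : 0 < s := by positivity
  have hsr : s < r := by linarith
  have hseg : ∀ σ : ℝ, |σ| = 1 → segment ℝ p (p + (σ * s) • τ) ⊆ P.facet i := by
    intro σ hσ
    rw [segment_eq_image']
    rintro _ ⟨θ, hθ, rfl⟩
    have : p + θ • (p + (σ * s) • τ - p) = p + (θ * (σ * s)) • τ := by module
    simp only [this]
    refine hmem _ ?_
    rw [abs_mul, abs_mul, hσ, one_mul, abs_of_pos hs0, abs_of_nonneg hθ.1]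
    have := mul_le_of_le_one_left hs0.le hθ.2
    linarith
  have hnorm : 0 < ‖P.normalVec i‖ := by
    rw [norm_pos_iff]
    intro h
    exact P.dl_ne_zero i (by rw [dl, h, map_zero])
  have hmeas : ∀ σ : ℝ, |σ| = 1 →
      1 / ‖P.normalVec i‖ * (s * ‖τ‖) ≤ P.boundaryMeasure.real (segment ℝ p (p + (σ * s) • τ)) := by
    intro σ hσ
    have h1 := le_boundaryMeasure i (hseg σ hσ)
    rw [hausdorffMeasure_segment, edist_dist, ← ENNReal.ofReal_mul (by positivity)] at h1
    have h2 : dist p (p + (σ * s) • τ) = s * ‖τ‖ := by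
      rw [dist_eq_norm, sub_add_cancel_left, norm_neg, norm_smul, Real.norm_eq_abs, abs_mul, hσ,
        one_mul, abs_of_pos hs0]
    rw [h2] at h1
    exact (ENNReal.ofReal_le_iff_le_toReal (measure_ne_top _ _)).1 h1
  set c := 1 / ‖P.normalVec i‖ * (s * ‖τ‖) with hc
  have hτ0 : 0 < ‖τ‖ := norm_pos_iff.2 hτ
  have hc0 : 0 < c := by positivity
  refine ⟨C / c, ?_⟩
  rintro u ⟨hu, hnn, hint⟩
  rw [le_div_iff₀ hc0]
  have hhalf : ∃ σ : ℝ, |σ| = 1 ∧ ∀ x ∈ segment ℝ p (p + (σ * s) • τ), u p ≤ u x := by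
    by_contra! hcon
    obtain ⟨x, hx, hxlt⟩ := hcon 1 (by simp)
    obtain ⟨y, hy, hylt⟩ := hcon (-1) (by simp)
    have hxP := (hseg 1 (by simp) hx).1
    have hyP := (hseg (-1) (by simp) hy).1
    rw [segment_eq_image'] at hx hy
    obtain ⟨θ, hθ, rfl⟩ := hx
    obtain ⟨η, hη, rfl⟩ := hy
    have e1 : p + θ • (p + (1 * s) • τ - p) = p + (θ * s) • τ := by module
    have e2 : p + η • (p + (-1 * s) • τ - p) = p - (η * s) • τ := by module
    simp only [e1, e2] at hxlt hylt hxP hyP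
    have := P.le_of_convexOn_of_endpoints hu.convexOn (mul_nonneg hη.1 hs0.le)
      (mul_nonneg hθ.1 hs0.le) hyP hxP (le_max_left _ _) (le_max_right _ _)
    exact absurd this (not_le.2 (max_lt hylt hxlt))
  obtain ⟨σ, hσ, hge⟩ := hhalf
  set S := segment ℝ p (p + (σ * s) • τ) with hS
  have hSm : MeasurableSet S := by
    have : IsCompact S := by
      rw [hS, segment_eq_image']
      exact isCompact_Icc.image (by fun_prop)
    exact this.measurableSet
  have h1 : ∫ x in S, u p ∂P.boundaryMeasure ≤ ∫ x in S, u x ∂P.boundaryMeasure :=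
    setIntegral_mono_on (integrableOn_const (measure_ne_top _ _)) hu.integrable.integrableOn hSm hge
  have h2 : ∫ x in S, u x ∂P.boundaryMeasure ≤ ∫ x, u x ∂P.boundaryMeasure :=
    setIntegral_le_integral hu.integrable (ae_mem_carrier.mono fun x hx => hnn x hx)
  rw [setIntegral_const, smul_eq_mul] at h1
  have h3 : u p * c ≤ P.boundaryMeasure.real S * u p := by
    rw [mul_comm]
    exact mul_le_mul_of_nonneg_right (hmeas σ hσ) (hnn p hpP)
  linarith

/-- A line through `q` avoiding the vertices leaves `P` at two points inside edges, where `u` is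
already bounded, and `u` is convex on it. -/
theorem exists_bound_interior_point {q : EuclideanSpace ℝ (Fin 2)} (hq : ∀ i, 0 < P.l i q)
    (C : ℝ) : ∃ B : ℝ, ∀ u ∈ P.admissible C, u q ≤ B := by
  obtain ⟨w, hw, hgen⟩ := P.exists_generic_direction hq
  have hqP : q ∈ P.carrier := fun i => (hq i).le
  obtain ⟨T, hT, hTP, i, hi, -⟩ := P.exists_exit hqP hw
  obtain ⟨S, hS, hSP, j, hj, -⟩ := P.exists_exit hqP (neg_ne_zero.2 hw)
  have e : q + S • -w = q + (-S) • w := by rw [smul_neg, neg_smul]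
  rw [e] at hSP hj
  obtain ⟨B₁, hB₁⟩ := exists_bound_facet_point hi (fun k hk => (hTP k).lt_of_ne'
    fun h => hk (hgen T hTP k i h hi)) C
  obtain ⟨B₂, hB₂⟩ := exists_bound_facet_point hj (fun k hk => (hSP k).lt_of_ne'
    fun h => hk (hgen (-S) hSP k j h hj)) C
  have e' : q + (-S) • w = q - S • w := by rw [neg_smul, sub_eq_add_neg]
  rw [e'] at hSP hB₂
  refine ⟨max B₂ B₁, fun u hu => ?_⟩
  exact P.le_of_convexOn_of_endpoints hu.1.convexOn hS hT hSP hTP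
    ((hB₂ u hu).trans (le_max_left _ _)) ((hB₁ u hu).trans (le_max_right _ _))

/-- The pointwise bounds become locally uniform because the supremum of the whole family is a finite
convex function on an open set, hence continuous. -/
theorem exists_bound_compact {K : Set (EuclideanSpace ℝ (Fin 2))} (hK : IsCompact K)
    (hKP : K ⊆ interior P.carrier) (C : ℝ) : ∃ B : ℝ, ∀ u ∈ P.admissible C, ∀ x ∈ K, u x ≤ B := by
  set U : EuclideanSpace ℝ (Fin 2) → ℝ := fun x => ⨆ u : P.admissible C, u.1 x with hU
  rcases isEmpty_or_nonempty (P.admissible C) with hemp | hne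
  · exact ⟨0, fun u hu => (hemp.false ⟨u, hu⟩).elim⟩
  have hbdd : ∀ x ∈ interior P.carrier, BddAbove (range fun u : P.admissible C => u.1 x) := by
    intro x hx
    obtain ⟨B, hB⟩ := exists_bound_interior_point (P.mem_interior.1 hx) C
    exact ⟨B, by rintro _ ⟨u, rfl⟩; exact hB u.1 u.2⟩
  have hconv : ConvexOn ℝ (interior P.carrier) U := by
    refine ⟨P.convex_carrier.interior, fun x hx y hy a b ha hb hab => ciSup_le fun u => ?_⟩
    refine (u.2.1.convexOn.2 (interior_subset hx) (interior_subset hy) ha hb hab).trans ?_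
    simp only [smul_eq_mul]
    have := le_ciSup (hbdd x hx) u
    have := le_ciSup (hbdd y hy) u
    gcongr
  have hcont : ContinuousOn U K := (hconv.continuousOn isOpen_interior).mono hKP
  obtain ⟨B, hB⟩ := hK.exists_bound_of_continuousOn hcont
  exact ⟨B, fun u hu x hx => (le_ciSup (hbdd x (hKP hx)) ⟨u, hu⟩).trans
    ((le_abs_self _).trans (hB x hx))⟩

namespace IsSymplecticPotential

theorem add_fderiv_le (hu : P.IsSymplecticPotential u) {x y : EuclideanSpace ℝ (Fin 2)}
    (hx : ∀ i, 0 < P.l i x) (hy : y ∈ P.carrier) : u x + fderiv ℝ u x (y - x) ≤ u y := by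
  have h0 : ∀ i, 0 < P.l i (x + (0 : ℝ) • (y - x)) := by simpa using hx
  have h1 := (hu.hasDerivAt_line h0).tendsto_slope_zero_right
  simp only [zero_smul, add_zero, zero_add] at h1
  have h2 : fderiv ℝ u x (y - x) ≤ u y - u x := by
    refine le_of_tendsto h1 ?_
    filter_upwards [Ioc_mem_nhdsGT (zero_lt_one (α := ℝ))] with t ht
    have h3 := hu.convexOn.2 (fun i => (hx i).le : x ∈ P.carrier) hy (sub_nonneg.2 ht.2) ht.1.le
      (by ring)
    have e : (1 - t) • x + t • y = x + t • (y - x) := by module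
    rw [e] at h3
    simp only [smul_eq_mul] at h3 ⊢
    rw [inv_mul_le_iff₀ ht.1]
    linarith
  linarith

theorem nonneg_of_isNormalizedAt (hu : P.IsSymplecticPotential u) {x₀ : EuclideanSpace ℝ (Fin 2)}
    (h : P.IsNormalizedAt u x₀) {x : EuclideanSpace ℝ (Fin 2)} (hx : x ∈ P.carrier) : 0 ≤ u x := by
  have := hu.add_fderiv_le (P.mem_interior.1 h.1) hx
  rw [h.2.1, h.2.2] at this
  simpa using this

end IsSymplecticPotential

theorem exists_bound_fderiv_compact {K : Set (EuclideanSpace ℝ (Fin 2))} (hK : IsCompact K)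
    (hKP : K ⊆ interior P.carrier) (C : ℝ) : ∃ B : ℝ, 0 ≤ B ∧ ∀ u ∈ P.admissible C, ∀ x ∈ K,
      u x ≤ B ∧ ‖fderiv ℝ u x‖ ≤ B := by
  obtain ⟨δ, hδ, hsub⟩ := hK.exists_cthickening_subset_open isOpen_interior hKP
  obtain ⟨B, hB⟩ := exists_bound_compact hK.cthickening hsub C
  refine ⟨max (|B|) (|B| / δ), by positivity, fun u hu x hx => ⟨?_, ?_⟩⟩
  · exact ((hB u hu x (Metric.self_subset_cthickening _ hx)).trans (le_abs_self B)).trans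
      (le_max_left _ _)
  refine le_trans ?_ (le_max_right _ _)
  have hxP : ∀ i, 0 < P.l i x := P.mem_interior.1 (hKP hx)
  -- The graph of `u` lies above its tangent at `x`, and `u x ≥ 0`, so the slope is bounded by the
  -- values of `u` on a slightly larger compact set.
  have key : ∀ w : EuclideanSpace ℝ (Fin 2), ‖w‖ ≤ δ → fderiv ℝ u x w ≤ |B| := by
    intro w hw
    have hmem : x + w ∈ Metric.cthickening δ K := by
      refine Metric.mem_cthickening_of_dist_le _ x _ _ hx ?_
      simpa [dist_eq_norm] using hw
    have h1 := hu.1.add_fderiv_le hxP (interior_subset (hsub hmem))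
    rw [add_sub_cancel_left] at h1
    have h2 := hu.2.1 x (interior_subset (hKP hx))
    have h3 := hB u hu _ hmem
    have := le_abs_self B
    linarith
  refine ContinuousLinearMap.opNorm_le_bound _ (by positivity) fun w => ?_
  rcases eq_or_ne w 0 with rfl | hw
  · simp
  have hw0 : 0 < ‖w‖ := norm_pos_iff.2 hw
  have hn : ‖(δ / ‖w‖) • w‖ ≤ δ := by
    rw [norm_smul, Real.norm_of_nonneg (by positivity)]
    exact (div_mul_cancel₀ _ hw0.ne').le
  have h1 := key _ hn
  have h2 := key (-((δ / ‖w‖) • w)) (by rwa [norm_neg])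
  rw [map_neg, map_smul, smul_eq_mul] at h2
  rw [map_smul, smul_eq_mul] at h1
  have e : |B| / δ * ‖w‖ = |B| / (δ / ‖w‖) := by field_simp
  have hpos : 0 < δ / ‖w‖ := by positivity
  rw [e, le_div_iff₀ hpos, Real.norm_eq_abs]
  have h3 : |fderiv ℝ u x w| * (δ / ‖w‖) = |δ / ‖w‖ * fderiv ℝ u x w| := by
    rw [abs_mul, abs_of_pos hpos, mul_comm]
  rw [h3, abs_le]
  constructor <;> linarith

end DelzantPolygon

/-! ### The bound for the maximum. -/

namespace DelzantPolygon

open CoordMetric Filter Topology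

variable {P : DelzantPolygon} {u : EuclideanSpace ℝ (Fin 2) → ℝ}

/-- A scale, depending on the curvature bound, below which the gradients of the functions defining
the facets and of their sums at the vertices are uniformly bounded below. -/
structure IsCurvatureScale (P : DelzantPolygon) (K δ : ℝ) : Prop where
  pos : 0 < δ
  corner : ∀ i j, i ≠ j → ∀ x ∈ P.carrier, P.l i x ≤ δ → P.l j x ≤ δ →
      ∃ v ∈ P.carrier, P.l i v = 0 ∧ P.l j v = 0
  le_gradSq_facet : ∀ u, P.IsSymplecticPotential u → P.CurvatureBoundedBy u K →
    ∀ i x, (∀ i, 0 < P.l i x) → P.l i x ≤ δ → P.l i x ≤ gradSq u (P.nv i) x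
  le_gradSq_corner : ∀ u, P.IsSymplecticPotential u → P.CurvatureBoundedBy u K →
    ∀ i j, i ≠ j → ∀ v ∈ P.carrier, P.l i v = 0 → P.l j v = 0 →
    ∀ x, (∀ i, 0 < P.l i x) → P.l i x + P.l j x ≤ δ →
      P.l i x + P.l j x ≤ gradSq u (P.nv i + P.nv j) x

/-- The comparison needs a positive constant `K' ≥ 2 K` and `K' δ ≤ 1/2`; the geometry of `P` needs
`δ ≤ ε`. None of this involves `u`. -/
theorem exists_curvatureScale (P : DelzantPolygon) (K : ℝ) : ∃ δ, P.IsCurvatureScale K δ := by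
  obtain ⟨ε, hε⟩ := P.exists_scale
  have hε' : P.IsScale ε := hε
  set K' := max (2 * K) 1
  have hK' : 0 < K' := lt_max_of_lt_right one_pos
  have hKK' : 2 * K ≤ K' := le_max_left _ _
  set δ := min ε (1 / (2 * K'))
  have hδε : δ ≤ ε := min_le_left _ _
  have hδK : K' * δ ≤ 1 / 2 := by
    have : δ ≤ 1 / (2 * K') := min_le_right _ _
    calc K' * δ ≤ K' * (1 / (2 * K')) := by gcongr
      _ = 1 / 2 := by field_simp
  refine ⟨δ, lt_min hε.1 (by positivity), ?_, ?_, ?_⟩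
  · exact fun i j hij x hx h1 h2 => hε.2.1 i j hij x hx (h1.trans hδε) (h2.trans hδε)
  · exact fun u hu hK i x hx h => hu.le_gradSq_facet hK hK' hKK' hε' hδε hδK i hx h
  · exact fun u hu hK i j hij v hv hi hj x hx h =>
      hu.le_gradSq_corner hK hK' hKK' hε' hδε hδK hij hv hi hj hx h

theorem hasDerivAt_dotProduct {X : ℝ → EuclideanSpace ℝ (Fin 2)} {w : Fin 2 → ℝ} {s : ℝ}
    (h : HasDerivAt X (WithLp.toLp 2 w) s) (n : Fin 2 → ℝ) :
    HasDerivAt (fun s => n ⬝ᵥ (X s).ofLp) (n ⬝ᵥ w) s := by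
  have hcoord : ∀ k, HasDerivAt (fun s => X s k) (w k) s := fun k =>
    (PiLp.proj 2 (fun _ : Fin 2 => ℝ) k : EuclideanSpace ℝ (Fin 2) →L[ℝ] ℝ).hasFDerivAt
      |>.comp_hasDerivAt s h
  exact HasDerivAt.fun_sum fun k _ => (hcoord k).const_mul (n k)

theorem hasDerivAt_l_comp {X : ℝ → EuclideanSpace ℝ (Fin 2)} {w : Fin 2 → ℝ} {s : ℝ}
    (h : HasDerivAt X (WithLp.toLp 2 w) s) (i : Fin P.d) :
    HasDerivAt (fun s => P.l i (X s)) (P.nv i ⬝ᵥ w) s :=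
  (hasDerivAt_dotProduct h (P.nv i)).sub_const _

/-- Near a vertex the distance to it is controlled by the two functions vanishing there. -/
theorem exists_norm_sub_vertex_le {i j : Fin P.d} (hij : i ≠ j) {v : EuclideanSpace ℝ (Fin 2)}
    (hv : v ∈ P.carrier) (hi : P.l i v = 0) (hj : P.l j v = 0) :
    ∃ D : ℝ, 0 ≤ D ∧ ∀ x ∈ P.carrier, ‖x - v‖ ≤ D * (P.l i x + P.l j x) := by
  obtain ⟨D, hD, hDw⟩ := exists_dualVec_le i j
  refine ⟨D, hD, fun x hx => ?_⟩
  have h := hDw (P.l i x) (P.l j x)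
  rw [abs_of_nonneg (hx i), abs_of_nonneg (hx j)] at h
  rwa [P.eq_dualVec (P.ndet_ne_zero hv hij hi hj) (x - v), dl_sub, dl_sub, hi, hj, sub_zero,
    sub_zero]

/-- The gradient line of `l_i + l_j` through a point `x` close to a vertex, for negative times. -/
theorem IsSymplecticPotential.exists_flow_corner (hu : P.IsSymplecticPotential u) {K δ : ℝ}
    (hK : P.CurvatureBoundedBy u K) (hδ : P.IsCurvatureScale K δ) {i j : Fin P.d} (hij : i ≠ j)
    {v : EuclideanSpace ℝ (Fin 2)} (hv : v ∈ P.carrier) (hi : P.l i v = 0) (hj : P.l j v = 0)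
    {x : EuclideanSpace ℝ (Fin 2)} (hx : ∀ i, 0 < P.l i x) (hxδ : P.l i x + P.l j x ≤ δ) :
    ∃ X : ℝ → EuclideanSpace ℝ (Fin 2), X 0 = x ∧ (∀ s i, 0 < P.l i (X s)) ∧
      (∀ s, HasDerivAt X (WithLp.toLp 2 (gradVec u (P.nv i + P.nv j) (X s))) s) ∧
      (∀ s k, pd k u (X s) = pd k u x + s * (P.nv i + P.nv j) k) ∧
      (∀ s, HasDerivAt (fun s => P.l i (X s) + P.l j (X s))
        (gradSq u (P.nv i + P.nv j) (X s)) s) ∧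
      (∀ s ≤ 0, P.l i (X s) + P.l j (X s) ≤ gradSq u (P.nv i + P.nv j) (X s)) ∧
      (∀ b ≤ 0, ∀ c > 0, ∃ s ≤ b, P.l i (X s) + P.l j (X s) < c) := by
  obtain ⟨X, hX0, hXpos, hXd, hpd⟩ := hu.exists_flow hx (P.nv i + P.nv j)
  have hm : ∀ s, HasDerivAt (fun s => P.l i (X s) + P.l j (X s))
        (gradSq u (P.nv i + P.nv j) (X s)) s := by
    intro s
    refine ((hasDerivAt_l_comp (hXd s) i).add (hasDerivAt_l_comp (hXd s) j)).congr_deriv ?_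
    rw [gradSq, add_dotProduct]
  have hnn : ∀ s, 0 ≤ gradSq u (P.nv i + P.nv j) (X s) := by
    intro s
    have h := (hu.posDef_invHess (hXpos s)).posSemidef.dotProduct_mulVec_nonneg (P.nv i + P.nv j)
    rwa [star_trivial] at h
  have hle : ∀ s ≤ 0, P.l i (X s) + P.l j (X s) ≤ gradSq u (P.nv i + P.nv j) (X s) := by
    intro s hs
    have h := monotoneOn_Iic_of_hasDerivAt (b := 0) (fun s _ => hm s)
      (fun s _ => hnn s) (mem_Iic.2 hs) (mem_Iic.2 le_rfl) hs
    simp only [hX0] at h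
    exact hδ.le_gradSq_corner u hu hK i j hij v hv hi hj _ (hXpos s) (h.trans hxδ)
  refine ⟨X, hX0, hXpos, hXd, hpd, hm, hle, fun b hb c hc => ?_⟩
  obtain ⟨s, hs, hlt⟩ := exists_deriv_lt (fun s _ => hm s)
    (fun s (_ : s ≤ b) => add_pos (hXpos s i) (hXpos s j)) hc
  exact ⟨s, hs, (hle s (hs.trans hb)).trans_lt hlt⟩

/-- Convexity bounds `u` from below by its tangent plane; this is a bound from above at the vertex,
with error `l_i + l_j` at `x`. It is obtained by following the gradient line of `l_i + l_j` back
from `x` to the vertex. -/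
theorem IsSymplecticPotential.le_vertex (hu : P.IsSymplecticPotential u) {K δ : ℝ}
    (hK : P.CurvatureBoundedBy u K) (hδ : P.IsCurvatureScale K δ) {i j : Fin P.d} (hij : i ≠ j)
    {v : EuclideanSpace ℝ (Fin 2)} (hv : v ∈ P.carrier) (hi : P.l i v = 0) (hj : P.l j v = 0)
    {x : EuclideanSpace ℝ (Fin 2)} (hx : ∀ i, 0 < P.l i x) (hxδ : P.l i x + P.l j x ≤ δ) :
    u v ≤ u x + fderiv ℝ u x (v - x) + (P.l i x + P.l j x) := by
  obtain ⟨X, hX0, hXpos, hXd, hpd, hm, hle, hsmall⟩ :=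
    hu.exists_flow_corner hK hδ hij hv hi hj hx hxδ
  set n := P.nv i + P.nv j with hn
  set m : ℝ → ℝ := fun s => P.l i (X s) + P.l j (X s) with hmdef
  -- Along the line `Du(X s) = Du(x) + s n`, so `u - Du(x)` has derivative `s m'`. Subtracting `s m`
  -- leaves `-m`, and adding `m` gives `m' - m ≥ 0`. For `s ≤ 0` both `-s m` and `m` are nonnegative
  -- and may be dropped on the left.
  have hA : ∀ s ≤ 0, HasDerivAt (fun s => u (X s) - fderiv ℝ u x (X s) - s * m s + m s)
      (gradSq u n (X s) - m s) s := by
    intro s hs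
    have h1 := (hu.differentiableAt (hXpos s)).hasFDerivAt.comp_hasDerivAt s (hXd s)
    have h2 := (fderiv ℝ u x).hasFDerivAt.comp_hasDerivAt s (hXd s)
    have h3 := (hasDerivAt_id s).mul (hm s)
    refine (((h1.sub h2).sub h3).add (hm s)).congr_deriv ?_
    rw [fderiv_toLp, fderiv_toLp]
    simp only [hpd, gradSq, dotProduct, Fin.sum_univ_two, id, hmdef]
    ring
  have hmono := monotoneOn_Iic_of_hasDerivAt hA fun s hs => sub_nonneg.2 (hle s hs)
  have hbound : ∀ s ≤ 0, u (X s) ≤ u x + fderiv ℝ u x (X s - x) + (P.l i x + P.l j x) := by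
    intro s hs
    have h1 := hmono (mem_Iic.2 hs) (mem_Iic.2 le_rfl) hs
    have h2 : 0 < m s := add_pos (hXpos s i) (hXpos s j)
    have h3 : s * m s ≤ 0 := mul_nonpos_of_nonpos_of_nonneg hs h2.le
    simp only [hX0, zero_mul, sub_zero] at h1
    have h4 : m 0 = P.l i x + P.l j x := by simp only [hmdef, hX0]
    rw [map_sub]
    linarith
  obtain ⟨D, hD, hDv⟩ := exists_norm_sub_vertex_le hij hv hi hj
  choose s hs0 hs using fun k : ℕ => hsmall 0 le_rfl (1 / ((k : ℝ) + 1)) (by positivity)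
  have hlim : Tendsto (fun k => X (s k)) atTop (𝓝 v) := by
    rw [tendsto_iff_norm_sub_tendsto_zero]
    have h0 : Tendsto (fun k : ℕ => D * (1 / ((k : ℝ) + 1))) atTop (𝓝 0) := by
      simpa using tendsto_one_div_add_atTop_nhds_zero_nat.const_mul D
    refine squeeze_zero (fun _ => norm_nonneg _) (fun k => ?_) h0
    exact (hDv _ fun i => (hXpos (s k) i).le).trans (mul_le_mul_of_nonneg_left (hs k).le hD)
  have hlim' : Tendsto (fun k => u (X (s k))) atTop (𝓝 (u v)) :=
    (hu.continuousOn v hv).tendsto.comp (tendsto_nhdsWithin_iff.2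
      ⟨hlim, Eventually.of_forall fun k i => (hXpos (s k) i).le⟩)
  have hlim'' : Tendsto (fun k => u x + fderiv ℝ u x (X (s k) - x) + (P.l i x + P.l j x)) atTop
      (𝓝 (u x + fderiv ℝ u x (v - x) + (P.l i x + P.l j x))) :=
    ((((fderiv ℝ u x).continuous.tendsto _).comp (hlim.sub_const x)).const_add _).add_const _
  exact le_of_tendsto_of_tendsto' hlim' hlim'' fun k => hbound _ (hs0 k)

/-- Interior points close to a vertex. -/
theorem exists_near_vertex {i j : Fin P.d} {v : EuclideanSpace ℝ (Fin 2)} (hv : v ∈ P.carrier)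
    (hi : P.l i v = 0) (hj : P.l j v = 0) {δ : ℝ} (hδ : 0 < δ) :
    ∃ q, (∀ i, 0 < P.l i q) ∧ P.l i q + P.l j q ≤ δ := by
  obtain ⟨c, hc⟩ := P.exists_pos
  have hs : 0 < P.l i c + P.l j c := add_pos (hc i) (hc j)
  set t := min 1 (δ / (P.l i c + P.l j c)) with ht
  have ht0 : 0 < t := lt_min one_pos (by positivity)
  refine ⟨v + t • (c - v), pos_segment hc hv ht0 (min_le_left _ _), ?_⟩
  rw [l_add_smul, l_add_smul, dl_sub, dl_sub, hi, hj]
  have h1 : t * (P.l i c + P.l j c) ≤ δ := by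
    rw [← le_div_iff₀ hs]; exact min_le_right _ _
  linarith

theorem exists_bound_max (P : DelzantPolygon) (K C : ℝ) : ∃ B : ℝ, ∀ u ∈ P.admissible C,
    P.CurvatureBoundedBy u K → ∀ x ∈ P.carrier, u x ≤ B := by
  obtain ⟨δ, hδ⟩ := P.exists_curvatureScale K
  have hv : ∀ i j : Fin P.d, ∃ B : ℝ, ∀ u ∈ P.admissible C, P.CurvatureBoundedBy u K → i ≠ j →
      ∀ v ∈ P.carrier, P.l i v = 0 → P.l j v = 0 → u v ≤ B := by
    intro i j
    by_cases hex : i ≠ j ∧ ∃ v ∈ P.carrier, P.l i v = 0 ∧ P.l j v = 0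
    · obtain ⟨hij, v, hv, hi, hj⟩ := hex
      -- The point `q` is chosen before `u`, so the bounds for `u` and `Du` at `q` are uniform over
      -- the family.
      obtain ⟨q, hq, hqδ⟩ := exists_near_vertex hv hi hj hδ.pos
      obtain ⟨B, hB, hBu⟩ := exists_bound_fderiv_compact (K := {q}) isCompact_singleton
        (by simpa using P.mem_interior.2 hq) C
      refine ⟨B + B * ‖v - q‖ + δ, fun u hu hK _ v' hv' hi' hj' => ?_⟩
      obtain rfl : v' = v := P.eq_of_l_eq (P.ndet_ne_zero hv hij hi hj) (hi'.trans hi.symm)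
        (hj'.trans hj.symm)
      have h1 := hu.1.le_vertex hK hδ hij hv hi hj hq hqδ
      obtain ⟨h2, h3⟩ := hBu u hu q rfl
      have h4 : fderiv ℝ u q (v' - q) ≤ B * ‖v' - q‖ := (le_abs_self _).trans
        (((fderiv ℝ u q).le_opNorm _).trans (by gcongr))
      linarith
    · exact ⟨0, fun u _ _ hij v hv hi hj => absurd ⟨hij, v, hv, hi, hj⟩ hex⟩
  choose B hB using hv
  refine ⟨∑ i, ∑ j, |B i j|, fun u hu hK x hx => ?_⟩
  refine P.le_of_convexOn_of_vertices hu.1.convexOn (fun i j hij v hv hi hj => ?_) hx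
  refine ((hB i j u hu hK hij v hv hi hj).trans (le_abs_self _)).trans ?_
  refine le_trans ?_ (Finset.single_le_sum (f := fun i => ∑ j, |B i j|)
    (fun _ _ => Finset.sum_nonneg fun _ _ => abs_nonneg _) (Finset.mem_univ i))
  exact Finset.single_le_sum (f := fun j => |B i j|) (fun _ _ => abs_nonneg _) (Finset.mem_univ j)

end DelzantPolygon

namespace DelzantPolygon

open CoordMetric Filter Topology

variable {P : DelzantPolygon} {u : EuclideanSpace ℝ (Fin 2) → ℝ}

/-! ### Curves on the toric surface with constant angle -/

theorem cornerMatrix_mulVec (a : Fin 2 → Fin P.d) (w : EuclideanSpace ℝ (Fin 2)) :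
    P.cornerMatrix a *ᵥ w.ofLp = fun k => P.dl (a k) w := by
  ext k
  rw [dl_eq_dotProduct]
  rfl

theorem IsCorner.ndet_ne_zero {a : Fin 2 → Fin P.d} (ha : P.IsCorner a) :
    P.ndet (a 0) (a 1) ≠ 0 := by
  obtain ⟨h, v, hv, h0, h1⟩ := ha
  exact P.ndet_ne_zero hv h h0 h1

theorem IsCorner.cornerMatrix_inv_mul {a : Fin 2 → Fin P.d} (ha : P.IsCorner a) :
    (P.cornerMatrix a)⁻¹ * P.cornerMatrix a = 1 := by
  refine Matrix.nonsing_inv_mul _ (IsUnit.mk0 _ ?_)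
  rw [Matrix.det_fin_two]
  exact ha.ndet_ne_zero

theorem IsCorner.cornerMatrix_inv_mulVec {a : Fin 2 → Fin P.d} (ha : P.IsCorner a)
    (w : EuclideanSpace ℝ (Fin 2)) : (P.cornerMatrix a)⁻¹ *ᵥ (fun k => P.dl (a k) w) = w.ofLp := by
  rw [← cornerMatrix_mulVec, Matrix.mulVec_mulVec, ha.cornerMatrix_inv_mul, Matrix.one_mulVec]

theorem IsCorner.chartMoment_eq {a : Fin 2 → Fin P.d} (ha : P.IsCorner a) {z : Fin 2 → ℂ}
    {x : EuclideanSpace ℝ (Fin 2)} (h : ∀ k, P.l (a k) x = ‖z k‖ ^ 2 / 2) :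
    P.chartMoment a z = x := by
  have e : (fun k => ‖z k‖ ^ 2 / 2 + P.offset (a k)) = fun k => P.dl (a k) x := by
    ext k
    rw [← h, P.l_eq]; ring
  rw [chartMoment, e, ha.cornerMatrix_inv_mulVec]

theorem IsCorner.exists_angles {a : Fin 2 → Fin P.d} (ha : P.IsCorner a)
    (θ : EuclideanSpace ℝ (Fin 2)) : ∃ φ : Fin 2 → ℝ, θ = ∑ k, φ k • P.normalVec (a k) := by
  refine ⟨((P.cornerMatrix a)⁻¹)ᵀ *ᵥ θ.ofLp, ?_⟩
  have h : (P.cornerMatrix a)ᵀ *ᵥ (((P.cornerMatrix a)⁻¹)ᵀ *ᵥ θ.ofLp) = θ.ofLp := by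
    rw [Matrix.mulVec_mulVec, ← Matrix.transpose_mul, ha.cornerMatrix_inv_mul,
      Matrix.transpose_one, Matrix.one_mulVec]
  generalize ((P.cornerMatrix a)⁻¹)ᵀ *ᵥ θ.ofLp = φ at h ⊢
  ext m
  refine (congrFun h m).symm.trans ?_
  simp only [Matrix.mulVec, dotProduct, Matrix.transpose_apply, cornerMatrix, Matrix.of_apply,
    Fin.sum_univ_two, PiLp.add_apply, PiLp.smul_apply, smul_eq_mul, normalVec]
  ring

theorem two_pi_smul_normalVec_mem (x : EuclideanSpace ℝ (Fin 2)) (i : Fin P.d) (m : ℤ) :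
    ((m : ℝ) * (2 * Real.pi)) • P.normalVec i ∈ P.stab x := by
  have hgen : ∀ k : Fin 2, EuclideanSpace.single k (2 * Real.pi) ∈ P.stab x := fun k =>
    AddSubgroup.mem_sup_left (AddSubgroup.subset_closure ⟨k, rfl⟩)
  have e : ((m : ℝ) * (2 * Real.pi)) • P.normalVec i =
      ∑ k : Fin 2, (m * P.normal i k) • EuclideanSpace.single k (2 * Real.pi) := by
    ext j
    fin_cases j <;> simp [Fin.sum_univ_two, normalVec] <;> ring
  rw [e]
  exact sum_mem fun k _ => (P.stab x).zsmul_mem (hgen k) _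

theorem smul_normalVec_mem {x : EuclideanSpace ℝ (Fin 2)} {i : Fin P.d} (h : P.l i x = 0) (t : ℝ) :
    t • P.normalVec i ∈ P.stab x :=
  AddSubgroup.mem_sup_right (Submodule.smul_mem _ t (Submodule.subset_span ⟨i, h, rfl⟩))

theorem mkPoint_eq {x : P.carrier} {θ θ' : EuclideanSpace ℝ (Fin 2)} (h : θ - θ' ∈ P.stab x) :
    P.mkPoint x θ = P.mkPoint x θ' :=
  Quotient.sound (show P.surfaceSetoid.r (x, θ) (x, θ') from ⟨rfl, h⟩)

/-- Over a vertex there is a single point of the toric surface. -/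
theorem mkPoint_vertex_eq {a : Fin 2 → Fin P.d} (ha : P.IsCorner a) {v : P.carrier}
    (h : ∀ k, P.l (a k) v = 0) (θ θ' : EuclideanSpace ℝ (Fin 2)) :
    P.mkPoint v θ = P.mkPoint v θ' := by
  obtain ⟨φ, hφ⟩ := ha.exists_angles (θ - θ')
  refine mkPoint_eq ?_
  rw [hφ]
  exact sum_mem fun k _ => smul_normalVec_mem (h k) _

/-- If `r k > 0`, then `arg` recovers `φ k` up to a multiple of `2π`, which disappears because the
normals are integral. If `r k = 0`, the point lies on the facet and the whole direction of its
normal is collapsed. -/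
theorem chartPoint_eq_mkPoint {a : Fin 2 → Fin P.d} (ha : P.IsCorner a) {r φ : Fin 2 → ℝ}
    (hr : ∀ k, 0 ≤ r k) {x : P.carrier} (hx : ∀ k, P.l (a k) x = r k ^ 2 / 2)
    (hz : (fun k => (r k : ℂ) * Complex.exp (φ k * Complex.I)) ∈ P.chartDomain a) :
    P.chartPoint a (fun k => (r k : ℂ) * Complex.exp (φ k * Complex.I)) hz =
      P.mkPoint x (∑ k, φ k • P.normalVec (a k)) := by
  have hnorm : ∀ k, ‖(r k : ℂ) * Complex.exp (φ k * Complex.I)‖ = r k := by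
    intro k
    rw [norm_mul, Complex.norm_exp_ofReal_mul_I, mul_one, Complex.norm_real,
      Real.norm_of_nonneg (hr k)]
  have hm : P.chartMoment a (fun k => (r k : ℂ) * Complex.exp (φ k * Complex.I)) = x :=
    ha.chartMoment_eq fun k => by rw [hnorm, hx]
  have hm' : (⟨_, hz.1⟩ : P.carrier) = x := Subtype.ext hm
  rw [chartPoint, hm']
  refine mkPoint_eq ?_
  rw [chartAngle, ← Finset.sum_sub_distrib]
  refine sum_mem fun k _ => ?_
  rw [← sub_smul]
  rcases (hr k).eq_or_lt with h0 | h0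
  · exact smul_normalVec_mem (by rw [hx, ← h0]; simp) _
  · have h1 := Complex.arg_mul_cos_add_sin_mul_I_coe_angle h0 (φ k : Real.Angle)
    rw [Real.Angle.cos_coe, Real.Angle.sin_coe, Complex.ofReal_cos, Complex.ofReal_sin,
      ← Complex.exp_mul_I, Real.Angle.angle_eq_iff_two_pi_dvd_sub] at h1
    obtain ⟨m, hm⟩ := h1
    rw [hm, show 2 * Real.pi * (m : ℝ) = (m : ℝ) * (2 * Real.pi) by ring]
    exact two_pi_smul_normalVec_mem _ _ m

theorem pullbackMetric_eq (u : EuclideanSpace ℝ (Fin 2) → ℝ) (a : Fin 2 → Fin P.d)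
    (w z : Fin 2 → ℂ) : P.pullbackMetric u a w z =
      ((P.cornerMatrix a)⁻¹ *ᵥ fun k => ((starRingEnd ℂ) (z k) * w k).re) ⬝ᵥ
        (hess u (P.chartMoment a z) *ᵥ
          ((P.cornerMatrix a)⁻¹ *ᵥ fun k => ((starRingEnd ℂ) (z k) * w k).re)) +
      ((P.cornerMatrix a)ᵀ *ᵥ fun k => (w k / z k).im) ⬝ᵥ
        (invHess u (P.chartMoment a z) *ᵥ ((P.cornerMatrix a)ᵀ *ᵥ fun k => (w k / z k).im)) := by
  rw [pullbackMetric, metric_eq, Matrix.fromBlocks_mulVec, chartDiff]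
  have e : (actionPart (WithLp.toLp 2 (Sum.elim (P.chartMoment a z) (P.chartAngle a z))) :
    EuclideanSpace ℝ (Fin 2)) = P.chartMoment a z := rfl
  rw [e]
  simp

theorem continuous_chartMoment (a : Fin 2 → Fin P.d) : Continuous (P.chartMoment a) := by
  refine (PiLp.continuous_toLp 2 _).comp (Continuous.matrix_mulVec continuous_const ?_)
  fun_prop

theorem IsSymplecticPotential.continuousAt_pullbackMetric (hu : P.IsSymplecticPotential u)
    (a : Fin 2 → Fin P.d) (w : Fin 2 → ℂ) {z : Fin 2 → ℂ} (hz : ∀ k, z k ≠ 0)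
    (hpos : ∀ i, 0 < P.l i (P.chartMoment a z)) : ContinuousAt (P.pullbackMetric u a w) z := by
  have e : P.pullbackMetric u a w = _ := funext fun z => pullbackMetric_eq u a w z
  rw [e]
  have hm : ContinuousAt (P.chartMoment a) z := (continuous_chartMoment a).continuousAt
  have h1 : ∀ i j, ContinuousAt (fun z => hess u (P.chartMoment a z) i j) z := fun i j =>
    ContinuousAt.comp (f := P.chartMoment a) (g := fun x => hess u x i j)
      (hu.contDiffAt_hess hpos i j).continuousAt hm
  have h2 : ∀ i j, ContinuousAt (fun z => invHess u (P.chartMoment a z) i j) z := fun i j =>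
    ContinuousAt.comp (f := P.chartMoment a) (g := fun x => invHess u x i j)
      (hu.contDiffAt_invHess hpos i j).continuousAt hm
  have h3 : ∀ k, ContinuousAt (fun z : Fin 2 → ℂ => ((starRingEnd ℂ) (z k) * w k).re) z := by
    intro k
    have : Continuous (fun z : Fin 2 → ℂ => ((starRingEnd ℂ) (z k) * w k).re) :=
      Complex.continuous_re.comp ((Complex.continuous_conj.comp (continuous_apply k)).mul
        continuous_const)
    exact this.continuousAt
  have h4 : ∀ k, ContinuousAt (fun z : Fin 2 → ℂ => (w k / z k).im) z := fun k =>
    Complex.continuous_im.continuousAt.comp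
      (continuousAt_const.div (continuous_apply k).continuousAt (hz k))
  simp only [dotProduct, Matrix.mulVec, Fin.sum_univ_two]
  fun_prop

/-- A path `x` in the polygon, interior except for its endpoints, which lifts to a path with
constant angles in the coordinates at a corner; `r k` is the absolute value of the `k`-th
coordinate, and `ρ` is a function whose derivative bounds the speed. -/
structure ChartPath (P : DelzantPolygon) (u : EuclideanSpace ℝ (Fin 2) → ℝ) (a : Fin 2 → Fin P.d)
    (x x' : ℝ → EuclideanSpace ℝ (Fin 2)) (r : Fin 2 → ℝ → ℝ) (ρ ρ' : ℝ → ℝ) : Prop where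
  corner : P.IsCorner a
  contDiffOn : ∀ k, ContDiffOn ℝ 1 (r k) (Icc 0 1)
  nonneg : ∀ k, ∀ t ∈ Icc (0 : ℝ) 1, 0 ≤ r k t
  l_eq : ∀ k, ∀ t ∈ Icc (0 : ℝ) 1, P.l (a k) (x t) = r k t ^ 2 / 2
  mem : ∀ t ∈ Icc (0 : ℝ) 1, x t ∈ P.carrier
  pos_of_notMem : ∀ t ∈ Icc (0 : ℝ) 1, ∀ k, k ∉ range a → 0 < P.l k (x t)
  pos : ∀ t ∈ Ioo (0 : ℝ) 1, ∀ i, 0 < P.l i (x t)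
  hasDerivAt : ∀ t ∈ Ioo (0 : ℝ) 1, HasDerivAt x (x' t) t
  continuousOn : ContinuousOn ρ (Icc 0 1)
  hasDerivAt_bound : ∀ t ∈ Ioo (0 : ℝ) 1, HasDerivAt ρ (ρ' t) t
  bound_nonneg : ∀ t ∈ Ioo (0 : ℝ) 1, 0 ≤ ρ' t
  D2_le : ∀ t ∈ Ioo (0 : ℝ) 1, D2 u (x t) (x' t) (x' t) ≤ ρ' t ^ 2

namespace ChartPath

variable {a : Fin 2 → Fin P.d} {x x' : ℝ → EuclideanSpace ℝ (Fin 2)} {r : Fin 2 → ℝ → ℝ}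
  {ρ ρ' : ℝ → ℝ}

theorem reverse (h : P.ChartPath u a x x' r ρ ρ') :
    P.ChartPath u a (fun t => x (1 - t)) (fun t => -x' (1 - t)) (fun k t => r k (1 - t))
      (fun t => -ρ (1 - t)) (fun t => ρ' (1 - t)) := by
  have hI : ∀ t ∈ Icc (0 : ℝ) 1, 1 - t ∈ Icc (0 : ℝ) 1 := fun t ht =>
    ⟨by linarith [ht.2], by linarith [ht.1]⟩
  have hI' : ∀ t ∈ Ioo (0 : ℝ) 1, 1 - t ∈ Ioo (0 : ℝ) 1 := fun t ht =>
    ⟨by linarith [ht.2], by linarith [ht.1]⟩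
  have hd : ∀ t : ℝ, HasDerivAt (fun t : ℝ => 1 - t) (-1) t := fun t => by
    simpa using (hasDerivAt_id t).const_sub 1
  refine ⟨h.corner, fun k => ?_, fun k t ht => h.nonneg k _ (hI t ht),
    fun k t ht => h.l_eq k _ (hI t ht), fun t ht => h.mem _ (hI t ht),
    fun t ht => h.pos_of_notMem _ (hI t ht), fun t ht => h.pos _ (hI' t ht), fun t ht => ?_,
    ?_, fun t ht => ?_, fun t ht => h.bound_nonneg _ (hI' t ht), fun t ht => ?_⟩
  · exact (h.contDiffOn k).comp (contDiff_const.sub contDiff_id).contDiffOn hI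
  · have := (h.hasDerivAt _ (hI' t ht)).scomp t (hd t)
    exact this.congr_deriv (by simp)
  · exact (h.continuousOn.comp (by fun_prop) hI).neg
  · have := ((h.hasDerivAt_bound _ (hI' t ht)).comp t (hd t)).neg
    exact this.congr_deriv (by simp)
  · have := h.D2_le _ (hI' t ht)
    simpa using this

/-- For constant angles `w k / z k` is real, so the angular part of the metric vanishes, while `Re
(conj z w) = r r'` is the derivative of `l = r² / 2`. At interior times both coordinates are
nonzero, where the extended metric equals the pull-back by continuity. -/
theorem chartMetric_eq (hu : P.IsSymplecticPotential u) (h : P.ChartPath u a x x' r ρ ρ')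
    (φ : Fin 2 → ℝ) {t : ℝ} (ht : t ∈ Ioo (0 : ℝ) 1) :
    P.chartMetric u a (fun k => (r k t : ℂ) * Complex.exp (φ k * Complex.I))
      (derivWithin (fun t k => (r k t : ℂ) * Complex.exp (φ k * Complex.I)) (Icc 0 1) t) =
      D2 u (x t) (x' t) (x' t) := by
  have htI := Ioo_subset_Icc_self ht
  have hnhds : Icc (0 : ℝ) 1 ∈ 𝓝 t := Icc_mem_nhds ht.1 ht.2
  set e : Fin 2 → ℂ := fun k => Complex.exp (φ k * Complex.I) with he
  have henorm : ∀ k, ‖e k‖ = 1 := fun k => Complex.norm_exp_ofReal_mul_I _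
  have he0 : ∀ k, e k ≠ 0 := fun k => Complex.exp_ne_zero _
  have hrd : ∀ k, HasDerivAt (r k) (deriv (r k) t) t := fun k =>
    (((h.contDiffOn k).differentiableOn (by simp) t htI).differentiableAt hnhds).hasDerivAt
  have hγ : HasDerivAt (fun (t : ℝ) (k : Fin 2) => (r k t : ℂ) * e k)
      (fun k => ((deriv (r k) t : ℝ) : ℂ) * e k) t :=
    hasDerivAt_pi.2 fun k => (hrd k).ofReal_comp.mul_const (e k)
  change P.chartMetric u a (fun k => (r k t : ℂ) * e k)
    (derivWithin (fun (t : ℝ) (k : Fin 2) => (r k t : ℂ) * e k) (Icc 0 1) t) = _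
  rw [hγ.hasDerivWithinAt.derivWithin (uniqueDiffOn_Icc zero_lt_one t htI)]
  have hrpos : ∀ k, 0 < r k t := by
    intro k
    refine (h.nonneg k t htI).lt_of_ne' fun h0 => ?_
    have h1 := h.pos t ht (a k)
    rw [h.l_eq k t htI, h0] at h1
    simp at h1
  have hm : P.chartMoment a (fun k => (r k t : ℂ) * e k) = x t :=
    h.corner.chartMoment_eq fun k => by
      rw [h.l_eq k t htI, norm_mul, henorm, mul_one, Complex.norm_real,
        Real.norm_of_nonneg (hrpos k).le]
  have hne : ∀ k, (r k t : ℂ) * e k ≠ 0 := fun k =>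
    mul_ne_zero (Complex.ofReal_ne_zero.2 (hrpos k).ne') (he0 k)
  have hcont := hu.continuousAt_pullbackMetric a (fun k => ((deriv (r k) t : ℝ) : ℂ) * e k)
    (z := fun k => (r k t : ℂ) * e k) hne (by rw [hm]; exact h.pos t ht)
  have hmem : (fun k => (r k t : ℂ) * e k) ∈ {z : Fin 2 → ℂ | ∀ k, z k ≠ 0} := hne
  rw [chartMetric, extendFrom_eq (subset_closure hmem)
    (hcont.tendsto.mono_left nhdsWithin_le_nhds), pullbackMetric_eq, hm]
  have h1 : (fun k => ((starRingEnd ℂ) ((r k t : ℂ) * e k) * (((deriv (r k) t : ℝ) : ℂ) * e k)).re) =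
      fun k => P.dl (a k) (x' t) := by
    ext k
    have h2 : (starRingEnd ℂ) ((r k t : ℂ) * e k) * (((deriv (r k) t : ℝ) : ℂ) * e k) =
        ((r k t * deriv (r k) t : ℝ) : ℂ) := by
      have h3 : (starRingEnd ℂ) (e k) * e k = 1 := by
        rw [← Complex.normSq_eq_conj_mul_self, Complex.normSq_eq_norm_sq, henorm]; simp
      rw [map_mul, Complex.conj_ofReal, Complex.ofReal_mul]
      linear_combination (r k t : ℂ) * ((deriv (r k) t : ℝ) : ℂ) * h3
    rw [h2, Complex.ofReal_re]
    have h4 : HasDerivAt (fun t => P.l (a k) (x t)) (P.dl (a k) (x' t)) t :=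
      (hasFDerivAt_l (a k) (x t)).comp_hasDerivAt t (h.hasDerivAt t ht)
    have h5 : HasDerivAt (fun t => P.l (a k) (x t)) (r k t * deriv (r k) t) t := by
      have h6 : HasDerivAt (fun t => r k t ^ 2 / 2) (r k t * deriv (r k) t) t := by
        refine (((hrd k).pow 2).div_const 2).congr_deriv ?_
        simp; ring
      refine h6.congr_of_eventuallyEq ?_
      filter_upwards [hnhds] with s hs using h.l_eq k s hs
    exact h5.unique h4
  have h2 : (fun k => (((deriv (r k) t : ℝ) : ℂ) * e k / ((r k t : ℂ) * e k)).im) = 0 := by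
    ext k
    rw [mul_div_mul_right _ _ (he0 k), ← Complex.ofReal_div, Complex.ofReal_im]
    rfl
  rw [h1, h2, h.corner.cornerMatrix_inv_mulVec, Matrix.mulVec_zero, zero_dotProduct, add_zero,
    hu.dotProduct_hess (h.pos t ht)]

theorem chartLength_le (hu : P.IsSymplecticPotential u) (h : P.ChartPath u a x x' r ρ ρ')
    (φ : Fin 2 → ℝ) :
    P.chartLength u a (fun t k => (r k t : ℂ) * Complex.exp (φ k * Complex.I)) ≤
      ENNReal.ofReal (ρ 1 - ρ 0) := by
  -- Nonnegativity of `ρ'` and continuity of `ρ` up to the endpoints give integrability, so `ρ` need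
  -- not be differentiable at the endpoints.
  have hint : IntegrableOn ρ' (Ioc 0 1) :=
    intervalIntegral.integrableOn_deriv_of_nonneg h.continuousOn h.hasDerivAt_bound h.bound_nonneg
  have hFTC : ∫ t in (0 : ℝ)..1, ρ' t = ρ 1 - ρ 0 :=
    intervalIntegral.integral_eq_sub_of_hasDerivAt_of_le zero_le_one h.continuousOn
      h.hasDerivAt_bound ((intervalIntegrable_iff_integrableOn_Ioc_of_le zero_le_one).2 hint)
  rw [chartLength, restrict_Ioo_eq_restrict_Icc.symm]
  calc _ ≤ ∫⁻ t in Ioo (0 : ℝ) 1, ENNReal.ofReal (ρ' t) := by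
        refine setLIntegral_mono' measurableSet_Ioo fun t ht => ENNReal.ofReal_le_ofReal ?_
        rw [h.chartMetric_eq hu φ ht]
        exact Real.sqrt_le_iff.2 ⟨h.bound_nonneg t ht, h.D2_le t ht⟩
    _ = ENNReal.ofReal (∫ t in Ioo (0 : ℝ) 1, ρ' t) := by
        refine (ofReal_integral_eq_lintegral_ofReal (hint.mono_set Ioo_subset_Ioc_self) ?_).symm
        exact (ae_restrict_iff' measurableSet_Ioo).2 (Eventually.of_forall h.bound_nonneg)
    _ = ENNReal.ofReal (ρ 1 - ρ 0) := by
        rw [← hFTC, intervalIntegral.integral_of_le zero_le_one, integral_Ioc_eq_integral_Ioo]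

theorem exists_hasCurve (hu : P.IsSymplecticPotential u) (h : P.ChartPath u a x x' r ρ ρ')
    (θ : EuclideanSpace ℝ (Fin 2)) (p q : P.carrier) (hp : x 0 = p) (hq : x 1 = q) :
    ∃ L ≤ ENNReal.ofReal (ρ 1 - ρ 0), P.HasCurve u (P.mkPoint p θ) (P.mkPoint q θ) L := by
  obtain ⟨φ, rfl⟩ := h.corner.exists_angles θ
  set γ : ℝ → Fin 2 → ℂ := fun t k => (r k t : ℂ) * Complex.exp (φ k * Complex.I) with hγ
  have hcd : ContDiffOn ℝ 1 γ (Icc 0 1) := by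
    refine contDiffOn_pi.2 fun k => ContDiffOn.mul ?_ contDiffOn_const
    exact Complex.ofRealCLM.contDiff.comp_contDiffOn (h.contDiffOn k)
  have hm : ∀ t ∈ Icc (0 : ℝ) 1, P.chartMoment a (γ t) = x t := fun t ht =>
    h.corner.chartMoment_eq fun k => by
      rw [h.l_eq k t ht, hγ, norm_mul, Complex.norm_exp_ofReal_mul_I, mul_one, Complex.norm_real,
        Real.norm_of_nonneg (h.nonneg k t ht)]
  have hD : ∀ t ∈ Icc (0 : ℝ) 1, γ t ∈ P.chartDomain a := by
    intro t ht
    refine ⟨?_, ?_⟩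
    · rw [hm t ht]; exact h.mem t ht
    · rw [hm t ht]; exact h.pos_of_notMem t ht
  have h0 : (0 : ℝ) ∈ Icc (0 : ℝ) 1 := left_mem_Icc.2 zero_le_one
  have h1 : (1 : ℝ) ∈ Icc (0 : ℝ) 1 := right_mem_Icc.2 zero_le_one
  have e0 : P.chartPoint a (γ 0) (hD 0 h0) = P.mkPoint p (∑ k, φ k • P.normalVec (a k)) :=
    chartPoint_eq_mkPoint h.corner (fun k => h.nonneg k 0 h0)
      (fun k => by rw [← hp]; exact h.l_eq k 0 h0) (hD 0 h0)
  have e1 : P.chartPoint a (γ 1) (hD 1 h1) = P.mkPoint q (∑ k, φ k • P.normalVec (a k)) :=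
    chartPoint_eq_mkPoint h.corner (fun k => h.nonneg k 1 h1)
      (fun k => by rw [← hq]; exact h.l_eq k 1 h1) (hD 1 h1)
  refine ⟨P.chartLength u a γ + 0, ?_, ?_⟩
  · rw [add_zero]
    exact h.chartLength_le hu φ
  · rw [← e0, ← e1]
    exact HasCurve.cons a h.corner γ hcd hD (HasCurve.refl _)

end ChartPath

end DelzantPolygon

/-! ### Lengths of segments and gradient lines. -/

namespace DelzantPolygon

open CoordMetric Filter Topology

variable {P : DelzantPolygon} {u : EuclideanSpace ℝ (Fin 2) → ℝ}

theorem HasCurve.trans {p q s : P.Surface} {L M : ℝ≥0∞} (h : P.HasCurve u p q L)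
    (h' : P.HasCurve u q s M) : P.HasCurve u p s (L + M) := by
  induction h with
  | refl p => rwa [zero_add]
  | cons a ha γ hγ hD rest ih =>
    rw [add_assoc]
    exact HasCurve.cons a ha γ hγ hD (ih h')

/-- For all angles `θ` the points `(p, θ)` and `(q, θ)` of the toric surface are joined in both
directions by curves of length at most `C`. -/
def JoinedWithin (P : DelzantPolygon) (u : EuclideanSpace ℝ (Fin 2) → ℝ)
    (p q : EuclideanSpace ℝ (Fin 2)) (C : ℝ) : Prop :=
  ∃ (hp : p ∈ P.carrier) (hq : q ∈ P.carrier), ∀ θ,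
    (∃ L ≤ ENNReal.ofReal C, P.HasCurve u (P.mkPoint ⟨p, hp⟩ θ) (P.mkPoint ⟨q, hq⟩ θ) L) ∧
    ∃ L ≤ ENNReal.ofReal C, P.HasCurve u (P.mkPoint ⟨q, hq⟩ θ) (P.mkPoint ⟨p, hp⟩ θ) L

namespace JoinedWithin

variable {p q s : EuclideanSpace ℝ (Fin 2)} {C D : ℝ}

theorem symm (h : P.JoinedWithin u p q C) : P.JoinedWithin u q p C := by
  obtain ⟨hp, hq, h⟩ := h
  exact ⟨hq, hp, fun θ => (h θ).symm⟩

theorem mono (h : P.JoinedWithin u p q C) (hCD : C ≤ D) : P.JoinedWithin u p q D := by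
  obtain ⟨hp, hq, h⟩ := h
  refine ⟨hp, hq, fun θ => ?_⟩
  obtain ⟨⟨L, hL, hc⟩, L', hL', hc'⟩ := h θ
  have := ENNReal.ofReal_le_ofReal hCD
  exact ⟨⟨L, hL.trans this, hc⟩, L', hL'.trans this, hc'⟩

theorem trans (h : P.JoinedWithin u p q C) (h' : P.JoinedWithin u q s D) (hC : 0 ≤ C)
    (hD : 0 ≤ D) : P.JoinedWithin u p s (C + D) := by
  obtain ⟨hp, hq, h⟩ := h
  obtain ⟨_, hs, h'⟩ := h'
  refine ⟨hp, hs, fun θ => ?_⟩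
  obtain ⟨⟨L, hL, hc⟩, M, hM, hd⟩ := h θ
  obtain ⟨⟨L', hL', hc'⟩, M', hM', hd'⟩ := h' θ
  rw [ENNReal.ofReal_add hC hD]
  exact ⟨⟨L + L', add_le_add hL hL', hc.trans hc'⟩,
    ⟨M' + M, (add_comm M' M).le.trans (add_le_add hM hM'), hd'.trans hd⟩⟩

end JoinedWithin

/-- Lifts the path by `|z_k| = √(2 l)`. Regularity of these square roots is a separate hypothesis
because it can fail where the path meets a facet. The opposite direction is the same lift run
backwards. -/
theorem JoinedWithin.of_path (hu : P.IsSymplecticPotential u) {a : Fin 2 → Fin P.d}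
    (ha : P.IsCorner a) {x x' : ℝ → EuclideanSpace ℝ (Fin 2)} {ρ ρ' : ℝ → ℝ}
    (hr : ∀ k, ContDiffOn ℝ 1 (fun t => √(2 * P.l (a k) (x t))) (Icc 0 1))
    (hmem : ∀ t ∈ Icc (0 : ℝ) 1, x t ∈ P.carrier)
    (hnot : ∀ t ∈ Icc (0 : ℝ) 1, ∀ k, k ∉ range a → 0 < P.l k (x t))
    (hpos : ∀ t ∈ Ioo (0 : ℝ) 1, ∀ i, 0 < P.l i (x t))
    (hx : ∀ t ∈ Ioo (0 : ℝ) 1, HasDerivAt x (x' t) t) (hρ : ContinuousOn ρ (Icc 0 1))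
    (hρ' : ∀ t ∈ Ioo (0 : ℝ) 1, HasDerivAt ρ (ρ' t) t) (h0 : ∀ t ∈ Ioo (0 : ℝ) 1, 0 ≤ ρ' t)
    (hD : ∀ t ∈ Ioo (0 : ℝ) 1, D2 u (x t) (x' t) (x' t) ≤ ρ' t ^ 2) :
    P.JoinedWithin u (x 0) (x 1) (ρ 1 - ρ 0) := by
  have h : P.ChartPath u a x x' (fun k t => √(2 * P.l (a k) (x t))) ρ ρ' :=
    ⟨ha, hr, fun _ _ _ => Real.sqrt_nonneg _, fun k t ht => by
      rw [Real.sq_sqrt (mul_nonneg zero_le_two (hmem t ht (a k)))]; ring,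
      hmem, hnot, hpos, hx, hρ, hρ', h0, hD⟩
  have hp := hmem 0 (left_mem_Icc.2 zero_le_one)
  have hq := hmem 1 (right_mem_Icc.2 zero_le_one)
  refine ⟨hp, hq, fun θ => ⟨h.exists_hasCurve hu θ ⟨_, hp⟩ ⟨_, hq⟩ rfl rfl, ?_⟩⟩
  have := h.reverse.exists_hasCurve hu θ ⟨_, hq⟩ ⟨_, hp⟩ (by simp) (by simp)
  simpa [neg_add_eq_sub] using this

theorem contDiffOn_sqrt_l {x : ℝ → EuclideanSpace ℝ (Fin 2)} {s : Set ℝ}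
    (hx : ContDiffOn ℝ 1 x s) {i : Fin P.d} (hpos : ∀ t ∈ s, 0 < P.l i (x t)) :
    ContDiffOn ℝ 1 (fun t => √(2 * P.l i (x t))) s := by
  have h1 : ContDiffOn ℝ 1 (fun t => 2 * P.l i (x t)) s :=
    contDiffOn_const.mul (((contDiff_l i).of_le (by exact_mod_cast le_top)).comp_contDiffOn hx)
  exact h1.sqrt fun t ht => (mul_pos two_pos (hpos t ht)).ne'

/-- Every point of `P` lies in the domain of some corner chart: a vertex in its own, a point inside
an edge in that of a vertex of this edge, an interior point in any. -/
theorem exists_isCorner {p : EuclideanSpace ℝ (Fin 2)} (hp : p ∈ P.carrier) :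
    ∃ a, P.IsCorner a ∧ ∀ k, k ∉ range a → 0 < P.l k p := by
  have key : ∀ i j, i ≠ j → (∃ v ∈ P.carrier, P.l i v = 0 ∧ P.l j v = 0) →
      (∀ k, P.l k p = 0 → k = i ∨ k = j) → ∃ a, P.IsCorner a ∧ ∀ k, k ∉ range a → 0 < P.l k p := by
    intro i j hij hv h
    refine ⟨![i, j], ⟨hij, hv⟩, fun k hk => (hp k).lt_of_ne' fun h0 => hk ?_⟩
    rcases h k h0 with rfl | rfl
    · exact ⟨0, rfl⟩
    · exact ⟨1, rfl⟩
  by_cases h : ∃ i, P.l i p = 0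
  · obtain ⟨i, hi⟩ := h
    by_cases h2 : ∃ j, i ≠ j ∧ P.l j p = 0
    · obtain ⟨j, hij, hj⟩ := h2
      exact key i j hij ⟨p, hp, hi, hj⟩ (P.delzant p hp i j hij hi hj).2
    · push Not at h2
      obtain ⟨j, hij, hv⟩ := P.exists_vertex_of_facet hp hi
      exact key i j hij hv fun k hk => Or.inl (by_contra fun h => h2 k (Ne.symm h) hk)
  · push Not at h
    obtain ⟨i, j, hij, hv⟩ := P.exists_vertex
    exact key i j hij hv fun k hk => absurd hk (h k)

theorem JoinedWithin.of_interior_path (hu : P.IsSymplecticPotential u)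
    {x x' : ℝ → EuclideanSpace ℝ (Fin 2)} {ρ ρ' : ℝ → ℝ} (hc : ContDiffOn ℝ 1 x (Icc 0 1))
    (hpos : ∀ t ∈ Icc (0 : ℝ) 1, ∀ i, 0 < P.l i (x t))
    (hx : ∀ t ∈ Icc (0 : ℝ) 1, HasDerivAt x (x' t) t)
    (hρ' : ∀ t ∈ Icc (0 : ℝ) 1, HasDerivAt ρ (ρ' t) t) (h0 : ∀ t ∈ Ioo (0 : ℝ) 1, 0 ≤ ρ' t)
    (hD : ∀ t ∈ Ioo (0 : ℝ) 1, D2 u (x t) (x' t) (x' t) ≤ ρ' t ^ 2) :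
    P.JoinedWithin u (x 0) (x 1) (ρ 1 - ρ 0) := by
  obtain ⟨i, j, hij, hv⟩ := P.exists_vertex
  have ha : P.IsCorner ![i, j] := ⟨hij, hv⟩
  exact JoinedWithin.of_path hu ha (fun k => contDiffOn_sqrt_l hc fun t ht => hpos t ht _)
    (fun t ht i => (hpos t ht i).le) (fun t ht k _ => hpos t ht k)
    (fun t ht => hpos t (Ioo_subset_Icc_self ht)) (fun t ht => hx t (Ioo_subset_Icc_self ht))
    (fun t ht => (hρ' t ht).continuousAt.continuousWithinAt)
    (fun t ht => hρ' t (Ioo_subset_Icc_self ht)) h0 hD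

theorem pos_lineMap {p q : EuclideanSpace ℝ (Fin 2)} {i : Fin P.d} (hp : 0 < P.l i p)
    (hq : 0 < P.l i q) {t : ℝ} (ht : t ∈ Icc (0 : ℝ) 1) : 0 < P.l i (p + t • (q - p)) := by
  rw [P.l_add_smul, dl_sub]
  rcases ht.2.eq_or_lt with h | h
  · rw [h]; linarith
  · nlinarith [mul_pos (sub_pos.2 h) hp, mul_nonneg ht.1 hq.le]

/-- Two interior points are joined by a segment, whose length is controlled by the derivatives of
`u` at the endpoints. -/
theorem JoinedWithin.segment (hu : P.IsSymplecticPotential u) {p q : EuclideanSpace ℝ (Fin 2)}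
    (hp : ∀ i, 0 < P.l i p) (hq : ∀ i, 0 < P.l i q) :
    P.JoinedWithin u p q ((1 + fderiv ℝ u q (q - p) - fderiv ℝ u p (q - p)) / 2) := by
  have hpos : ∀ t ∈ Icc (0 : ℝ) 1, ∀ i, 0 < P.l i (p + t • (q - p)) := fun t ht i =>
    pos_lineMap (hp i) (hq i) ht
  have hnn : ∀ t ∈ Icc (0 : ℝ) 1, 0 ≤ D2 u (p + t • (q - p)) (q - p) (q - p) := by
    intro t ht
    rcases eq_or_ne (q - p) 0 with h | h
    · simp [h]
    · exact (hu.D2_pos (hpos t ht) h).le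
  have h := JoinedWithin.of_interior_path hu (x := fun t => p + t • (q - p)) (x' := fun _ => q - p)
    -- By `√D ≤ (1 + D) / 2` the length is bounded by an integral of the second derivative, which
    -- telescopes to first derivatives.
    (ρ := fun t => (t + fderiv ℝ u (p + t • (q - p)) (q - p)) / 2)
    (ρ' := fun t => (1 + D2 u (p + t • (q - p)) (q - p) (q - p)) / 2)
    (by fun_prop) hpos (fun t _ => by
      simpa using ((hasDerivAt_id t).smul_const (q - p)).const_add p)
    (fun t ht => ((hasDerivAt_id t).add (hu.hasDerivAt_fderiv_line (hpos t ht))).div_const 2)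
    (fun t ht => by linarith [hnn t (Ioo_subset_Icc_self ht)])
    (fun t ht => by
      nlinarith [sq_nonneg (1 - D2 u (p + t • (q - p)) (q - p) (q - p))])
  simp only [one_smul, zero_smul, add_zero, add_sub_cancel, zero_add] at h
  exact h.mono (by linarith)

/-- The length of a gradient line along which the squared norm of the gradient of `m` is at least
`m`. -/
theorem JoinedWithin.flow (hu : P.IsSymplecticPotential u) {n : Fin 2 → ℝ}
    {X : ℝ → EuclideanSpace ℝ (Fin 2)} (hpos : ∀ s i, 0 < P.l i (X s))
    (hX : ∀ s, HasDerivAt X (WithLp.toLp 2 (gradVec u n (X s))) s) {m : ℝ → ℝ}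
    (hm : ∀ s, HasDerivAt m (gradSq u n (X s)) s) {s₀ s₁ : ℝ} (hs : s₀ ≤ s₁)
    (hm0 : ∀ s ∈ Icc s₀ s₁, 0 < m s) (hle : ∀ s ∈ Icc s₀ s₁, m s ≤ gradSq u n (X s)) :
    P.JoinedWithin u (X s₀) (X s₁) (2 * √(m s₁)) := by
  set h := s₁ - s₀ with hh
  have h0 : 0 ≤ h := sub_nonneg.2 hs
  have hI : ∀ t ∈ Icc (0 : ℝ) 1, s₀ + t * h ∈ Icc s₀ s₁ := fun t ht =>
    ⟨by nlinarith [ht.1], by nlinarith [mul_le_mul_of_nonneg_right ht.2 h0]⟩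
  have hlin : ∀ t, HasDerivAt (fun t => s₀ + t * h) h t := fun t => by
    simpa using ((hasDerivAt_id t).mul_const h).const_add s₀
  have hXc : ContDiff ℝ 1 X := by
    refine contDiff_one_iff_deriv.2 ⟨fun s => (hX s).differentiableAt, ?_⟩
    have e : deriv X = fun s => WithLp.toLp 2 (gradVec u n (X s)) := funext fun s => (hX s).deriv
    rw [e]
    refine continuous_iff_continuousAt.2 fun s => ?_
    have h1 : ContinuousAt (fun s => gradVec u n (X s)) s :=
      continuousAt_pi.2 fun k => ContinuousAt.comp (f := X) (g := fun x => gradVec u n x k)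
        (hu.contDiffAt_gradVec (hpos s) n k).continuousAt (hX s).continuousAt
    exact (PiLp.continuous_toLp 2 _).continuousAt.comp h1
  have hD : ∀ s, D2 u (X s) (WithLp.toLp 2 (gradVec u n (X s)))
      (WithLp.toLp 2 (gradVec u n (X s))) = gradSq u n (X s) := by
    intro s
    rw [← hu.dotProduct_hess (hpos s), hu.hess_mulVec_gradVec (hpos s), gradSq, dotProduct_comm]
  have key := JoinedWithin.of_interior_path hu (x := fun t => X (s₀ + t * h))
    (x' := fun t => h • WithLp.toLp 2 (gradVec u n (X (s₀ + t * h))))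
    -- The curve has speed `h √f`, and `√f ≤ f / √m = (2 √m)'` because `m ≤ f`.
    (ρ := fun t => 2 * √(m (s₀ + t * h)))
    (ρ' := fun t => h * gradSq u n (X (s₀ + t * h)) / √(m (s₀ + t * h)))
    (hXc.comp (by fun_prop)).contDiffOn (fun t _ => hpos _)
    (fun t _ => (hX _).scomp t (hlin t))
    (fun t ht => by
      have h1 := (((hm (s₀ + t * h)).comp t (hlin t)).sqrt (hm0 _ (hI t ht)).ne').const_mul 2
      refine h1.congr_deriv ?_
      have := Real.sqrt_pos.2 (hm0 _ (hI t ht))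
      simp only [Function.comp]
      field_simp)
    (fun t ht => by
      have ht' := Ioo_subset_Icc_self ht
      have := (hm0 _ (hI t ht')).le.trans (hle _ (hI t ht'))
      positivity)
    (fun t ht => by
      have ht' := Ioo_subset_Icc_self ht
      have h1 := hm0 _ (hI t ht')
      have h2 := hle _ (hI t ht')
      simp only [map_smul, FunLike.coe_smul, Pi.smul_apply, hD, smul_eq_mul]
      rw [div_pow, Real.sq_sqrt h1.le, le_div_iff₀ h1]
      have h3 := mul_le_mul_of_nonneg_left h2 (h1.le.trans h2)
      nlinarith [mul_le_mul_of_nonneg_left h3 (sq_nonneg h)])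
  simp only [zero_mul, add_zero, one_mul, hh, add_sub_cancel] at key
  exact key.mono (by linarith [Real.sqrt_nonneg (m s₀)])

end DelzantPolygon

/-! ### Reaching boundary points, and the bound for the diameter. -/

namespace DelzantPolygon

open CoordMetric Filter Topology

variable {P : DelzantPolygon} {u : EuclideanSpace ℝ (Fin 2) → ℝ}

/-- A path `p + t² (q - p)` from a boundary point to an interior point. -/
theorem JoinedWithin.of_mem_carrier (hu : P.IsSymplecticPotential u) {B : ℝ}
    (hB : ∀ x, (∀ i, 0 < P.l i x) → ∀ w, D2 u x w w ≤ B * ‖w‖ ^ 2 +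
      ∑ i, (1 / 2) * ((P.dl i w) ^ 2 / P.l i x)) (hB0 : 0 ≤ B)
    {p q : EuclideanSpace ℝ (Fin 2)} (hp : p ∈ P.carrier) (hq : ∀ i, 0 < P.l i q)
    (hle : 4 * (B * ‖q - p‖ ^ 2 + ∑ i, (1 / 2) * ((P.dl i (q - p)) ^ 2 / P.l i q)) ≤ 1) :
    P.JoinedWithin u p q 1 := by
  obtain ⟨a, ha, hap⟩ := P.exists_isCorner hp
  have hl : ∀ t i, P.l i (p + t ^ 2 • (q - p)) = P.l i p + t ^ 2 * (P.l i q - P.l i p) := by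
    intro t i
    rw [P.l_add_smul, dl_sub]
  have hsq : ∀ t ∈ Icc (0 : ℝ) 1, t ^ 2 ∈ Icc (0 : ℝ) 1 := fun t ht =>
    ⟨sq_nonneg t, pow_le_one₀ ht.1 ht.2⟩
  have hpos : ∀ t ∈ Ioo (0 : ℝ) 1, ∀ i, 0 < P.l i (p + t ^ 2 • (q - p)) := fun t ht i =>
    P.pos_segment hq hp (pow_pos ht.1 2) (pow_le_one₀ ht.1.le ht.2.le) i
  have hcd : ContDiffOn ℝ 1 (fun t : ℝ => p + t ^ 2 • (q - p)) (Icc 0 1) := by fun_prop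
  have h := JoinedWithin.of_path hu ha (x := fun t => p + t ^ 2 • (q - p))
    (x' := fun t => (2 * t) • (q - p)) (ρ := fun t => t) (ρ' := fun _ => 1)
    -- With the parameter `t²` the chart coordinate of a facet through `p` is `t √(2 l(q))`, smooth
    -- up to `t = 0`; the factor `4 t²` in the squared speed compensates `l_i ≥ t² l_i(q)` in the
    -- denominators.
    (fun k => by
      rcases (hp (a k)).eq_or_lt with h0 | h0
      · have h1 : ContDiffOn ℝ 1 (fun t : ℝ => t * √(2 * P.l (a k) q)) (Icc 0 1) := by fun_prop
        refine h1.congr fun t ht => ?_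
        rw [hl, ← h0, sub_zero, zero_add,
          show 2 * (t ^ 2 * P.l (a k) q) = t ^ 2 * (2 * P.l (a k) q) by ring,
          Real.sqrt_mul (sq_nonneg t), Real.sqrt_sq ht.1]
      · exact contDiffOn_sqrt_l hcd fun t ht => pos_lineMap h0 (hq _) (hsq t ht))
    (fun t ht i => by
      rw [hl]
      nlinarith [mul_nonneg (hsq t ht).1 (hq i).le,
        mul_nonneg (sub_nonneg.2 (hsq t ht).2) (hp i)])
    (fun t ht k hk => pos_lineMap (hap k hk) (hq k) (hsq t ht)) hpos
    (fun t _ => by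
      simpa using ((hasDerivAt_pow 2 t).smul_const (q - p)).const_add p)
    continuousOn_id (fun t _ => hasDerivAt_id t) (fun _ _ => zero_le_one)
    (fun t ht => by
      have ht2 : 0 < t ^ 2 := pow_pos ht.1 2
      simp only [map_smul, FunLike.coe_smul, Pi.smul_apply, smul_eq_mul]
      have h1 := hB _ (hpos t ht) (q - p)
      have h2 : t ^ 2 * (B * ‖q - p‖ ^ 2 +
          ∑ i, (1 / 2) * ((P.dl i (q - p)) ^ 2 / P.l i (p + t ^ 2 • (q - p)))) ≤
          B * ‖q - p‖ ^ 2 + ∑ i, (1 / 2) * ((P.dl i (q - p)) ^ 2 / P.l i q) := by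
        rw [mul_add, Finset.mul_sum]
        refine add_le_add (mul_le_of_le_one_left (by positivity)
          (pow_le_one₀ ht.1.le ht.2.le)) (Finset.sum_le_sum fun i _ => ?_)
        have h3 : t ^ 2 * P.l i q ≤ P.l i (p + t ^ 2 • (q - p)) := by
          rw [hl]
          nlinarith [mul_nonneg (sub_nonneg.2 (hsq t (Ioo_subset_Icc_self ht)).2) (hp i)]
        have h4 : (P.dl i (q - p)) ^ 2 / P.l i (p + t ^ 2 • (q - p)) ≤
            (P.dl i (q - p)) ^ 2 / (t ^ 2 * P.l i q) :=
          div_le_div_of_nonneg_left (sq_nonneg _) (mul_pos ht2 (hq i)) h3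
        calc _ = 1 / 2 * (t ^ 2 * ((P.dl i (q - p)) ^ 2 / P.l i (p + t ^ 2 • (q - p)))) := by ring
          _ ≤ 1 / 2 * (t ^ 2 * ((P.dl i (q - p)) ^ 2 / (t ^ 2 * P.l i q))) := by gcongr
          _ = _ := by
            have := (hq i).ne'
            have := ht.1.ne'
            field_simp
      nlinarith [mul_le_mul_of_nonneg_left h1 ht2.le])
  simpa using h

theorem eventually_joinedWithin (hu : P.IsSymplecticPotential u) {p : EuclideanSpace ℝ (Fin 2)}
    (hp : p ∈ P.carrier) :
    ∀ᶠ q in 𝓝[{q | ∀ i, 0 < P.l i q}] p, P.JoinedWithin u p q 1 := by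
  obtain ⟨B, hB0, hB⟩ := hu.exists_D2_le
  have hid : Tendsto (fun q => q) (𝓝[{q | ∀ i, 0 < P.l i q}] p) (𝓝 p) := nhdsWithin_le_nhds
  have h1 : ∀ i, Tendsto (fun q => (1 / 2) * ((P.dl i (q - p)) ^ 2 / P.l i q))
      (𝓝[{q | ∀ i, 0 < P.l i q}] p) (𝓝 0) := by
    intro i
    have hli : Tendsto (fun q => P.l i q) (𝓝[{q | ∀ i, 0 < P.l i q}] p) (𝓝 (P.l i p)) :=
      ((P.continuous_l i).tendsto p).comp hid
    rcases (hp i).eq_or_lt with h0 | h0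
    · have h2 : Tendsto (fun q => (1 / 2) * P.l i q) (𝓝[{q | ∀ i, 0 < P.l i q}] p) (𝓝 0) := by
        simpa [← h0] using hli.const_mul (1 / 2 : ℝ)
      refine h2.congr' ?_
      filter_upwards [self_mem_nhdsWithin] with q hq
      have := hq i
      rw [dl_sub, ← h0, sub_zero]
      field_simp
    · have h2 : Tendsto (fun q => P.dl i (q - p)) (𝓝[{q | ∀ i, 0 < P.l i q}] p) (𝓝 0) := by
        simp only [dl_sub]
        simpa using hli.sub_const (P.l i p)
      simpa using ((h2.pow 2).div hli h0.ne').const_mul (1 / 2 : ℝ)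
  have h2 : Tendsto (fun q => 4 * (B * ‖q - p‖ ^ 2 +
      ∑ i, (1 / 2) * ((P.dl i (q - p)) ^ 2 / P.l i q))) (𝓝[{q | ∀ i, 0 < P.l i q}] p) (𝓝 0) := by
    have h3 : Tendsto (fun q => B * ‖q - p‖ ^ 2) (𝓝[{q | ∀ i, 0 < P.l i q}] p) (𝓝 0) := by
      have : Continuous fun q => B * ‖q - p‖ ^ 2 := by fun_prop
      simpa using (this.tendsto p).mono_left nhdsWithin_le_nhds
    simpa using (h3.add (tendsto_finsetSum Finset.univ fun i _ => h1 i)).const_mul 4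
  filter_upwards [self_mem_nhdsWithin, h2.eventually_lt_const one_pos] with q hq hlt
  exact JoinedWithin.of_mem_carrier hu hB hB0 hp hq hlt.le

theorem mem_closure_pos {p : EuclideanSpace ℝ (Fin 2)} (hp : p ∈ P.carrier) :
    p ∈ closure {q | ∀ i, 0 < P.l i q} := by
  obtain ⟨c, hc⟩ := P.exists_pos
  have h1 : Tendsto (fun t : ℝ => p + t • (c - p)) (𝓝[>] 0) (𝓝 p) := by
    have : Continuous fun t : ℝ => p + t • (c - p) := by fun_prop
    simpa using (this.tendsto 0).mono_left nhdsWithin_le_nhds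
  refine mem_closure_of_tendsto h1 ?_
  filter_upwards [Ioo_mem_nhdsGT zero_lt_one] with t ht
  exact P.pos_segment hc hp ht.1 ht.2.le

theorem exists_joinedWithin_pos (hu : P.IsSymplecticPotential u) {p : EuclideanSpace ℝ (Fin 2)}
    (hp : p ∈ P.carrier) : ∃ q, (∀ i, 0 < P.l i q) ∧ P.JoinedWithin u p q 1 := by
  have := mem_closure_iff_nhdsWithin_neBot.1 (mem_closure_pos hp)
  exact ((eventually_mem_nhdsWithin).and (eventually_joinedWithin hu hp)).exists

/-- Points close to a vertex are at bounded distance from it. -/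
theorem joinedWithin_vertex (hu : P.IsSymplecticPotential u) {K δ : ℝ}
    (hK : P.CurvatureBoundedBy u K) (hδ : P.IsCurvatureScale K δ) {i j : Fin P.d} (hij : i ≠ j)
    {v : EuclideanSpace ℝ (Fin 2)} (hv : v ∈ P.carrier) (hi : P.l i v = 0) (hj : P.l j v = 0)
    {x : EuclideanSpace ℝ (Fin 2)} (hx : ∀ i, 0 < P.l i x) (hxδ : P.l i x + P.l j x ≤ δ) :
    P.JoinedWithin u x v (2 * √δ + 1) := by
  obtain ⟨X, hX0, hXpos, hXd, -, hm, hle, hsmall⟩ :=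
    hu.exists_flow_corner hK hδ hij hv hi hj hx hxδ
  obtain ⟨D, hD, hDv⟩ := exists_norm_sub_vertex_le hij hv hi hj
  -- The radius `ε` depends on `u`, but the remaining length `1` does not: the gradient line is
  -- simply followed until it enters this ball.
  obtain ⟨ε, hε, hball⟩ := Metric.mem_nhdsWithin_iff.1 (eventually_joinedWithin hu hv)
  obtain ⟨s, hs, hlt⟩ := hsmall 0 le_rfl (ε / (D + 1)) (by positivity)
  have hs' : P.JoinedWithin u v (X s) 1 := by
    refine hball ⟨?_, hXpos s⟩
    rw [mem_ball_iff_norm]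
    refine (hDv _ fun i => (hXpos s i).le).trans_lt ?_
    have h0 := add_pos (hXpos s i) (hXpos s j)
    rw [lt_div_iff₀ (by positivity)] at hlt
    nlinarith
  have hf := JoinedWithin.flow hu hXpos hXd hm hs (fun s _ => add_pos (hXpos s i) (hXpos s j))
    (fun s hs => hle s hs.2)
  rw [hX0] at hf
  have hf' : P.JoinedWithin u (X s) x (2 * √δ) :=
    hf.mono (mul_le_mul_of_nonneg_left (Real.sqrt_le_sqrt hxδ) zero_le_two)
  exact hf'.symm.trans hs'.symm (by positivity) zero_le_one

/-- From a point close to a facet the gradient line leads away from the facet. -/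
theorem exists_joinedWithin_level (hu : P.IsSymplecticPotential u) {K δ : ℝ}
    (hK : P.CurvatureBoundedBy u K) (hδ : P.IsCurvatureScale K δ) {η : ℝ} (hη : η ≤ δ)
    {i : Fin P.d} {x : EuclideanSpace ℝ (Fin 2)} (hx : ∀ i, 0 < P.l i x) (hxη : P.l i x ≤ η) :
    ∃ y, (∀ i, 0 < P.l i y) ∧ P.l i y = η ∧ P.JoinedWithin u x y (2 * √η) := by
  obtain ⟨X, hX0, hXpos, hXd, -⟩ := hu.exists_flow hx (P.nv i)
  have hm : ∀ s, HasDerivAt (fun s => P.l i (X s)) (gradSq u (P.nv i) (X s)) s := fun s =>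
    hasDerivAt_l_comp (hXd s) i
  have hmono : StrictMono fun s => P.l i (X s) :=
    strictMono_of_hasDerivAt_pos hm fun s => hu.gradSq_pos (hXpos s) (P.nv_ne_zero i)
  have hle : ∀ s, P.l i (X s) ≤ η → P.l i (X s) ≤ gradSq u (P.nv i) (X s) := fun s hs =>
    hδ.le_gradSq_facet u hu hK i _ (hXpos s) (hs.trans hη)
  have hcont : Continuous fun s => P.l i (X s) :=
    continuous_iff_continuousAt.2 fun s => (hm s).continuousAt
  obtain ⟨s₁, hs₁, hs₁η⟩ : ∃ s₁ ≥ 0, P.l i (X s₁) = η := by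
    -- As long as `l_i` stays below `η`, its derivative is at least its initial value, so it cannot
    -- stay below forever.
    obtain ⟨b, hb0, hb⟩ : ∃ b ≥ (0 : ℝ), η ≤ P.l i (X b) := by
      by_contra! hcon
      set m0 := P.l i (X 0) with hm0
      have hpos0 : 0 < m0 := hXpos 0 i
      have hgrow : ∀ s ≥ (0 : ℝ), m0 + s * m0 ≤ P.l i (X s) := by
        intro s hs
        have h1 : MonotoneOn (fun s => P.l i (X s) - s * m0) (Ici 0) := by
          refine monotoneOn_of_hasDerivWithinAt_nonneg (convex_Ici 0) ?_ (fun s hs => ?_)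
            (fun s hs => ?_) (f' := fun s => gradSq u (P.nv i) (X s) - m0)
          · exact (hcont.sub (by fun_prop)).continuousOn
          · have h3 := (hm s).sub ((hasDerivAt_id s).mul_const m0)
            rw [one_mul] at h3
            exact h3.hasDerivWithinAt
          · have hs0 : 0 ≤ s := interior_subset hs
            have := hle s (hcon s hs0).le
            have h2 : m0 ≤ P.l i (X s) := hmono.monotone hs0
            linarith
        have h2 := h1 (mem_Ici.2 le_rfl) (mem_Ici.2 hs) hs
        simp only [zero_mul, sub_zero] at h2
        linarith
      have hη0 : 0 < η := hpos0.trans (hcon 0 le_rfl)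
      have h1 := hgrow (η / m0) (by positivity)
      have h2 := hcon (η / m0) (div_nonneg hη0.le hpos0.le)
      rw [div_mul_cancel₀ _ hpos0.ne'] at h1
      linarith
    obtain ⟨s, hs, hse⟩ := intermediate_value_Icc hb0 hcont.continuousOn
      (show η ∈ Icc (P.l i (X 0)) (P.l i (X b)) from ⟨by rwa [hX0], hb⟩)
    exact ⟨s, hs.1, hse⟩
  refine ⟨X s₁, hXpos s₁, hs₁η, ?_⟩
  have h := JoinedWithin.flow hu hXpos hXd hm hs₁ (fun s _ => hXpos s i)
    (fun s hs => hle s ((hmono.monotone hs.2).trans hs₁η.le))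
  rwa [hX0, hs₁η] at h

/-- All points of the polygon are at uniformly bounded distance from a given interior point. -/
theorem exists_joinedWithin (P : DelzantPolygon) (K C : ℝ) :
    ∃ c ∈ P.carrier, ∃ D, 0 ≤ D ∧ ∀ u ∈ P.admissible C, P.CurvatureBoundedBy u K →
      ∀ p ∈ P.carrier, P.JoinedWithin u p c D := by
  obtain ⟨c, hc⟩ := P.exists_pos
  obtain ⟨δ, hδ⟩ := P.exists_curvatureScale K
  have hδ0 := hδ.pos
  set S := 1 + ∑ i, P.l i c with hS
  have hS1 : ∀ i, P.l i c ≤ S := by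
    intro i
    have := Finset.single_le_sum (fun i _ => (hc i).le) (Finset.mem_univ i)
      (f := fun i => P.l i c)
    linarith
  have hS0 : 1 ≤ S := by
    have := Finset.sum_nonneg (s := Finset.univ) fun i _ => (hc i).le
    linarith
  -- Chosen so that the points `v + s (c - v)` lie in the compact set `A` below for every `v` in
  -- `P`, and within the scale `δ` of `v` when `v` is a vertex.
  set s := min 1 (δ / (2 * S)) with hs
  have hs0 : 0 < s := lt_min one_pos (by positivity)
  have hs1 : s ≤ 1 := min_le_left _ _
  have hsδ : ∀ i, s * P.l i c ≤ δ / 2 := by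
    intro i
    have h1 : s ≤ δ / (2 * S) := min_le_right _ _
    calc s * P.l i c ≤ δ / (2 * S) * S := mul_le_mul h1 (hS1 i) (hc i).le (by positivity)
      _ = δ / 2 := by field_simp
  set A := {x | x ∈ P.carrier ∧ ∀ i, s * P.l i c ≤ P.l i x} with hA
  have hApos : ∀ x ∈ A, ∀ i, 0 < P.l i x := fun x hx i => (mul_pos hs0 (hc i)).trans_le (hx.2 i)
  have hAc : IsCompact A := by
    refine P.isCompact_carrier.inter_right ?_
    have e : {x | ∀ i, s * P.l i c ≤ P.l i x} = ⋂ i, {x | s * P.l i c ≤ P.l i x} := by ext; simp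
    change IsClosed {x | ∀ i, s * P.l i c ≤ P.l i x}
    rw [e]
    exact isClosed_iInter fun i => isClosed_le continuous_const (P.continuous_l i)
  have hcA : c ∈ A := ⟨fun i => (hc i).le, fun i => mul_le_of_le_one_left (hc i).le hs1⟩
  obtain ⟨B, hB, hbound⟩ := P.exists_bound_fderiv_compact hAc
    (fun x hx => P.mem_interior.2 (hApos x hx)) C
  set R := Metric.diam A
  have hR : 0 ≤ R := Metric.diam_nonneg
  set E := (1 + 2 * (B * R)) / 2 with hE
  have hE0 : 0 ≤ E := by positivity
  set V := 2 * √δ + 1 with hV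
  have hV0 : 0 ≤ V := by positivity
  set H := 2 * √(δ / 2) with hH
  have hH0 : 0 ≤ H := by positivity
  refine ⟨c, fun i => (hc i).le, 1 + (H + (V + (V + E))), by positivity, fun u hua hK p hp => ?_⟩
  have hu := hua.1
  have hAE : ∀ x ∈ A, P.JoinedWithin u x c E := by
    intro x hx
    refine (JoinedWithin.segment hu (hApos x hx) hc).mono ?_
    have h1 : ∀ y ∈ A, |fderiv ℝ u y (c - x)| ≤ B * R := by
      intro y hy
      have h2 : ‖c - x‖ ≤ R := by
        rw [← dist_eq_norm]
        exact Metric.dist_le_diam_of_mem hAc.isBounded hcA hx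
      exact ((fderiv ℝ u y).le_opNorm _).trans
        (mul_le_mul (hbound u hua y hy).2 h2 (norm_nonneg _) hB)
    have h2 := (abs_le.1 (h1 c hcA)).2
    have h3 := (abs_le.1 (h1 x hx)).1
    rw [hE]
    linarith
  have hvertex : ∀ i j, i ≠ j → ∀ v ∈ P.carrier, P.l i v = 0 → P.l j v = 0 →
      P.JoinedWithin u v c (V + E) := by
    intro i j hij v hv hi hj
    have hl : ∀ k, P.l k (v + s • (c - v)) = P.l k v + s * (P.l k c - P.l k v) := fun k => by
      rw [P.l_add_smul, dl_sub]
    have hq : v + s • (c - v) ∈ A := by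
      have h1 : ∀ k, s * P.l k c ≤ P.l k (v + s • (c - v)) := fun k => by
        rw [hl]
        nlinarith [mul_nonneg (sub_nonneg.2 hs1) (hv k)]
      exact ⟨fun k => (mul_pos hs0 (hc k)).le.trans (h1 k), h1⟩
    refine (joinedWithin_vertex hu hK hδ hij hv hi hj (hApos _ hq) ?_).symm.trans (hAE _ hq)
      hV0 hE0
    rw [hl, hl, hi, hj]
    linarith [hsδ i, hsδ j]
  have hnear : ∀ i j, i ≠ j → ∀ x, (∀ i, 0 < P.l i x) → P.l i x ≤ δ / 2 → P.l j x ≤ δ / 2 →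
      P.JoinedWithin u x c (V + (V + E)) := by
    intro i j hij x hx hi hj
    obtain ⟨v, hv, hvi, hvj⟩ := hδ.corner i j hij x (fun i => (hx i).le) (by linarith)
      (by linarith)
    exact (joinedWithin_vertex hu hK hδ hij hv hvi hvj hx (by linarith)).trans
      (hvertex i j hij v hv hvi hvj) hV0 (by positivity)
  have hmemA : ∀ x, (∀ i, 0 < P.l i x) → (∀ i, δ / 2 ≤ P.l i x) → x ∈ A := fun x hx h =>
    ⟨fun i => (hx i).le, fun i => (hsδ i).trans (h i)⟩
  -- Flow away from a near facet up to the level `δ / 2`. The end point is either in `A` or close to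
  -- a second facet; in the latter case it is near a vertex, from which the polygon's interior is
  -- reached through the vertex itself.
  have hmid : ∀ x, (∀ i, 0 < P.l i x) → P.JoinedWithin u x c (H + (V + (V + E))) := by
    intro x hx
    by_cases h : ∀ i, δ / 2 ≤ P.l i x
    · exact (hAE x (hmemA x hx h)).mono (by linarith)
    push Not at h
    obtain ⟨i, hi⟩ := h
    obtain ⟨y, hy, hyi, hxy⟩ := exists_joinedWithin_level hu hK hδ (by linarith) hx hi.le
    refine hxy.trans ?_ hH0 (by positivity)
    by_cases h : ∀ j, δ / 2 ≤ P.l j y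
    · exact (hAE y (hmemA y hy h)).mono (by linarith)
    push Not at h
    obtain ⟨j, hj⟩ := h
    have hij : i ≠ j := by
      rintro rfl
      exact hj.ne hyi
    exact hnear i j hij y hy hyi.le hj.le
  obtain ⟨q, hq, hpq⟩ := exists_joinedWithin_pos hu hp
  exact hpq.trans (hmid q hq) zero_le_one (by positivity)

theorem exists_bound_diameter (P : DelzantPolygon) (K C : ℝ) :
    ∃ D, ∀ u ∈ P.admissible C, P.CurvatureBoundedBy u K →
      P.diameter u ≤ ENNReal.ofReal D := by
  obtain ⟨c, hc, D, hD, h⟩ := P.exists_joinedWithin K C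
  obtain ⟨i, j, hij, v, hv, hi, hj⟩ := P.exists_vertex
  have ha : P.IsCorner ![i, j] := ⟨hij, v, hv, hi, hj⟩
  refine ⟨D + D + (D + D), fun u hua hK => iSup₂_le fun p q => ?_⟩
  induction p using Quotient.inductionOn with | _ p
  induction q using Quotient.inductionOn with | _ q
  obtain ⟨p, θ⟩ := p
  obtain ⟨q, θ'⟩ := q
  have hv' : ∀ p ∈ P.carrier, P.JoinedWithin u p v (D + D) := fun p hp =>
    (h u hua hK p hp).trans (h u hua hK v hv).symm hD hD
  obtain ⟨_, _, hp⟩ := hv' p p.2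
  obtain ⟨_, _, hq⟩ := hv' q q.2
  obtain ⟨⟨L, hL, hpc⟩, -⟩ := hp θ
  obtain ⟨-, M, hM, hqc⟩ := hq θ'
  -- The two constant-angle curves meet over the vertex `v`, where the angles no longer matter. Each
  -- passes through `c`, whence `D + D` for each of them.
  have e : P.mkPoint ⟨v, hv⟩ θ = P.mkPoint ⟨v, hv⟩ θ' := mkPoint_vertex_eq ha (fun k => by
    fin_cases k
    · exact hi
    · exact hj) θ θ'
  rw [e] at hpc
  rw [ENNReal.ofReal_add (by positivity) (by positivity)]
  exact (sInf_le (hpc.trans hqc)).trans (add_le_add hL hM)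

end DelzantPolygon

theorem theorem1p5 (P : DelzantPolygon) (C₁ C₂ : ℝ) :
    ∃ C : ℝ, ∀ (x₀ : EuclideanSpace ℝ (Fin 2)) (u : EuclideanSpace ℝ (Fin 2) → ℝ),
      P.IsSymplecticPotential u → P.IsNormalizedAt u x₀ →
      P.CurvatureBoundedBy u C₁ →
      (∫ x, u x ∂P.boundaryMeasure) < C₂ →
      P.diameter u ≤ ENNReal.ofReal C ∧ ∀ x ∈ P.carrier, u x ≤ C := by
  obtain ⟨B, hB⟩ := P.exists_bound_max C₁ C₂
  obtain ⟨D, hD⟩ := P.exists_bound_diameter C₁ C₂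
  refine ⟨max B D, fun x₀ u hu hx₀ hK hint => ?_⟩
  -- The normalization enters only here, as nonnegativity of `u`; the constants therefore do not
  -- depend on `x₀`.
  have hua : u ∈ P.admissible C₂ := ⟨hu, fun x hx => hu.nonneg_of_isNormalizedAt hx₀ hx, hint⟩
  exact ⟨(hD u hua hK).trans (ENNReal.ofReal_le_ofReal (le_max_right _ _)),
    fun x hx => (hB u hua hK x hx).trans (le_max_left _ _)⟩
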